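/- **Setting.** Let $R$ be a commutative ring and let $\Lambda,\Gamma$ be countable discrete groups. Let $\phi:\Lambda\to\Gamma$ be a uniform embedding: for all sequences $(\alpha_i),(\beta_i)$ in $\Lambda$, $\alpha_i^{-1}\beta_i\to\infty$ if and only if $\phi(\alpha_i)^{-1}\phi(\beta_i)\to\infty$ (where $\to\infty$ means eventually leaving every finite subset). Let $X$ be a chosen topological coupling of $\Lambda$ and $\Gamma$: a locally compact Hausdorff space with commuting, continuous, free and proper (left) actions of $\Lambda$ and $\Gamma$, together with a closed-open fundamental domain $X_\Lambda$ for $\Lambda$ and a compact-open fundamental domain $X_\Gamma$ for $\Gamma$ (each orbit meets its fundamental domain in exactly one point). Identify $X_\Lambda=\Lambda\backslash X$ and $X_\Gamma=\Gamma\backslash X$; thus $\Gamma$ acts on $X_\Lambda$ and $\Lambda$ acts on $X_\Gamma$. Let $A\subset X_\Gamma$ and $B\subset X_\Lambda$ be compact-open subsets meeting every $\Lambda$-orbit of $X_\Gamma$, respectively every $\Gamma$-orbit of $X_\Lambda$, such that the projection $X\to\Lambda\backslash X=X_\Lambda$ restricts to a bijection $f:A\to B$. For a group $G$ acting continuously on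 a space $Y$ let $\mathcal F(Y)=\mathcal F(Y;R)$ be the ring of locally constant functions $Y\to R$, with $f^\gamma(y)=f(\gamma^{-1}y)$, and let $R(Y\rtimes G)$ be the crossed product $\mathcal F(Y)\rtimes G$: the free $\mathcal F(Y)$-module with basis $G$ and $f\gamma\cdot g\gamma'=f g^{\gamma}\gamma\gamma'$. Its element $\sum_\gamma f_\gamma\gamma$ is regarded as the function $(y,\gamma)\mapsto f_\gamma(\gamma y)$ on the transformation groupoid $Y\rtimes G$. It acts on $\mathcal F(Y)$ by $(f\gamma)\cdot h=f h^\gamma$ and contains the group ring $RG$. For a closed-open $U\subset Y$ with characteristic function $\chi_U$ put $R(U\rtimes G)=\chi_U R(Y\rtimes G)\chi_U$. **Theorem.** There is a ring isomorphism $\Phi:R(B\rtimes\Gamma)\to R(A\rtimes\Lambda)$ given by $$\Phi(t)(a,\lambda)=t(f(a),\gamma)\qquad(a\in A,\ \lambda\cdot a\in A),$$ where $\gamma\in\Gamma$ is the unique element with $\gamma\lambda a\in X_\Gamma$ (products formed in $X$). For an $R\Lambda$-module $M$ define the $R\Gamma$-modules $$\bar I(M)=\operatorname{res}_{R\Gamma}\Bigl(R(X_\Lambda\rtimes\Gamma)\chi_B\otimes_{R(B\rtimes\Gamma)}\operatorname{res}_\Phi\bigl(\chi_AR(X_\Gamma\rtimes\Lambda)\otimes_{R\Lambda}M\bigr)\Bigr),$$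 $$I(M)=\operatorname{res}_{R\Gamma}\operatorname{Hom}_{R(B\rtimes\Gamma)}\Bigl(\chi_BR(X_\Lambda\rtimes\Gamma),\operatorname{res}_\Phi\bigl(\chi_AR(X_\Gamma\rtimes\Lambda)\otimes_{R\Lambda}M\bigr)\Bigr),$$ the latter with $(\gamma\theta)(x)=\theta(x\gamma)$; both are functors in $M$. Then there are $R$-linear homomorphisms, natural in $M$, $$I_n:H_n(\Lambda,M)\to H_n(\Gamma,\bar I(M)),\qquad I^n:H^n(\Lambda,M)\to H^n(\Gamma,I(M))\qquad(n\ge 0)$$ such that: 1. $I_n$ factorizes as $$H_n(\Lambda,M)\to H_n\bigl(\Lambda,\operatorname{res}_{R\Lambda}R(X_\Gamma\rtimes\Lambda)\otimes_{R\Lambda}M\bigr)\xrightarrow{\ \cong\ }H_n(\Gamma,\bar I(M)),$$ where the first map is induced by $j:M\to R(X_\Gamma\rtimes\Lambda)\otimes_{R\Lambda}M$, $m\mapsto 1\otimes m$, and the second is an isomorphism natural in $M$. 2. $I^n$ factorizes as $$H^n(\Lambda,M)\to H^n\bigl(\Lambda,\operatorname{res}_{R\Lambda}R(X_\Gamma\rtimes\Lambda)\otimes_{R\Lambda}M\bigr)\xrightarrow{\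 \cong\ }H^n(\Gamma,I(M)),$$ where the first map is induced by $j$ and the second is an isomorphism natural in $M$. 3. Suppose that $X_\Lambda$ is compact too (the case of a quasi-isometry). Then for the trivial module $R$ there are canonical isomorphisms of $R\Gamma$-modules $\bar I(R)\cong\mathcal F(X_\Lambda)\cong I(R)$. The first sends $s'\otimes(s\otimes r)$ to $s'\cdot h$ for any $h\in\mathcal F(X_\Lambda)$ with $h\circ f=s\cdot r$ on $A$. The second sends $k\in\mathcal F(X_\Lambda)$ to the homomorphism with value $s\otimes 1$ at $x$, for any $s\in\chi_AR(X_\Gamma\rtimes\Lambda)$ with $s\cdot 1=(x\cdot k)\circ f$ on $A$. The resulting maps $$I_*:H_*(\Lambda,R)\to H_*(\Gamma,\mathcal F(X_\Lambda)),\qquad I^*:H^*(\Lambda,R)\to H^*(\Gamma,\mathcal F(X_\Lambda))$$ are compatible with cup and cap products (formed with the multiplications of $R$ and of $\mathcal F(X_\Lambda)$): $$I^*(x\cup y)=I^*(x)\cup I^*(y),\qquad I_*(x\cap z)=I^*(x)\cap I_*(z)$$ for all classes $x\in H^m(\Lambda,R)$, $y\in H^n(\Lambda,R)$, $z\in H_N(\Lambda,R)$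 with $m\le N$. -/

import Mathlib

open CategoryTheory TensorProduct MulOpposite

universe u

namespace CouplingInduction

noncomputable section

/-! ### Uniform embeddings, topological couplings -/

/-- A map of discrete groups is a uniform embedding if `αᵢ⁻¹βᵢ → ∞` iff `φ(αᵢ)⁻¹φ(βᵢ) → ∞`, where
`→ ∞` means eventually leaving every finite subset. -/
def IsUniformEmbedding {Λ Γ : Type*} [Group Λ] [Group Γ] (φ : Λ → Γ) : Prop :=
  ∀ α β : ℕ → Λ,
    Filter.Tendsto (fun i => (α i)⁻¹ * β i) Filter.atTop Filter.cofinite ↔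
      Filter.Tendsto (fun i => (φ (α i))⁻¹ * φ (β i)) Filter.atTop Filter.cofinite

/-- A closed-open (strict) fundamental domain for an action of `G` on `X`: every point has exactly
one translate in it. In particular the action is free. -/
structure ClopenDomain (G X : Type*) [Group G] [TopologicalSpace X] [MulAction G X] where
  /-- the underlying set -/
  carrier : Set X
  isClopen : IsClopen carrier
  existsUnique (x : X) : ∃! g : G, g • x ∈ carrier

namespace ClopenDomain

variable {G X : Type*} [Group G] [TopologicalSpace X] [MulAction G X] (D : ClopenDomain G X)

/-- The fundamental domain as a topological space; it is identified with the orbit space. -/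
def Space : Type _ := {x : X // x ∈ D.carrier}

instance : TopologicalSpace D.Space := inferInstanceAs (TopologicalSpace {x : X // x ∈ D.carrier})

/-- The unique element `g` with `g • x ∈ D`. -/
def toDom (x : X) : G := (D.existsUnique x).choose

theorem toDom_mem (x : X) : D.toDom x • x ∈ D.carrier := (D.existsUnique x).choose_spec.1

theorem toDom_unique {x : X} {g : G} (h : g • x ∈ D.carrier) : g = D.toDom x :=
  (D.existsUnique x).choose_spec.2 g h

/-- The canonical projection from `X` to the orbit space, identified with the domain `D`. -/
def proj (x : X) : D.Space := ⟨D.toDom x • x, D.toDom_mem x⟩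

theorem proj_smul (g : G) (x : X) : D.proj (g • x) = D.proj x := by
  apply Subtype.ext
  have h : (D.toDom x * g⁻¹) • (g • x) ∈ D.carrier := by
    rw [smul_smul, inv_mul_cancel_right]; exact D.toDom_mem x
  change D.toDom (g • x) • g • x = D.toDom x • x
  rw [← D.toDom_unique h, smul_smul, inv_mul_cancel_right]

theorem proj_coe (d : D.Space) : D.proj d.1 = d := by
  apply Subtype.ext
  have h : (1 : G) • d.1 ∈ D.carrier := by rw [one_smul]; exact d.2
  change D.toDom d.1 • d.1 = d.1
  rw [← D.toDom_unique h, one_smul]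

theorem continuous_proj [ContinuousConstSMul G X] : Continuous D.proj := by
  rw [continuous_iff_continuousAt]
  intro x
  have hopen : IsOpen {y : X | D.toDom x • y ∈ D.carrier} :=
    D.isClopen.isOpen.preimage (continuous_const_smul _)
  have hev : (fun y => D.toDom x • y) =ᶠ[nhds x] fun y => (D.proj y).1 := by
    filter_upwards [hopen.mem_nhds (D.toDom_mem x)] with y hy
    change _ = D.toDom y • y
    rw [← D.toDom_unique hy]
  exact Topology.IsInducing.subtypeVal.continuousAt_iff.2
    (((continuous_const_smul (D.toDom x)).continuousAt).congr hev)

variable {H : Type*} [Group H] [MulAction H X] [SMulCommClass G H X]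

/-- The action of a commuting group on the orbit space of `G`, identified with the domain `D`. -/
instance : MulAction H D.Space where
  smul h d := D.proj (h • d.1)
  one_smul d := by
    change D.proj ((1 : H) • d.1) = d
    rw [one_smul, D.proj_coe]
  mul_smul h k d := by
    change D.proj ((h * k) • d.1) = D.proj (h • (D.toDom (k • d.1) • k • d.1))
    rw [← smul_comm (D.toDom (k • d.1)) h, D.proj_smul, mul_smul]

instance [ContinuousConstSMul G X] [ContinuousConstSMul H X] : ContinuousConstSMul H D.Space where
  continuous_const_smul h :=
    D.continuous_proj.comp ((continuous_const_smul h).comp continuous_subtype_val)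

end ClopenDomain

/-- A topological coupling of `Λ` and `Γ` on a space `X` carrying commuting actions of the two
groups: fundamental domains `X_Λ` (closed-open) and `X_Γ` (compact-open). The requirements on the
space and the two actions (local compactness, continuity, properness) are stated where this is used;
freeness and cocompactness of the `Γ`-action are consequences of the existence of the domains. A
right `Λ`-action is written as the left action `λ • x = x λ⁻¹`. -/
structure TopologicalCoupling (Λ Γ X : Type*) [Group Λ] [Group Γ] [TopologicalSpace X]
    [MulAction Λ X] [MulAction Γ X] where
  /-- the fundamental domain `X_Λ` -/
  domΛ : ClopenDomain Λ X
  /-- the fundamental domain `X_Γ` -/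
  domΓ : ClopenDomain Γ X
  isCompact_domΓ : IsCompact domΓ.carrier

/-- The canonical projection `q : X → X/Λ = X_Λ`, restricted to `X_Γ`. -/
def TopologicalCoupling.f {Λ Γ X : Type*} [Group Λ] [Group Γ] [TopologicalSpace X]
    [MulAction Λ X] [MulAction Γ X] (C : TopologicalCoupling Λ Γ X) (a : C.domΓ.Space) :
    C.domΛ.Space := C.domΛ.proj a.1

/-- Compact-open subsets `A ⊆ X_Γ` and `B ⊆ X_Λ`, meeting every orbit of the action of `Λ` on `X_Γ`
and of `Γ` on `X_Λ` respectively, such that the projection `f` restricts to a bijection `A → B`. -/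
structure TopologicalCoupling.IsMatching {Λ Γ X : Type*} [Group Λ] [Group Γ] [TopologicalSpace X]
    [MulAction Λ X] [MulAction Γ X] [SMulCommClass Λ Γ X] [SMulCommClass Γ Λ X]
    (C : TopologicalCoupling Λ Γ X)
    (A : TopologicalSpace.Clopens C.domΓ.Space) (B : TopologicalSpace.Clopens C.domΛ.Space) :
    Prop where
  isCompact_left : IsCompact (A : Set C.domΓ.Space)
  isCompact_right : IsCompact (B : Set C.domΛ.Space)
  meets_left (x : C.domΓ.Space) : ∃ l : Λ, l • x ∈ A
  meets_right (y : C.domΛ.Space) : ∃ g : Γ, g • y ∈ B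
  bijOn : Set.BijOn C.f A B

/-! ### The groupoid ring of a transformation groupoid, as a crossed product -/

section Ring

variable {R Y G : Type*} [CommRing R] [TopologicalSpace Y] [Group G] [MulAction G Y]
  [ContinuousConstSMul G Y]

/-- The action `f^γ(y) = f(γ⁻¹y)` on the ring `F(Y;R)` of functions with closed-open fibres. -/
instance : MulSemiringAction G (LocallyConstant Y R) where
  smul g f := ⟨fun y => f (g⁻¹ • y),
    f.isLocallyConstant.comp_continuous (continuous_const_smul g⁻¹)⟩
  one_smul f := by
    ext y; change f ((1 : G)⁻¹ • y) = f y; simp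
  mul_smul g h f := by
    ext y; change f ((g * h)⁻¹ • y) = f (h⁻¹ • g⁻¹ • y); simp [mul_smul]
  smul_zero _ := rfl
  smul_add _ _ _ := rfl
  smul_one _ := rfl
  smul_mul _ _ _ := rfl

theorem smul_locallyConstant_apply (g : G) (f : LocallyConstant Y R) (y : Y) :
    (g • f) y = f (g⁻¹ • y) := rfl

instance : SMulCommClass G R (LocallyConstant Y R) := ⟨fun _ _ _ => rfl⟩

variable (R Y G) in
/-- The crossed product ring `F(Y;R) ⋊ G`, identified with the groupoid ring `R(Y ⋊ G)`
through `groupoidFun`. -/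
def CrossedProduct : Type _ := SkewMonoidAlgebra (LocallyConstant Y R) G

instance : Ring (CrossedProduct R Y G) :=
  inferInstanceAs (Ring (SkewMonoidAlgebra (LocallyConstant Y R) G))

instance : Algebra R (CrossedProduct R Y G) :=
  inferInstanceAs (Algebra R (SkewMonoidAlgebra (LocallyConstant Y R) G))

/-- The element `f γ` of the crossed product. -/
def mono (g : G) (f : LocallyConstant Y R) : CrossedProduct R Y G := SkewMonoidAlgebra.single g f

theorem mono_mul_mono (g h : G) (f k : LocallyConstant Y R) :
    mono g f * mono h k = mono (g * h) (f * g • k) :=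
  SkewMonoidAlgebra.single_mul_single

/-- The function on the groupoid `Y ⋊ G` that corresponds to an element of the crossed product:
`∑ f_γ γ` is the function `(y, γ) ↦ f_γ(γ y)`. -/
def groupoidFun (s : CrossedProduct R Y G) (y : Y) (g : G) : R := SkewMonoidAlgebra.coeff s g (g • y)

/-- The canonical module structure of `F(Y;R)` over the crossed product: `(fγ) · h = f h^γ`. -/
def act (s : CrossedProduct R Y G) (h : LocallyConstant Y R) : LocallyConstant Y R :=
  SkewMonoidAlgebra.sum s fun g f => f * g • h

variable (R G) in
/-- The characteristic function `χ_U` of a closed-open set, as an element of the crossed product. -/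
def chi (U : TopologicalSpace.Clopens Y) : CrossedProduct R Y G :=
  mono 1 (LocallyConstant.charFn R U.isClopen)

variable (R G) in
theorem isIdempotentElem_chi (U : TopologicalSpace.Clopens Y) :
    IsIdempotentElem (chi R G U : CrossedProduct R Y G) := by
  have h : (LocallyConstant.charFn R U.isClopen : LocallyConstant Y R) *
      LocallyConstant.charFn R U.isClopen = LocallyConstant.charFn R U.isClopen := by
    ext y
    by_cases hy : y ∈ (U : Set Y) <;> simp [LocallyConstant.coe_charFn, hy]
  rw [IsIdempotentElem, chi, mono_mul_mono, one_smul, h, one_mul]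

variable (R G) in
/-- The groupoid ring `R(U ⋊ G) = χ_U R(Y ⋊ G) χ_U`, with unit `χ_U`. -/
abbrev GroupoidRing (U : TopologicalSpace.Clopens Y) : Type _ :=
  (isIdempotentElem_chi R G U).Corner

variable (R Y G) in
/-- The inclusion `RG ⊆ R(Y ⋊ G)`. -/
def incl : MonoidAlgebra R G →ₐ[R] CrossedProduct R Y G :=
  MonoidAlgebra.lift R _ G (SkewMonoidAlgebra.of (LocallyConstant Y R) G)

variable (R G) in
/-- The right ideal `χ_U R(Y ⋊ G)`. -/
def rowIdeal (U : TopologicalSpace.Clopens Y) : Submodule R (CrossedProduct R Y G) :=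
  LinearMap.range (LinearMap.mulLeft R (chi R G U : CrossedProduct R Y G))

variable (R G) in
/-- The left ideal `R(Y ⋊ G) χ_U`. -/
def colIdeal (U : TopologicalSpace.Clopens Y) : Submodule R (CrossedProduct R Y G) :=
  LinearMap.range (LinearMap.mulRight R (chi R G U : CrossedProduct R Y G))


/-! ### One-sided multiplications -/

/-- Left multiplication of `R(Y ⋊ G)` on itself. -/
def fullLeft : CrossedProduct R Y G →+* Module.End R (CrossedProduct R Y G) :=
  (Algebra.lmul R (CrossedProduct R Y G)).toRingHom

/-- Right multiplication of `R(Y ⋊ G)` on itself. -/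
def fullRight : (CrossedProduct R Y G)ᵐᵒᵖ →+* Module.End R (CrossedProduct R Y G) where
  toFun t := LinearMap.mulRight R t.unop
  map_one' := by ext; simp
  map_mul' _ _ := by ext; simp [mul_assoc]
  map_zero' := by ext; simp
  map_add' _ _ := by ext; simp [mul_add]

/-- Right multiplication of `R(Y ⋊ G)` on `χ_U R(Y ⋊ G)`. -/
def rowRight (U : TopologicalSpace.Clopens Y) :
    (CrossedProduct R Y G)ᵐᵒᵖ →+* Module.End R (rowIdeal R G U) where
  toFun t := (LinearMap.mulRight R t.unop).restrict (by
    rintro _ ⟨s, rfl⟩; exact ⟨s * t.unop, by simp [mul_assoc]⟩)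
  map_one' := by ext; simp
  map_mul' _ _ := by ext; simp [mul_assoc]
  map_zero' := by ext; simp
  map_add' _ _ := by ext; simp [mul_add]

/-- Left multiplication of `R(U ⋊ G)` on `χ_U R(Y ⋊ G)`. -/
def rowLeft (U : TopologicalSpace.Clopens Y) :
    GroupoidRing R G U →+* Module.End R (rowIdeal R G U) where
  toFun t := (LinearMap.mulLeft R t.1).restrict (by
    intro x _
    exact ⟨t.1 * x, by
      simp [← mul_assoc, ((Subsemigroup.mem_corner_iff (isIdempotentElem_chi R G U)).1 t.2).1]⟩)
  map_one' := by
    ext ⟨x, s, rfl⟩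
    change chi R G U * (chi R G U * s) = chi R G U * s
    rw [← mul_assoc, (isIdempotentElem_chi R G U).eq]
  map_mul' t t' := by
    ext x
    change (t.1 * t'.1) * x.1 = t.1 * (t'.1 * x.1)
    rw [mul_assoc]
  map_zero' := by
    ext x
    change (0 : CrossedProduct R Y G) * x.1 = 0
    rw [zero_mul]
  map_add' t t' := by
    ext x
    change (t.1 + t'.1) * x.1 = t.1 * x.1 + t'.1 * x.1
    rw [add_mul]

/-- Left multiplication of `R(Y ⋊ G)` on `R(Y ⋊ G) χ_U`. -/
def colLeft (U : TopologicalSpace.Clopens Y) :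
    CrossedProduct R Y G →+* Module.End R (colIdeal R G U) where
  toFun t := (LinearMap.mulLeft R t).restrict (by
    rintro _ ⟨s, rfl⟩; exact ⟨t * s, by simp [mul_assoc]⟩)
  map_one' := by ext; simp
  map_mul' _ _ := by ext; simp
  map_zero' := by ext; simp
  map_add' _ _ := by ext; simp [add_mul]

/-- Right multiplication of `R(U ⋊ G)` on `R(Y ⋊ G) χ_U`. -/
def colRight (U : TopologicalSpace.Clopens Y) :
    (GroupoidRing R G U)ᵐᵒᵖ →+* Module.End R (colIdeal R G U) where
  toFun t := (LinearMap.mulRight R t.unop.1).restrict (by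
    intro x _
    exact ⟨x * t.unop.1, by
      simp [mul_assoc,
        ((Subsemigroup.mem_corner_iff (isIdempotentElem_chi R G U)).1 t.unop.2).2]⟩)
  map_one' := by
    ext ⟨x, s, rfl⟩
    change (s * chi R G U) * chi R G U = s * chi R G U
    rw [mul_assoc, (isIdempotentElem_chi R G U).eq]
  map_mul' t t' := by
    ext x
    change x.1 * (t'.unop.1 * t.unop.1) = (x.1 * t'.unop.1) * t.unop.1
    rw [mul_assoc]
  map_zero' := by
    ext x
    change x.1 * (0 : CrossedProduct R Y G) = 0
    rw [mul_zero]
  map_add' t t' := by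
    ext x
    change x.1 * (t.unop.1 + t'.unop.1) = x.1 * t.unop.1 + x.1 * t'.unop.1
    rw [mul_add]

end Ring

/-! ### Tensor products over noncommutative rings -/

section Tensor

variable {R T T' : Type*} [CommRing R] [Ring T] [Ring T']
  {N M M' : Type*} [AddCommGroup N] [Module R N] [AddCommGroup M] [Module R M]
  [AddCommGroup M'] [Module R M']

/-- The relations `n t ⊗ m = n ⊗ t m`. -/
def balancedRel (r : Tᵐᵒᵖ →+* Module.End R N) (l : T →+* Module.End R M) :
    Submodule R (N ⊗[R] M) :=
  Submodule.span R {z | ∃ (n : N) (t : T) (m : M), z = r (op t) n ⊗ₜ[R] m - n ⊗ₜ[R] l t m}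

/-- The tensor product `N ⊗_T M` of a right `T`-module and a left `T`-module (both with a compatible
`R`-module structure, the actions of `T` being given by the ring homomorphisms `r` and `l`). -/
abbrev BalancedTensor (r : Tᵐᵒᵖ →+* Module.End R N) (l : T →+* Module.End R M) : Type _ :=
  (N ⊗[R] M) ⧸ balancedRel r l

namespace BalancedTensor

/-- The class of `n ⊗ m`. -/
def mk (r : Tᵐᵒᵖ →+* Module.End R N) (l : T →+* Module.End R M) (n : N) (m : M) :
    BalancedTensor r l := Submodule.Quotient.mk (n ⊗ₜ[R] m)

variable {r : Tᵐᵒᵖ →+* Module.End R N} {l : T →+* Module.End R M} {l' : T →+* Module.End R M'}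

theorem mk_balanced (n : N) (t : T) (m : M) : mk r l (r (op t) n) m = mk r l n (l t m) :=
  (Submodule.Quotient.eq _).2 (Submodule.subset_span ⟨n, t, m, rfl⟩)

theorem hom_ext {P : Type*} [AddCommGroup P] [Module R P] {f g : BalancedTensor r l →ₗ[R] P}
    (h : ∀ n m, f (mk r l n m) = g (mk r l n m)) : f = g :=
  Submodule.linearMap_qext _ (TensorProduct.ext' h)

/-- Functoriality of the tensor product. -/
def map (a : N →ₗ[R] N) (ha : ∀ t n, a (r t n) = r t (a n))
    (b : M →ₗ[R] M') (hb : ∀ t m, b (l t m) = l' t (b m)) :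
    BalancedTensor r l →ₗ[R] BalancedTensor r l' :=
  Submodule.mapQ _ _ (TensorProduct.map a b) (by
    rw [balancedRel, Submodule.span_le]
    rintro _ ⟨n, t, m, rfl⟩
    rw [SetLike.mem_coe, Submodule.mem_comap, map_sub, TensorProduct.map_tmul,
      TensorProduct.map_tmul, ha, hb]
    exact Submodule.subset_span ⟨a n, t, b m, rfl⟩)

@[simp]
theorem map_mk (a : N →ₗ[R] N) (ha : ∀ t n, a (r t n) = r t (a n))
    (b : M →ₗ[R] M') (hb : ∀ t m, b (l t m) = l' t (b m)) (n : N) (m : M) :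
    map a ha b hb (mk r l n m) = mk r l' (a n) (b m) := rfl

theorem mk_add_left (n n' : N) (m : M) : mk r l (n + n') m = mk r l n m + mk r l n' m := by
  simp [mk, TensorProduct.add_tmul]

theorem mk_add_right (n : N) (m m' : M) : mk r l n (m + m') = mk r l n m + mk r l n m' := by
  simp [mk, TensorProduct.tmul_add]

theorem mk_smul_right (n : N) (c : R) (m : M) : mk r l n (c • m) = c • mk r l n m := by
  simp [mk]

theorem mk_zero_left (m : M) : mk r l 0 m = 0 := by
  simp [mk]

/-- The left module structure of `N ⊗_T M` coming from a left module structure of `N`. -/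
def leftAction (r : Tᵐᵒᵖ →+* Module.End R N) (l : T →+* Module.End R M)
    (a : T' →+* Module.End R N) (ha : ∀ t' t n, a t' (r t n) = r t (a t' n)) :
    T' →+* Module.End R (BalancedTensor r l) where
  toFun t' := map (a t') (ha t') LinearMap.id (fun _ _ => rfl)
  map_one' := hom_ext fun n m => by simp
  map_mul' t t' := hom_ext fun n m => by simp
  map_zero' := hom_ext fun n m => by simp [mk_zero_left]
  map_add' t t' := hom_ext fun n m => by simp [mk_add_left]

@[simp]
theorem leftAction_mk (a : T' →+* Module.End R N) (ha : ∀ t' t n, a t' (r t n) = r t (a t' n))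
    (t' : T') (n : N) (m : M) : leftAction r l a ha t' (mk r l n m) = mk r l (a t' n) m := rfl

end BalancedTensor

end Tensor

/-! ### The induction functors -/

section Functors

variable {R Λ : Type u} [CommRing R] [Group Λ] {Y : Type u} [TopologicalSpace Y] [MulAction Λ Y]
  [ContinuousConstSMul Λ Y]

/-- The left `RΛ`-module structure of a representation. -/
def repLeft (M : Rep.{u} R Λ) : MonoidAlgebra R Λ →+* Module.End R M.V :=
  (Representation.asAlgebraHom M.ρ).toRingHom

theorem repLeft_comm {M M' : Rep.{u} R Λ} (f : M ⟶ M') (t : MonoidAlgebra R Λ) (m : M.V) :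
    f.hom.toLinearMap (repLeft M t m) = repLeft M' t (f.hom.toLinearMap m) := by
  induction t using MonoidAlgebra.induction_on with
  | of g =>
    simp only [repLeft, AlgHom.toRingHom_eq_coe, RingHom.coe_coe, Representation.asAlgebraHom_of]
    exact Rep.hom_comm_apply f g m
  | add a b ha hb => simp only [map_add, LinearMap.add_apply, ha, hb]
  | smul r a ha =>
    simp only [repLeft, AlgHom.toRingHom_eq_coe, RingHom.coe_coe, map_smul,
      LinearMap.smul_apply] at ha ⊢
    rw [ha]

/-- The right `RΛ`-module structure of `R(Y ⋊ Λ)`. -/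
abbrev fullRightGroup (R Λ Y : Type u) [CommRing R] [Group Λ] [TopologicalSpace Y] [MulAction Λ Y]
    [ContinuousConstSMul Λ Y] :
    (MonoidAlgebra R Λ)ᵐᵒᵖ →+* Module.End R (CrossedProduct R Y Λ) :=
  fullRight.comp (incl R Y Λ).toRingHom.op

/-- The right `RΛ`-module structure of `χ_U R(Y ⋊ Λ)`. -/
abbrev rowRightGroup (R Λ : Type u) [CommRing R] [Group Λ] {Y : Type u} [TopologicalSpace Y]
    [MulAction Λ Y] [ContinuousConstSMul Λ Y] (U : TopologicalSpace.Clopens Y) :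
    (MonoidAlgebra R Λ)ᵐᵒᵖ →+* Module.End R (rowIdeal R Λ U) :=
  (rowRight U).comp (incl R Y Λ).toRingHom.op

/-- The `R`-module `R(Y ⋊ Λ) ⊗_{RΛ} M`. -/
abbrev FullTensor (Y : Type u) [TopologicalSpace Y] [MulAction Λ Y] [ContinuousConstSMul Λ Y]
    (M : Rep.{u} R Λ) : Type u :=
  BalancedTensor (fullRightGroup R Λ Y) (repLeft M)

/-- The left `R(Y ⋊ Λ)`-module structure of `R(Y ⋊ Λ) ⊗_{RΛ} M`. -/
def fullTensorAct (Y : Type u) [TopologicalSpace Y] [MulAction Λ Y] [ContinuousConstSMul Λ Y]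
    (M : Rep.{u} R Λ) : CrossedProduct R Y Λ →+* Module.End R (FullTensor Y M) :=
  BalancedTensor.leftAction _ _ fullLeft (fun t' _ n => (mul_assoc t' n _).symm)

/-- The `R`-module `χ_U R(Y ⋊ Λ) ⊗_{RΛ} M`. -/
abbrev RowTensor (U : TopologicalSpace.Clopens Y) (M : Rep.{u} R Λ) : Type u :=
  BalancedTensor (rowRightGroup R Λ U) (repLeft M)

/-- The left `R(U ⋊ Λ)`-module structure of `χ_U R(Y ⋊ Λ) ⊗_{RΛ} M`. -/
def rowTensorAct (U : TopologicalSpace.Clopens Y) (M : Rep.{u} R Λ) :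
    GroupoidRing R Λ U →+* Module.End R (RowTensor U M) :=
  BalancedTensor.leftAction _ _ (rowLeft U)
    (fun t' _ n => Subtype.ext (mul_assoc t'.1 n.1 _).symm)

/-- The map `χ_U R(Y ⋊ Λ) ⊗_{RΛ} f`. -/
def rowTensorMap (U : TopologicalSpace.Clopens Y) {M M' : Rep.{u} R Λ} (f : M ⟶ M') :
    RowTensor U M →ₗ[R] RowTensor U M' :=
  BalancedTensor.map LinearMap.id (fun _ _ => rfl) f.hom.toLinearMap (repLeft_comm f)

theorem rowTensorMap_act (U : TopologicalSpace.Clopens Y) {M M' : Rep.{u} R Λ} (f : M ⟶ M')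
    (t : GroupoidRing R Λ U) (z : RowTensor U M) :
    rowTensorMap U f (rowTensorAct U M t z) = rowTensorAct U M' t (rowTensorMap U f z) :=
  LinearMap.congr_fun (BalancedTensor.hom_ext
    (f := rowTensorMap U f ∘ₗ rowTensorAct U M t)
    (g := rowTensorAct U M' t ∘ₗ rowTensorMap U f) fun _ _ => rfl) z

theorem rowTensorMap_id (U : TopologicalSpace.Clopens Y) (M : Rep.{u} R Λ) :
    rowTensorMap U (𝟙 M) = LinearMap.id :=
  BalancedTensor.hom_ext fun _ _ => rfl

theorem rowTensorMap_comp (U : TopologicalSpace.Clopens Y) {M M' M'' : Rep.{u} R Λ} (f : M ⟶ M')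
    (g : M' ⟶ M'') : rowTensorMap U (f ≫ g) = rowTensorMap U g ∘ₗ rowTensorMap U f :=
  BalancedTensor.hom_ext fun _ _ => rfl

/-- The functor `M ↦ res_{RΛ} (R(Y ⋊ Λ) ⊗_{RΛ} M)` on `RΛ`-modules. -/
def extRes (R Λ Y : Type u) [CommRing R] [Group Λ] [TopologicalSpace Y] [MulAction Λ Y]
    [ContinuousConstSMul Λ Y] : Rep.{u} R Λ ⥤ Rep.{u} R Λ where
  obj M := Rep.of (X := FullTensor Y M) ((fullTensorAct Y M).toMonoidHom.comp
    ((incl R Y Λ).toMonoidHom.comp (MonoidAlgebra.of R Λ)))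
  map f := Rep.ofHom
    ⟨BalancedTensor.map LinearMap.id (fun _ _ => rfl) f.hom.toLinearMap (repLeft_comm f),
      fun _ => BalancedTensor.hom_ext fun _ _ => rfl⟩
  map_id M := Rep.hom_ext (Representation.IntertwiningMap.toLinearMap_injective _ _
    (BalancedTensor.hom_ext fun _ _ => rfl))
  map_comp f g := Rep.hom_ext (Representation.IntertwiningMap.toLinearMap_injective _ _
    (BalancedTensor.hom_ext fun _ _ => rfl))

/-- The natural map `j : M → R(Y ⋊ Λ) ⊗_{RΛ} M`, `m ↦ 1 ⊗ m`. -/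
def unitMap (R Λ Y : Type u) [CommRing R] [Group Λ] [TopologicalSpace Y] [MulAction Λ Y]
    [ContinuousConstSMul Λ Y] : 𝟭 (Rep.{u} R Λ) ⟶ extRes R Λ Y where
  app M := Rep.ofHom (σ := ((extRes R Λ Y).obj M).ρ)
    ⟨{ toFun := fun m => BalancedTensor.mk (fullRightGroup R Λ Y) (repLeft M) 1 m
       map_add' := fun m m' => BalancedTensor.mk_add_right _ _ _
       map_smul' := fun c m => BalancedTensor.mk_smul_right _ _ _ },
      fun g => by
        ext m
        have h := BalancedTensor.mk_balanced (r := fullRightGroup R Λ Y) (l := repLeft M) 1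
          (MonoidAlgebra.of R Λ g) m
        have h1 : repLeft M (MonoidAlgebra.of R Λ g) m = M.ρ g m := by
          simp only [repLeft, AlgHom.toRingHom_eq_coe, RingHom.coe_coe,
            Representation.asAlgebraHom_of]
        rw [h1] at h
        refine h.symm.trans ?_
        change BalancedTensor.mk _ _ (1 * incl R Y Λ (MonoidAlgebra.of R Λ g)) m =
          BalancedTensor.mk _ _ (incl R Y Λ (MonoidAlgebra.of R Λ g) * 1) m
        rw [one_mul, mul_one]⟩
  naturality _ _ _ := rfl

variable {Γ : Type u} [Group Γ] {Z : Type u} [TopologicalSpace Z] [MulAction Γ Z]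
  [ContinuousConstSMul Γ Z] {A : TopologicalSpace.Clopens Y} {B : TopologicalSpace.Clopens Z}

/-- The `R`-module `R(Z ⋊ Γ) χ_B ⊗_{R(B ⋊ Γ)} res_Φ (χ_A R(Y ⋊ Λ) ⊗_{RΛ} M)`. -/
abbrev IndLower (Φ : GroupoidRing R Γ B →+* GroupoidRing R Λ A) (M : Rep.{u} R Λ) : Type u :=
  BalancedTensor (colRight (R := R) (G := Γ) B) ((rowTensorAct A M).comp Φ)

/-- The left `RΓ`-module structure of `R(Z ⋊ Γ) χ_B ⊗_{R(B ⋊ Γ)} res_Φ (χ_A R(Y ⋊ Λ) ⊗_{RΛ} M)`. -/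
def indLowerRep (Φ : GroupoidRing R Γ B →+* GroupoidRing R Λ A) (M : Rep.{u} R Λ) :
    Representation R Γ (IndLower Φ M) :=
  (BalancedTensor.leftAction _ _ (colLeft B)
    (fun t' _ n => Subtype.ext (mul_assoc t' n.1 _).symm)).toMonoidHom.comp
      ((incl R Z Γ).toMonoidHom.comp (MonoidAlgebra.of R Γ))

/-- Functoriality of `IndLower`. -/
def indLowerMap (Φ : GroupoidRing R Γ B →+* GroupoidRing R Λ A) {M M' : Rep.{u} R Λ} (f : M ⟶ M') :
    IndLower Φ M →ₗ[R] IndLower Φ M' :=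
  BalancedTensor.map LinearMap.id (fun _ _ => rfl) (rowTensorMap A f)
    (fun t z => rowTensorMap_act A f (Φ t) z)

theorem indLowerMap_id (Φ : GroupoidRing R Γ B →+* GroupoidRing R Λ A) (M : Rep.{u} R Λ) :
    indLowerMap Φ (𝟙 M) = LinearMap.id :=
  BalancedTensor.hom_ext fun n z => by
    rw [indLowerMap, BalancedTensor.map_mk, rowTensorMap_id, LinearMap.id_apply,
      LinearMap.id_apply, LinearMap.id_apply]

theorem indLowerMap_comp (Φ : GroupoidRing R Γ B →+* GroupoidRing R Λ A) {M M' M'' : Rep.{u} R Λ}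
    (f : M ⟶ M') (g : M' ⟶ M'') :
    indLowerMap Φ (f ≫ g) = indLowerMap Φ g ∘ₗ indLowerMap Φ f :=
  BalancedTensor.hom_ext fun n z => by
    rw [LinearMap.comp_apply, indLowerMap, indLowerMap, indLowerMap, BalancedTensor.map_mk,
      BalancedTensor.map_mk, BalancedTensor.map_mk, rowTensorMap_comp, LinearMap.comp_apply]
    rfl

/-- The induction functor for homology,
`M ↦ res_{RΓ} (R(Z ⋊ Γ) χ_B ⊗_{R(B ⋊ Γ)} res_Φ (χ_A R(Y ⋊ Λ) ⊗_{RΛ} M))`. -/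
def indLower (Φ : GroupoidRing R Γ B →+* GroupoidRing R Λ A) : Rep.{u} R Λ ⥤ Rep.{u} R Γ where
  obj M := Rep.of (X := IndLower Φ M) (indLowerRep Φ M)
  map {M M'} f := Rep.ofHom (ρ := indLowerRep Φ M) (σ := indLowerRep Φ M')
    ⟨indLowerMap Φ f, fun _ => BalancedTensor.hom_ext fun _ _ => rfl⟩
  map_id M := Rep.hom_ext (Representation.IntertwiningMap.toLinearMap_injective _ _
    (indLowerMap_id Φ M))
  map_comp f g := Rep.hom_ext (Representation.IntertwiningMap.toLinearMap_injective _ _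
    (by exact indLowerMap_comp Φ f g))

/-- The `R`-module `Hom_{R(B ⋊ Γ)} (χ_B R(Z ⋊ Γ), res_Φ (χ_A R(Y ⋊ Λ) ⊗_{RΛ} M))`. -/
def IndUpper (Φ : GroupoidRing R Γ B →+* GroupoidRing R Λ A) (M : Rep.{u} R Λ) :
    Submodule R (rowIdeal R Γ B →ₗ[R] RowTensor A M) where
  carrier := {θ | ∀ t x, θ (rowLeft B t x) = rowTensorAct A M (Φ t) (θ x)}
  add_mem' h h' t x := by simp only [LinearMap.add_apply, map_add, h t x, h' t x]
  zero_mem' t x := by simp only [LinearMap.zero_apply, map_zero]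
  smul_mem' c θ h t x := by simp only [LinearMap.smul_apply, map_smul, h t x]

/-- The left `RΓ`-module structure `(γ θ)(x) = θ(x γ)`. -/
def indUpperRep (Φ : GroupoidRing R Γ B →+* GroupoidRing R Λ A) (M : Rep.{u} R Λ) :
    Representation R Γ (IndUpper Φ M) where
  toFun g := (LinearMap.lcomp R _
      (rowRight B (op (incl R Z Γ (MonoidAlgebra.of R Γ g))))).restrict (by
    intro θ h t x
    change θ (rowRight B _ (rowLeft B t x)) = _
    have : rowRight B (op (incl R Z Γ (MonoidAlgebra.of R Γ g))) (rowLeft B t x) =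
        rowLeft B t (rowRight B (op (incl R Z Γ (MonoidAlgebra.of R Γ g))) x) :=
      Subtype.ext (mul_assoc _ _ _)
    rw [this]
    exact h _ _)
  map_one' := by
    ext θ x
    change (θ.1 (rowRight B (op (incl R Z Γ (MonoidAlgebra.of R Γ 1))) x)) = θ.1 x
    rw [map_one, map_one, op_one, map_one, Module.End.one_apply]
  map_mul' g g' := by
    ext θ x
    change (θ.1 (rowRight B (op (incl R Z Γ (MonoidAlgebra.of R Γ (g * g')))) x)) =
      θ.1 (rowRight B (op (incl R Z Γ (MonoidAlgebra.of R Γ g')))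
        (rowRight B (op (incl R Z Γ (MonoidAlgebra.of R Γ g))) x))
    rw [← Module.End.mul_apply, ← map_mul, ← op_mul, ← map_mul, ← map_mul]

/-- Functoriality of `IndUpper`: composition with `χ_A R(Y ⋊ Λ) ⊗_{RΛ} f`. -/
def indUpperMap (Φ : GroupoidRing R Γ B →+* GroupoidRing R Λ A) {M M' : Rep.{u} R Λ} (f : M ⟶ M') :
    IndUpper Φ M →ₗ[R] IndUpper Φ M' where
  toFun θ := ⟨rowTensorMap A f ∘ₗ θ.1, fun t x => by
    rw [LinearMap.comp_apply, LinearMap.comp_apply, θ.2 t x, rowTensorMap_act]⟩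
  map_add' θ θ' := Subtype.ext (LinearMap.comp_add _ _ _)
  map_smul' c θ := Subtype.ext (LinearMap.comp_smul _ _ _)

theorem indUpperMap_id (Φ : GroupoidRing R Γ B →+* GroupoidRing R Λ A) (M : Rep.{u} R Λ) :
    indUpperMap Φ (𝟙 M) = LinearMap.id :=
  LinearMap.ext fun θ => Subtype.ext (by
    change rowTensorMap A (𝟙 M) ∘ₗ θ.1 = θ.1
    rw [rowTensorMap_id, LinearMap.id_comp])

theorem indUpperMap_comp (Φ : GroupoidRing R Γ B →+* GroupoidRing R Λ A) {M M' M'' : Rep.{u} R Λ}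
    (f : M ⟶ M') (g : M' ⟶ M'') :
    indUpperMap Φ (f ≫ g) = indUpperMap Φ g ∘ₗ indUpperMap Φ f :=
  LinearMap.ext fun θ => Subtype.ext (by
    change rowTensorMap A (f ≫ g) ∘ₗ θ.1 = rowTensorMap A g ∘ₗ (rowTensorMap A f ∘ₗ θ.1)
    rw [rowTensorMap_comp, LinearMap.comp_assoc])

/-- The induction functor for cohomology,
`M ↦ res_{RΓ} Hom_{R(B ⋊ Γ)} (χ_B R(Z ⋊ Γ), res_Φ (χ_A R(Y ⋊ Λ) ⊗_{RΛ} M))`. -/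
def indUpper (Φ : GroupoidRing R Γ B →+* GroupoidRing R Λ A) : Rep.{u} R Λ ⥤ Rep.{u} R Γ where
  obj M := Rep.of (X := IndUpper Φ M) (indUpperRep Φ M)
  map {M M'} f := Rep.ofHom (X := IndUpper Φ M) (Y := IndUpper Φ M') (ρ := indUpperRep Φ M) (σ := indUpperRep Φ M')
    ⟨indUpperMap Φ f, fun _ => LinearMap.ext fun _ => rfl⟩
  map_id M := Rep.hom_ext (Representation.IntertwiningMap.toLinearMap_injective _ _
    (indUpperMap_id Φ M))
  map_comp f g := Rep.hom_ext (Representation.IntertwiningMap.toLinearMap_injective _ _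
    (by exact indUpperMap_comp Φ f g))

end Functors

/-! ### Cup and cap products -/

section Products

/-- The entries `g_k, …, g_{k+m-1}` of a tuple. -/
def segment {G : Type*} {N : ℕ} (g : Fin N → G) (k m : ℕ) (h : k + m ≤ N) : Fin m → G :=
  fun i => g ⟨k + i, lt_of_lt_of_le (Nat.add_lt_add_left i.2 k) h⟩

/-- The product `g_0 ⋯ g_{m-1}` of the first `m` entries of a tuple. -/
def frontProd {G : Type*} [Group G] {N : ℕ} (g : Fin N → G) (m : ℕ) (h : m ≤ N) : G :=
  (List.ofFn (segment g 0 m (by omega))).prod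

section Sequences

variable {G : Type*} [Group G]

/-- Auxiliary: initial segment of a sequence. -/
def seqTake (s : ℕ → G) (m : ℕ) : Fin m → G := fun i => s i

/-- Auxiliary: shift of a sequence. -/
def seqShift (s : ℕ → G) (k : ℕ) : ℕ → G := fun i => s (k + i)

/-- Auxiliary: product of the first terms of a sequence. -/
def seqProd (s : ℕ → G) (m : ℕ) : G := (List.ofFn (seqTake s m)).prod

/-- Auxiliary: contraction of two neighbouring terms of a sequence. -/
def seqContract (s : ℕ → G) (j : ℕ) : ℕ → G :=
  fun i => if i < j then s i else if i = j then s i * s (i + 1) else s (i + 1)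

/-- Auxiliary: extension of a tuple to a sequence. -/
def toSeq {N : ℕ} (g : Fin N → G) : ℕ → G := fun i => if h : i < N then g ⟨i, h⟩ else 1

theorem seqProd_succ (s : ℕ → G) (m : ℕ) : seqProd s (m + 1) = seqProd s m * s m := by
  simp only [seqProd, List.ofFn_succ', List.concat_eq_append, List.prod_append, List.prod_singleton]
  rfl

theorem seqProd_succ' (s : ℕ → G) (m : ℕ) : seqProd s (m + 1) = s 0 * seqProd (seqShift s 1) m := by
  have h : (fun i : Fin m => seqTake s (m + 1) i.succ) = seqTake (seqShift s 1) m := by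
    funext i; simp [seqTake, seqShift, add_comm]
  change (List.ofFn (seqTake s (m + 1))).prod = _
  rw [List.ofFn_succ, List.prod_cons, h]
  rfl

theorem seqProd_contract_le (s : ℕ → G) {m j : ℕ} (h : m ≤ j) :
    seqProd (seqContract s j) m = seqProd s m := by
  induction m with
  | zero => simp [seqProd]
  | succ m ih => rw [seqProd_succ, seqProd_succ, ih (by omega), seqContract, if_pos (by omega)]

theorem seqProd_contract_lt (s : ℕ → G) {m j : ℕ} (h : j < m) :
    seqProd (seqContract s j) m = seqProd s (m + 1) := by
  induction m with
  | zero => omega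
  | succ m ih =>
    rw [seqProd_succ, seqProd_succ s (m + 1)]
    rcases Nat.lt_or_ge j m with hj | hj
    · rw [ih hj, seqContract, if_neg (by omega), if_neg (by omega)]
    · obtain rfl : j = m := by omega
      rw [seqProd_contract_le s le_rfl, seqContract, if_neg (by omega), if_pos rfl,
        seqProd_succ, mul_assoc]

theorem seqTake_contract_le (s : ℕ → G) {m j : ℕ} (h : m ≤ j) :
    seqTake (seqContract s j) m = seqTake s m := by
  funext i; simp only [seqTake, seqContract]; rw [if_pos (by omega)]

theorem seqShift_contract_lt (s : ℕ → G) {m j : ℕ} (h : j < m) :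
    seqShift (seqContract s j) m = seqShift s (m + 1) := by
  funext i; simp only [seqShift, seqContract]
  rw [if_neg (by omega), if_neg (by omega)]; congr 1; omega

theorem seqShift_contract_add (s : ℕ → G) (m j : ℕ) :
    seqShift (seqContract s (m + j)) m = seqContract (seqShift s m) j := by
  funext i; simp only [seqShift, seqContract, add_lt_add_iff_left, add_right_inj, add_assoc]

theorem seqShift_shift (s : ℕ → G) (m j : ℕ) : seqShift (seqShift s m) j = seqShift s (m + j) := by
  funext i; simp only [seqShift, add_assoc]

theorem contractNth_eq {N : ℕ} (g : Fin (N + 1) → G) (j : Fin (N + 1)) :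
    Fin.contractNth j (· * ·) g = seqTake (seqContract (toSeq g) j) N := by
  funext i
  have h1 : (i : ℕ) < N + 1 := by omega
  have h2 : (i : ℕ) + 1 < N + 1 := by omega
  simp only [Fin.contractNth, seqTake, seqContract, toSeq, dif_pos h1, dif_pos h2]
  rfl

theorem toSeq_take {N : ℕ} (g : Fin N → G) : seqTake (toSeq g) N = g := by
  funext i; simp [seqTake, toSeq]

theorem segment_take (s : ℕ → G) {N : ℕ} (k m : ℕ) (h : k + m ≤ N) :
    segment (seqTake s N) k m h = seqTake (seqShift s k) m := rfl

theorem frontProd_take (s : ℕ → G) {N : ℕ} (m : ℕ) (h : m ≤ N) :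
    frontProd (seqTake s N) m h = seqProd s m := by
  simp only [frontProd, seqProd]
  congr 2
  funext i
  simp [segment, seqTake]

end Sequences

variable {R G : Type u} [CommRing R] [Group G] {A B C : Rep.{u} R G}

/-- The cup product of cochains for a pairing `c` of the coefficients:
`(u ∪ v)(g₁, …, g_{m+n}) = c (u(g₁, …, g_m), g₁ ⋯ g_m · v(g_{m+1}, …, g_{m+n}))`. -/
def cupCochain (c : A.V →ₗ[R] B.V →ₗ[R] C.V) {m n N : ℕ} (h : m + n = N)
    (u : (Fin m → G) → A.V) (v : (Fin n → G) → B.V) : (Fin N → G) → C.V :=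
  fun g => c (u (segment g 0 m (by omega)))
    (B.ρ (frontProd g m (by omega)) (v (segment g m n h.le)))

theorem cupCochain_seq (c : A.V →ₗ[R] B.V →ₗ[R] C.V) {m n N : ℕ} (h : m + n = N)
    (u : (Fin m → G) → A.V) (v : (Fin n → G) → B.V) (s : ℕ → G) :
    cupCochain c h u v (seqTake s N) =
      c (u (seqTake s m)) (B.ρ (seqProd s m) (v (seqTake (seqShift s m) n))) := by
  have h0 : seqShift s 0 = s := by funext i; simp [seqShift]
  rw [cupCochain, frontProd_take, segment_take, segment_take, h0]

/-- The differential of a cochain, as a function. -/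
def cochainD (A : Rep.{u} R G) (n : ℕ) (u : (Fin n → G) → A.V) : (Fin (n + 1) → G) → A.V :=
  (inhomogeneousCochains.d A n).hom u

theorem cochainD_seq {n : ℕ} (u : (Fin n → G) → A.V) (s : ℕ → G) :
    cochainD A n u (seqTake s (n + 1)) = A.ρ (s 0) (u (seqTake (seqShift s 1) n)) +
      ∑ j ∈ Finset.range (n + 1), (-1 : R) ^ (j + 1) • u (seqTake (seqContract s j) n) := by
  have h0 : (fun i : Fin n => seqTake s (n + 1) i.succ) = seqTake (seqShift s 1) n := by
    funext i; simp [seqTake, seqShift, add_comm]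
  have h1 (j : Fin (n + 1)) : Fin.contractNth j (· * ·) (seqTake s (n + 1)) =
      seqTake (seqContract s j) n := by
    rw [contractNth_eq]
    funext i
    have h1 : (i : ℕ) < n + 1 := by omega
    have h2 : (i : ℕ) + 1 < n + 1 := by omega
    simp only [seqTake, seqContract, toSeq, dif_pos h1, dif_pos h2]
  rw [cochainD, inhomogeneousCochains.d_hom_apply, h0, Finset.sum_range]
  simp only [h1]
  rfl

theorem cochain_ext {V : Type*} {N : ℕ} {f f' : (Fin N → G) → V}
    (h : ∀ s : ℕ → G, f (seqTake s N) = f' (seqTake s N)) : f = f' := by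
  funext g; rw [← toSeq_take g]; exact h _

theorem cup_leibniz (c : A.V →ₗ[R] B.V →ₗ[R] C.V)
    (hc : ∀ g a b, c (A.ρ g a) (B.ρ g b) = C.ρ g (c a b)) {m n N : ℕ} (h : m + n = N)
    (u : (Fin m → G) → A.V) (v : (Fin n → G) → B.V) :
    cochainD C N (cupCochain c h u v) =
      cupCochain c (show m + 1 + n = N + 1 by omega) (cochainD A m u) v +
        (-1 : R) ^ m • cupCochain c (show m + (n + 1) = N + 1 by omega) u (cochainD B n v) := by
  refine cochain_ext fun s => ?_
  rw [Pi.add_apply, Pi.smul_apply, cochainD_seq,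
    cupCochain_seq c (show m + 1 + n = N + 1 by omega),
    cupCochain_seq c (show m + (n + 1) = N + 1 by omega), cochainD_seq, cochainD_seq]
  subst h
  have e1 : ∑ j ∈ Finset.range (m + n + 1), (-1 : R) ^ (j + 1) •
      cupCochain c rfl u v (seqTake (seqContract s j) (m + n)) =
      ∑ j ∈ Finset.range m, (-1 : R) ^ (j + 1) • c (u (seqTake (seqContract s j) m))
        (B.ρ (seqProd s (m + 1)) (v (seqTake (seqShift s (m + 1)) n))) +
      (-1 : R) ^ m • ∑ j ∈ Finset.range (n + 1), (-1 : R) ^ (j + 1) • c (u (seqTake s m))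
        (B.ρ (seqProd s m) (v (seqTake (seqContract (seqShift s m) j) n))) := by
    rw [add_assoc, Finset.sum_range_add, Finset.smul_sum]
    congr 1
    · refine Finset.sum_congr rfl fun j hj => ?_
      rw [Finset.mem_range] at hj
      rw [cupCochain_seq, seqProd_contract_lt s hj, seqShift_contract_lt s hj]
    · refine Finset.sum_congr rfl fun j _ => ?_
      rw [cupCochain_seq, seqProd_contract_le s (Nat.le_add_right m j),
        seqTake_contract_le s (Nat.le_add_right m j), seqShift_contract_add, smul_smul]
      congr 1
      ring
  have e2 : C.ρ (s 0) (cupCochain c rfl u v (seqTake (seqShift s 1) (m + n))) =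
      c (A.ρ (s 0) (u (seqTake (seqShift s 1) m)))
        (B.ρ (seqProd s (m + 1)) (v (seqTake (seqShift s (m + 1)) n))) := by
    rw [cupCochain_seq, seqShift_shift, add_comm 1 m, ← hc, seqProd_succ', map_mul, Module.End.mul_apply]
  have e3 : seqTake (seqContract s m) m = seqTake s m := seqTake_contract_le s le_rfl
  have e4 : seqShift s m 0 = s m := rfl
  rw [e1, e2, Finset.sum_range_succ _ m, e3, seqShift_shift, e4]
  simp only [map_add, map_sum, map_smul, LinearMap.add_apply, LinearMap.smul_apply,
    LinearMap.sum_apply, seqProd_succ, map_mul, Module.End.mul_apply, smul_add, Finset.smul_sum,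
    pow_succ]
  module

/-- The cochain underlying a cocycle. -/
def cochainOf {n : ℕ} (z : groupCohomology.cocycles A n) : (Fin n → G) → A.V :=
  (groupCohomology.iCocycles A n).hom z

theorem cochainD_cochainOf {n : ℕ} (z : groupCohomology.cocycles A n) :
    cochainD A n (cochainOf z) = 0 := by
  have h := congrArg (fun f => f.hom z)
    ((groupCohomology.inhomogeneousCochains A).iCycles_d n (n + 1))
  rw [groupCohomology.inhomogeneousCochains.d_def] at h
  exact h

theorem exists_cocycle {n : ℕ} (x : groupCohomology A n) :
    ∃ z : groupCohomology.cocycles A n, (groupCohomology.π A n).hom z = x :=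
  groupCohomology_induction_on x fun z => ⟨z, rfl⟩

theorem cochainD_cupCochain (c : A.V →ₗ[R] B.V →ₗ[R] C.V)
    (hc : ∀ g a b, c (A.ρ g a) (B.ρ g b) = C.ρ g (c a b)) {m n N : ℕ} (h : m + n = N)
    (z : groupCohomology.cocycles A m) (w : groupCohomology.cocycles B n) :
    cochainD C N (cupCochain c h (cochainOf z) (cochainOf w)) = 0 := by
  rw [cup_leibniz c hc h, cochainD_cochainOf, cochainD_cochainOf]
  funext g
  simp [cupCochain]

/-- The product of two cocycles, as a cocycle. -/
def cupCocycle (c : A.V →ₗ[R] B.V →ₗ[R] C.V)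
    (hc : ∀ g a b, c (A.ρ g a) (B.ρ g b) = C.ρ g (c a b)) {m n N : ℕ} (h : m + n = N)
    (z : groupCohomology.cocycles A m) (w : groupCohomology.cocycles B n) :
    groupCohomology.cocycles C N :=
  groupCohomology.cocyclesMk (cupCochain c h (cochainOf z) (cochainOf w))
    (cochainD_cupCochain c hc h z w)

theorem cochainOf_cupCocycle (c : A.V →ₗ[R] B.V →ₗ[R] C.V)
    (hc : ∀ g a b, c (A.ρ g a) (B.ρ g b) = C.ρ g (c a b)) {m n N : ℕ} (h : m + n = N)
    (z : groupCohomology.cocycles A m) (w : groupCohomology.cocycles B n) :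
    cochainOf (cupCocycle c hc h z w) = cupCochain c h (cochainOf z) (cochainOf w) :=
  groupCohomology.iCocycles_mk _ (cochainD_cupCochain c hc h z w)

/-- The cup product `Hᵐ(G, A) × Hⁿ(G, B) → Hᴺ(G, C)`, `N = m + n`, for an equivariant pairing
`c : A × B → C`, computed on representing cocycles. -/
def cup (c : A.V →ₗ[R] B.V →ₗ[R] C.V)
    (hc : ∀ g a b, c (A.ρ g a) (B.ρ g b) = C.ρ g (c a b)) {m n N : ℕ} (h : m + n = N)
    (x : groupCohomology A m) (y : groupCohomology B n) : groupCohomology C N :=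
  (groupCohomology.π C N).hom
    (cupCocycle c hc h (exists_cocycle x).choose (exists_cocycle y).choose)

/-- The cap product of a chain with a cochain for a pairing `c` of the coefficients:
`u ∩ (b ⊗ [g₁|…|g_{k+m}]) = c (g₁ ⋯ g_k · u(g_{k+1}, …, g_{k+m}), b) ⊗ [g₁|…|g_k]`. -/
def capChain (c : A.V →ₗ[R] B.V →ₗ[R] C.V) {k m N : ℕ} (h : k + m = N)
    (u : (Fin m → G) → A.V) : ((Fin N → G) →₀ B.V) →ₗ[R] ((Fin k → G) →₀ C.V) :=
  Finsupp.lsum R fun g => Finsupp.lsingle (segment g 0 k (by omega)) ∘ₗ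
    c (A.ρ (frontProd g k (by omega)) (u (segment g k m h.le)))

/-- The differential of chains. -/
def chainD (A : Rep.{u} R G) (n : ℕ) : ((Fin (n + 1) → G) →₀ A.V) →ₗ[R] ((Fin n → G) →₀ A.V) :=
  (groupHomology.inhomogeneousChains.d A n).hom

theorem capChain_seq (c : A.V →ₗ[R] B.V →ₗ[R] C.V) {k m N : ℕ} (h : k + m = N)
    (u : (Fin m → G) → A.V) (s : ℕ → G) (b : B.V) :
    capChain c h u (Finsupp.single (seqTake s N) b) = Finsupp.single (seqTake s k)
      (c (A.ρ (seqProd s k) (u (seqTake (seqShift s k) m))) b) := by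
  have h0 : seqShift s 0 = s := by funext i; simp [seqShift]
  rw [capChain, Finsupp.lsum_single, LinearMap.comp_apply, frontProd_take, segment_take,
    segment_take, h0]
  rfl

theorem chainD_seq {n : ℕ} (s : ℕ → G) (a : A.V) :
    chainD A n (Finsupp.single (seqTake s (n + 1)) a) =
      Finsupp.single (seqTake (seqShift s 1) n) (A.ρ (s 0)⁻¹ a) +
      ∑ j ∈ Finset.range (n + 1), (-1 : R) ^ (j + 1) •
        Finsupp.single (seqTake (seqContract s j) n) a := by
  have h0 : (fun i : Fin n => seqTake s (n + 1) i.succ) = seqTake (seqShift s 1) n := by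
    funext i; simp [seqTake, seqShift, add_comm]
  have h1 (j : Fin (n + 1)) : Fin.contractNth j (· * ·) (seqTake s (n + 1)) =
      seqTake (seqContract s j) n := by
    rw [contractNth_eq]
    funext i
    have h1 : (i : ℕ) < n + 1 := by omega
    have h2 : (i : ℕ) + 1 < n + 1 := by omega
    simp only [seqTake, seqContract, toSeq, dif_pos h1, dif_pos h2]
  refine (groupHomology.inhomogeneousChains.d_single n _ _).trans ?_
  rw [h0, Finset.sum_range]
  simp only [h1]
  rfl

theorem cap_leibniz (c : A.V →ₗ[R] B.V →ₗ[R] C.V)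
    (hc : ∀ g a b, c (A.ρ g a) (B.ρ g b) = C.ρ g (c a b)) {k m N : ℕ} (h : k + m = N)
    (u : (Fin m → G) → A.V) (z : (Fin (N + 1) → G) →₀ B.V) :
    capChain c h u (chainD B N z) =
      chainD C k (capChain c (show k + 1 + m = N + 1 by omega) u z) +
        (-1 : R) ^ k •
          capChain c (show k + (m + 1) = N + 1 by omega) (cochainD A m u) z := by
  induction z using Finsupp.induction_linear with
  | zero => simp
  | add z z' hz hz' => simp only [map_add, hz, hz', smul_add]; abel
  | single g b =>
    rw [← toSeq_take g]
    generalize toSeq g = s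
    rw [capChain_seq c (show k + 1 + m = N + 1 by omega),
      capChain_seq c (show k + (m + 1) = N + 1 by omega), chainD_seq, chainD_seq, cochainD_seq]
    subst h
    have e1 : ∑ j ∈ Finset.range (k + m + 1), (-1 : R) ^ (j + 1) •
        capChain c rfl u (Finsupp.single (seqTake (seqContract s j) (k + m)) b) =
        ∑ j ∈ Finset.range k, (-1 : R) ^ (j + 1) • Finsupp.single (seqTake (seqContract s j) k)
          (c (A.ρ (seqProd s (k + 1)) (u (seqTake (seqShift s (k + 1)) m))) b) +
        (-1 : R) ^ k • ∑ j ∈ Finset.range (m + 1), (-1 : R) ^ (j + 1) •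
          Finsupp.single (seqTake s k)
            (c (A.ρ (seqProd s k) (u (seqTake (seqContract (seqShift s k) j) m))) b) := by
      rw [add_assoc, Finset.sum_range_add, Finset.smul_sum]
      congr 1
      · refine Finset.sum_congr rfl fun j hj => ?_
        rw [Finset.mem_range] at hj
        rw [capChain_seq, seqProd_contract_lt s hj, seqShift_contract_lt s hj]
      · refine Finset.sum_congr rfl fun j _ => ?_
        rw [capChain_seq, seqProd_contract_le s (Nat.le_add_right k j),
          seqTake_contract_le s (Nat.le_add_right k j), seqShift_contract_add, smul_smul]
        congr 1
        ring
    have e2 : capChain c rfl u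
        (Finsupp.single (seqTake (seqShift s 1) (k + m)) (B.ρ (s 0)⁻¹ b)) =
        Finsupp.single (seqTake (seqShift s 1) k) (C.ρ (s 0)⁻¹
          (c (A.ρ (seqProd s (k + 1)) (u (seqTake (seqShift s (k + 1)) m))) b)) := by
      rw [capChain_seq, seqShift_shift, add_comm 1 k, ← hc, seqProd_succ', map_mul,
        Module.End.mul_apply, ← Module.End.mul_apply, ← map_mul, inv_mul_cancel, map_one,
        Module.End.one_apply]
    have e3 : seqTake (seqContract s k) k = seqTake s k := seqTake_contract_le s le_rfl
    have e4 : seqShift s k 0 = s k := rfl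
    rw [map_add, map_sum]
    simp only [map_smul]
    rw [e1, e2, Finset.sum_range_succ _ k, e3, seqShift_shift, e4]
    simp only [map_add, map_sum, map_smul, LinearMap.add_apply, LinearMap.smul_apply,
      LinearMap.sum_apply, seqProd_succ, map_mul, Module.End.mul_apply, smul_add, Finset.smul_sum,
      Finsupp.single_add, Finsupp.single_finsetSum, ← Finsupp.smul_single, pow_succ]
    module

/-- The chain underlying a cycle. -/
def chainOf {n : ℕ} (z : groupHomology.cycles A n) : (Fin n → G) →₀ A.V :=
  (groupHomology.iCycles A n).hom z

theorem exists_cycle {n : ℕ} (x : groupHomology A n) :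
    ∃ z : groupHomology.cycles A n, (groupHomology.π A n).hom z = x :=
  groupHomology_induction_on x fun z => ⟨z, rfl⟩

theorem capChain_zero (c : A.V →ₗ[R] B.V →ₗ[R] C.V) {k m N : ℕ} (h : k + m = N) :
    capChain c h (0 : (Fin m → G) → A.V) = 0 :=
  Finsupp.lhom_ext fun g b => by simp [capChain]

theorem d_chainOf {n : ℕ} (z : groupHomology.cycles A n) (j : ℕ) :
    ((groupHomology.inhomogeneousChains A).d n j).hom (chainOf z) = 0 :=
  congrArg (fun f => f.hom z) ((groupHomology.inhomogeneousChains A).iCycles_d n j)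

theorem d_capChain (c : A.V →ₗ[R] B.V →ₗ[R] C.V)
    (hc : ∀ g a b, c (A.ρ g a) (B.ρ g b) = C.ρ g (c a b)) {k m N : ℕ} (h : k + m = N)
    (u : groupCohomology.cocycles A m) (z : groupHomology.cycles B N) (j : ℕ) :
    ((groupHomology.inhomogeneousChains C).d k j).hom
      (capChain c h (cochainOf u) (chainOf z)) = 0 := by
  by_cases hj : j + 1 = k
  · subst hj
    obtain ⟨N, rfl⟩ : ∃ M, N = M + 1 := ⟨j + m, by omega⟩
    have hz : chainD B N (chainOf z) = 0 := by
      have h := d_chainOf z N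
      rw [groupHomology.inhomogeneousChains.d_def] at h
      exact h
    rw [groupHomology.inhomogeneousChains.d_def]
    have h' := cap_leibniz c hc (show j + m = N by omega) (cochainOf u) (chainOf z)
    rw [hz, map_zero, cochainD_cochainOf, capChain_zero, LinearMap.zero_apply, smul_zero,
      add_zero] at h'
    exact h'.symm
  · rw [(groupHomology.inhomogeneousChains C).shape _ _ hj]
    rfl

/-- The cap product of a cocycle and a cycle, as a cycle. -/
def capCycle (c : A.V →ₗ[R] B.V →ₗ[R] C.V)
    (hc : ∀ g a b, c (A.ρ g a) (B.ρ g b) = C.ρ g (c a b)) {k m N : ℕ} (h : k + m = N)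
    (u : groupCohomology.cocycles A m) (z : groupHomology.cycles B N) : groupHomology.cycles C k :=
  groupHomology.cyclesMk k ((ComplexShape.down ℕ).next k) rfl
    (capChain c h (cochainOf u) (chainOf z)) (d_capChain c hc h u z _)

theorem chainOf_capCycle (c : A.V →ₗ[R] B.V →ₗ[R] C.V)
    (hc : ∀ g a b, c (A.ρ g a) (B.ρ g b) = C.ρ g (c a b)) {k m N : ℕ} (h : k + m = N)
    (u : groupCohomology.cocycles A m) (z : groupHomology.cycles B N) :
    chainOf (capCycle c hc h u z) = capChain c h (cochainOf u) (chainOf z) :=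
  groupHomology.iCycles_mk rfl _ (d_capChain c hc h u z _)

/-- The cap product `Hᵐ(G, A) × H_N(G, B) → H_k(G, C)`, `k = N - m`, for an equivariant pairing
`c : A × B → C`, computed on a representing cocycle and a representing cycle. -/
def cap (c : A.V →ₗ[R] B.V →ₗ[R] C.V)
    (hc : ∀ g a b, c (A.ρ g a) (B.ρ g b) = C.ρ g (c a b)) {k m N : ℕ} (h : k + m = N)
    (x : groupCohomology A m) (y : groupHomology B N) : groupHomology C k :=
  (groupHomology.π C k).hom
    (capCycle c hc h (exists_cocycle x).choose (exists_cycle y).choose)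


theorem class_eq_iff {n : ℕ} (z z' : groupCohomology.cocycles A n) :
    (groupCohomology.π A n).hom z = (groupCohomology.π A n).hom z' ↔
      ∃ (i : ℕ) (y : (groupCohomology.inhomogeneousCochains A).X i),
        ((groupCohomology.inhomogeneousCochains A).d i n).hom y = cochainOf z - cochainOf z' := by
  have key (i : ℕ) (y : (groupCohomology.inhomogeneousCochains A).X i) :
      (groupCohomology.iCocycles A n).hom
        (((groupCohomology.inhomogeneousCochains A).toCycles i n).hom y) =
        ((groupCohomology.inhomogeneousCochains A).d i n).hom y :=
    congrArg (fun f => f.hom y) ((groupCohomology.inhomogeneousCochains A).toCycles_i i n)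
  have hinj : Function.Injective (groupCohomology.iCocycles A n).hom :=
    (ModuleCat.mono_iff_injective _).1
      (inferInstanceAs (Mono ((groupCohomology.inhomogeneousCochains A).iCycles n)))
  constructor
  · intro h
    let S := ShortComplex.mk
      ((groupCohomology.inhomogeneousCochains A).toCycles ((ComplexShape.up ℕ).prev n) n)
      ((groupCohomology.inhomogeneousCochains A).homologyπ n)
      ((groupCohomology.inhomogeneousCochains A).toCycles_comp_homologyπ _ _)
    have hS : S.Exact := ShortComplex.exact_of_g_is_cokernel S
      ((groupCohomology.inhomogeneousCochains A).homologyIsCokernel _ n rfl)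
    obtain ⟨y, hy⟩ := (ShortComplex.moduleCat_exact_iff S).1 hS (z - z')
      ((map_sub (groupCohomology.π A n).hom z z').trans (sub_eq_zero.2 h))
    refine ⟨_, y, (key _ y).symm.trans ?_⟩
    exact (congrArg (groupCohomology.iCocycles A n).hom hy).trans (map_sub _ z z')
  · rintro ⟨i, y, hy⟩
    have h1 : ((groupCohomology.inhomogeneousCochains A).toCycles i n).hom y = z - z' :=
      hinj ((key i y).trans (hy.trans (map_sub (groupCohomology.iCocycles A n).hom z z').symm))
    have h2 := congrArg (fun f => f.hom y)
      ((groupCohomology.inhomogeneousCochains A).toCycles_comp_homologyπ i n)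
    have h3 : (groupCohomology.π A n).hom (z - z') = 0 := by rw [← h1]; exact h2
    exact sub_eq_zero.1 ((map_sub _ z z').symm.trans h3)

/-- A difference of cohomologous cocycles is the differential of a cochain of the right degree. -/
theorem exists_cochainD {n : ℕ} {z z' : groupCohomology.cocycles A n}
    (h : (groupCohomology.π A n).hom z = (groupCohomology.π A n).hom z') :
    cochainOf z = cochainOf z' ∨ ∃ (k : ℕ) (hk : n = k + 1) (y : (Fin k → G) → A.V),
      cochainD A k y = fun g => (cochainOf z - cochainOf z') (g ∘ Fin.cast hk) := by
  obtain ⟨i, y, hy⟩ := (class_eq_iff z z').1 h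
  by_cases hi : i + 1 = n
  · subst hi
    rw [groupCohomology.inhomogeneousCochains.d_def] at hy
    exact Or.inr ⟨i, rfl, y, hy⟩
  · left
    rw [(groupCohomology.inhomogeneousCochains A).shape _ _ hi] at hy
    exact sub_eq_zero.1 hy.symm

theorem cupCochain_sub (c : A.V →ₗ[R] B.V →ₗ[R] C.V) {m n N : ℕ} (h : m + n = N)
    (u u' : (Fin m → G) → A.V) (v v' : (Fin n → G) → B.V) :
    cupCochain c h u v - cupCochain c h u' v' =
      cupCochain c h (u - u') v + cupCochain c h u' (v - v') := by
  funext g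
  simp only [cupCochain, Pi.sub_apply, Pi.add_apply, map_sub, LinearMap.sub_apply]
  abel

/-- The cup product does not depend on the choice of representing cocycles. -/
theorem cup_π (c : A.V →ₗ[R] B.V →ₗ[R] C.V)
    (hc : ∀ g a b, c (A.ρ g a) (B.ρ g b) = C.ρ g (c a b)) {m n N : ℕ} (h : m + n = N)
    (z : groupCohomology.cocycles A m) (w : groupCohomology.cocycles B n) :
    cup c hc h ((groupCohomology.π A m).hom z) ((groupCohomology.π B n).hom w) =
      (groupCohomology.π C N).hom (cupCocycle c hc h z w) := by
  have hz := exists_cochainD (exists_cocycle ((groupCohomology.π A m).hom z)).choose_spec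
  have hw := exists_cochainD (exists_cocycle ((groupCohomology.π B n).hom w)).choose_spec
  rw [cup]
  generalize (exists_cocycle ((groupCohomology.π A m).hom z)).choose = z' at hz ⊢
  generalize (exists_cocycle ((groupCohomology.π B n).hom w)).choose = w' at hw ⊢
  have h1 : cupCochain c h (cochainOf z' - cochainOf z) (cochainOf w') = 0 ∨
      ∃ (k : ℕ) (hk : k + 1 = N) (y : (Fin k → G) → C.V),
        ((groupCohomology.inhomogeneousCochains C).d k N).hom y =
          cupCochain c h (cochainOf z' - cochainOf z) (cochainOf w') := by
    rcases hz with hz | ⟨k, rfl, y, hy⟩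
    · left; rw [hz, sub_self]; funext g; simp [cupCochain]
    · right
      have hN : k + n + 1 = N := by omega
      subst hN
      refine ⟨k + n, rfl, cupCochain c rfl y (cochainOf w'), ?_⟩
      rw [groupCohomology.inhomogeneousCochains.d_def]
      refine (cup_leibniz c hc rfl y (cochainOf w')).trans ?_
      have h0 : cupCochain c (show k + (n + 1) = k + n + 1 by omega) y
          (0 : (Fin (n + 1) → G) → B.V) = 0 := by
        funext g; simp [cupCochain]
      rw [hy, cochainD_cochainOf, h0, smul_zero, add_zero]
      rfl
  have h2 : cupCochain c h (cochainOf z) (cochainOf w' - cochainOf w) = 0 ∨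
      ∃ (k : ℕ) (hk : k + 1 = N) (y : (Fin k → G) → C.V),
        ((groupCohomology.inhomogeneousCochains C).d k N).hom y =
          cupCochain c h (cochainOf z) (cochainOf w' - cochainOf w) := by
    rcases hw with hw | ⟨k, rfl, y, hy⟩
    · left; rw [hw, sub_self]; funext g; simp [cupCochain]
    · right
      have hN : m + k + 1 = N := by omega
      subst hN
      refine ⟨m + k, rfl, (-1 : R) ^ m • cupCochain c rfl (cochainOf z) y, ?_⟩
      rw [groupCohomology.inhomogeneousCochains.d_def]
      refine (map_smul (inhomogeneousCochains.d C (m + k)).hom _ _).trans ?_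
      refine (congrArg _ (cup_leibniz c hc rfl (cochainOf z) y)).trans ?_
      have h0 : cupCochain c (show m + 1 + k = m + k + 1 by omega)
          (0 : (Fin (m + 1) → G) → A.V) y = 0 := by
        funext g; simp [cupCochain]
      rw [hy, cochainD_cochainOf, h0, zero_add, smul_smul, ← mul_pow, neg_one_mul, neg_neg,
        one_pow, one_smul]
      rfl
  rw [class_eq_iff, cochainOf_cupCocycle, cochainOf_cupCocycle, cupCochain_sub]
  rcases h1 with h1 | ⟨k, rfl, y, hy⟩
  · rcases h2 with h2 | ⟨k, rfl, y, hy⟩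
    · exact ⟨0, 0, by rw [h1, h2, map_zero, add_zero]⟩
    · exact ⟨k, y, by rw [hy, h1, zero_add]⟩
  · rcases h2 with h2 | ⟨k', hk', y', hy'⟩
    · exact ⟨k, y, by rw [hy, h2, add_zero]⟩
    · obtain rfl : k' = k := by omega
      exact ⟨k', y + y', by rw [map_add, hy, hy']⟩

theorem homology_class_eq_iff {n : ℕ} (z z' : groupHomology.cycles A n) :
    (groupHomology.π A n).hom z = (groupHomology.π A n).hom z' ↔
      ∃ y : (Fin (n + 1) → G) →₀ A.V, chainD A n y = chainOf z - chainOf z' := by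
  have key (y : (Fin (n + 1) → G) →₀ A.V) :
      (groupHomology.iCycles A n).hom
        (((groupHomology.inhomogeneousChains A).toCycles (n + 1) n).hom y) = chainD A n y := by
    have h := congrArg (fun f => f.hom y)
      ((groupHomology.inhomogeneousChains A).toCycles_i (n + 1) n)
    rw [groupHomology.inhomogeneousChains.d_def] at h
    exact h
  have hinj : Function.Injective (groupHomology.iCycles A n).hom :=
    (ModuleCat.mono_iff_injective _).1
      (inferInstanceAs (Mono ((groupHomology.inhomogeneousChains A).iCycles n)))
  constructor
  · intro h
    let S := ShortComplex.mk
      ((groupHomology.inhomogeneousChains A).toCycles (n + 1) n)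
      ((groupHomology.inhomogeneousChains A).homologyπ n)
      ((groupHomology.inhomogeneousChains A).toCycles_comp_homologyπ _ _)
    have hS : S.Exact := ShortComplex.exact_of_g_is_cokernel S
      ((groupHomology.inhomogeneousChains A).homologyIsCokernel _ n (by simp))
    obtain ⟨y, hy⟩ := (ShortComplex.moduleCat_exact_iff S).1 hS (z - z')
      ((map_sub (groupHomology.π A n).hom z z').trans (sub_eq_zero.2 h))
    refine ⟨y, (key y).symm.trans ?_⟩
    exact (congrArg (groupHomology.iCycles A n).hom hy).trans (map_sub _ z z')
  · rintro ⟨y, hy⟩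
    have h1 : ((groupHomology.inhomogeneousChains A).toCycles (n + 1) n).hom y = z - z' :=
      hinj ((key y).trans (hy.trans (map_sub (groupHomology.iCycles A n).hom z z').symm))
    have h2 := congrArg (fun f => f.hom y)
      ((groupHomology.inhomogeneousChains A).toCycles_comp_homologyπ (n + 1) n)
    have h3 : (groupHomology.π A n).hom (z - z') = 0 := by rw [← h1]; exact h2
    exact sub_eq_zero.1 ((map_sub _ z z').symm.trans h3)

theorem capChain_sub (c : A.V →ₗ[R] B.V →ₗ[R] C.V) {k m N : ℕ} (h : k + m = N)
    (u u' : (Fin m → G) → A.V) : capChain c h (u - u') = capChain c h u - capChain c h u' :=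
  Finsupp.lhom_ext fun g b => by simp [capChain]

/-- The cap product does not depend on the choice of a representing cocycle and cycle. -/
theorem cap_π (c : A.V →ₗ[R] B.V →ₗ[R] C.V)
    (hc : ∀ g a b, c (A.ρ g a) (B.ρ g b) = C.ρ g (c a b)) {k m N : ℕ} (h : k + m = N)
    (u : groupCohomology.cocycles A m) (z : groupHomology.cycles B N) :
    cap c hc h ((groupCohomology.π A m).hom u) ((groupHomology.π B N).hom z) =
      (groupHomology.π C k).hom (capCycle c hc h u z) := by
  have hu := exists_cochainD (exists_cocycle ((groupCohomology.π A m).hom u)).choose_spec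
  have hz := (homology_class_eq_iff _ _).1
    (exists_cycle ((groupHomology.π B N).hom z)).choose_spec
  rw [cap]
  generalize (exists_cocycle ((groupCohomology.π A m).hom u)).choose = u' at hu ⊢
  generalize (exists_cycle ((groupHomology.π B N).hom z)).choose = z' at hz ⊢
  have h1 : ∃ y, chainD C k y = capChain c h (cochainOf u' - cochainOf u) (chainOf z) := by
    rcases hu with hu | ⟨l, rfl, y, hy⟩
    · exact ⟨0, by rw [hu, sub_self, capChain_zero, map_zero, LinearMap.zero_apply]⟩
    · obtain ⟨M, rfl⟩ : ∃ M, N = M + 1 := ⟨k + l, by omega⟩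
      have h' := cap_leibniz c hc (show k + l = M by omega) y (chainOf z)
      have hz0 : chainD B M (chainOf z) = 0 := by
        have h := d_chainOf z M
        rw [groupHomology.inhomogeneousChains.d_def] at h
        exact h
      rw [hz0, map_zero, hy] at h'
      refine ⟨-((-1 : R) ^ k • capChain c (show k + 1 + l = M + 1 by omega) y (chainOf z)), ?_⟩
      have h'' := eq_neg_of_add_eq_zero_left h'.symm
      rw [map_neg, map_smul, h'', smul_neg, neg_neg, smul_smul, ← mul_pow, neg_one_mul, neg_neg,
        one_pow, one_smul]
      rfl
  have h2 : ∃ y, chainD C k y = capChain c h (cochainOf u') (chainOf z' - chainOf z) := by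
    obtain ⟨y, hy⟩ := hz
    have h' := cap_leibniz c hc h (cochainOf u') y
    rw [cochainD_cochainOf, capChain_zero, LinearMap.zero_apply, smul_zero, add_zero, hy] at h'
    exact ⟨_, h'.symm⟩
  obtain ⟨y1, hy1⟩ := h1
  obtain ⟨y2, hy2⟩ := h2
  rw [homology_class_eq_iff, chainOf_capCycle, chainOf_capCycle]
  refine ⟨y1 + y2, ?_⟩
  rw [map_add, hy1, hy2, capChain_sub, map_sub, LinearMap.sub_apply]
  abel

end Products

/-! ### The coefficient modules `R` and `F(Y;R)`; the statement that `Φ` is induced by the coupling -/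

section Coefficients

/-- The ring isomorphism `Φ : R(B ⋊ Γ) → R(A ⋊ Λ)` is `t ↦ t ∘ φ` for the isomorphism of groupoids
`φ : A ⋊ Λ → B ⋊ Γ`, `φ(a, λ) = (f(a), γ)`, where `γ` is the element with `γ λ a ∈ X_Γ`
(the product being formed in `X`). -/
def TopologicalCoupling.Induces {R Λ Γ X : Type*} [CommRing R] [Group Λ] [Group Γ]
    [TopologicalSpace X] [MulAction Λ X] [MulAction Γ X] [SMulCommClass Λ Γ X]
    [SMulCommClass Γ Λ X] [ContinuousConstSMul Λ X] [ContinuousConstSMul Γ X]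
    (C : TopologicalCoupling Λ Γ X) {A : TopologicalSpace.Clopens C.domΓ.Space}
    {B : TopologicalSpace.Clopens C.domΛ.Space}
    (Φ : GroupoidRing R Γ B ≃+* GroupoidRing R Λ A) : Prop :=
  ∀ (t : GroupoidRing R Γ B) (a : C.domΓ.Space) (l : Λ), a ∈ A → l • a ∈ A →
    groupoidFun (Φ t).1 a l = groupoidFun t.1 (C.f a) (C.domΓ.toDom (l • a.1))

/-- The `RG`-module `F(Y;R)`. -/
def functionRep (R G Y : Type u) [CommRing R] [Group G] [TopologicalSpace Y] [MulAction G Y]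
    [ContinuousConstSMul G Y] : Rep.{u} R G :=
  Rep.ofDistribMulAction R G (LocallyConstant Y R)

/-- The multiplication of `F(Y;R)`. -/
def functionMul (R G Y : Type u) [CommRing R] [Group G] [TopologicalSpace Y] [MulAction G Y]
    [ContinuousConstSMul G Y] :
    (functionRep R G Y).V →ₗ[R] (functionRep R G Y).V →ₗ[R] (functionRep R G Y).V :=
  LinearMap.mul R (LocallyConstant Y R)

theorem functionMul_equivariant (R G Y : Type u) [CommRing R] [Group G] [TopologicalSpace Y]
    [MulAction G Y] [ContinuousConstSMul G Y] (g : G) (a b : (functionRep R G Y).V) :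
    functionMul R G Y ((functionRep R G Y).ρ g a) ((functionRep R G Y).ρ g b) =
      (functionRep R G Y).ρ g (functionMul R G Y a b) := rfl

/-- The multiplication of `R`. -/
def trivialMul (R G : Type u) [CommRing R] [Group G] :
    (Rep.trivial R G R).V →ₗ[R] (Rep.trivial R G R).V →ₗ[R] (Rep.trivial R G R).V :=
  LinearMap.mul R R

theorem trivialMul_equivariant (R G : Type u) [CommRing R] [Group G] (g : G)
    (a b : (Rep.trivial R G R).V) :
    trivialMul R G ((Rep.trivial R G R).ρ g a) ((Rep.trivial R G R).ρ g b) =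
      (Rep.trivial R G R).ρ g (trivialMul R G a b) := rfl

variable {R Λ Γ Y : Type u} [CommRing R] [Group Λ] [Group Γ] [TopologicalSpace Y] [MulAction Γ Y]
  [ContinuousConstSMul Γ Y] {I : Rep.{u} R Λ ⥤ Rep.{u} R Γ}

/-- The map `H_n(Λ,R) → H_n(Γ,I(R)) → H_n(Γ,F(Y;R))` given by a natural transformation and a map
`κ : I(R) → F(Y;R)`. -/
def homologyMap (T : ∀ n, groupHomology.functor R Λ n ⟶ I ⋙ groupHomology.functor R Γ n)
    (κ : I.obj (Rep.trivial R Λ R) ⟶ functionRep R Γ Y) (n : ℕ)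
    (x : groupHomology (Rep.trivial R Λ R) n) : groupHomology (functionRep R Γ Y) n :=
  ((groupHomology.functor R Γ n).map κ).hom (((T n).app (Rep.trivial R Λ R)).hom x)

/-- The map `Hⁿ(Λ,R) → Hⁿ(Γ,I(R)) → Hⁿ(Γ,F(Y;R))` given by a natural transformation and a map
`κ : I(R) → F(Y;R)`. -/
def cohomologyMap (T : ∀ n, groupCohomology.functor R Λ n ⟶ I ⋙ groupCohomology.functor R Γ n)
    (κ : I.obj (Rep.trivial R Λ R) ⟶ functionRep R Γ Y) (n : ℕ)
    (x : groupCohomology (Rep.trivial R Λ R) n) : groupCohomology (functionRep R Γ Y) n :=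
  ((groupCohomology.functor R Γ n).map κ).hom (((T n).app (Rep.trivial R Λ R)).hom x)

end Coefficients

section Identifications

variable {R Λ Γ X : Type u} [CommRing R] [Group Λ] [Group Γ] [TopologicalSpace X] [MulAction Λ X]
  [MulAction Γ X] [SMulCommClass Λ Γ X] [SMulCommClass Γ Λ X] [ContinuousConstSMul Λ X]
  [ContinuousConstSMul Γ X] {C : TopologicalCoupling Λ Γ X}
  {A : TopologicalSpace.Clopens C.domΓ.Space} {B : TopologicalSpace.Clopens C.domΛ.Space}
  {Φ : GroupoidRing R Γ B →+* GroupoidRing R Λ A}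

/-- The canonical map `R(X_Λ ⋊ Γ) χ_B ⊗_{R(B ⋊ Γ)} res_Φ (χ_A R(X_Γ ⋊ Λ) ⊗_{RΛ} R) → F(X_Λ;R)`,
`s' ⊗ (s ⊗ r) ↦ s' · h`, where `h` is any function with `h ∘ f = s · r` on `A`. -/
def IsCanonicalLower (κ : (indLower Φ).obj (Rep.trivial R Λ R) ⟶ functionRep R Γ C.domΛ.Space) :
    Prop :=
  ∀ (s' : colIdeal R Γ B) (s : rowIdeal R Λ A) (r : R) (h : LocallyConstant C.domΛ.Space R),
    (∀ a ∈ A, h (C.f a) = act s.1 (LocallyConstant.const _ r) a) →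
    κ.hom (show IndLower Φ (Rep.trivial R Λ R) from BalancedTensor.mk _ _ s'
      (show RowTensor A (Rep.trivial R Λ R) from BalancedTensor.mk _ _ s (show R from r))) =
        (show LocallyConstant C.domΛ.Space R from act s'.1 h)

/-- The canonical map
`F(X_Λ;R) → Hom_{R(B ⋊ Γ)} (χ_B R(X_Λ ⋊ Γ), res_Φ (χ_A R(X_Γ ⋊ Λ) ⊗_{RΛ} R))`: the homomorphism
attached to `k` sends `x` to the element `s ⊗ 1` with `s · 1 = (x · k) ∘ f` on `A`. -/
def IsCanonicalUpper (κ : functionRep R Γ C.domΛ.Space ⟶ (indUpper Φ).obj (Rep.trivial R Λ R)) :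
    Prop :=
  ∀ (k : LocallyConstant C.domΛ.Space R) (x : rowIdeal R Γ B) (s : rowIdeal R Λ A),
    (∀ a ∈ A, act x.1 k (C.f a) = act s.1 1 a) →
    (show IndUpper Φ (Rep.trivial R Λ R) from κ.hom k).1 x =
      BalancedTensor.mk (rowRightGroup R Λ A) (repLeft (Rep.trivial R Λ R)) s (1 : R)

end Identifications

end

end CouplingInduction

open CouplingInduction

/-! Write `G = Λ`, `H = Γ`, `D = X_Λ`, `D' = X_Γ`. Every module in the theorem is a module of
locally constant functions `X → M`. Such a function on the compact space `X_Γ` has finitely many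
values, so `R(X_Γ ⋊ G) ⊗_{RG} M` is the module of `H`-invariant functions (`fullEquiv`). The subset
`U` of `X` underlying `A` is a slice: it embeds into both orbit spaces, with images `A` and `B`.
Extension from `U` turns `H`-invariant functions supported over `A` into `G`-equivariant functions
supported over `B`, and the crossed products act compatibly through `Φ` (`crossAct_transferFun`).
Since `B` meets every orbit, inducing from `B ⋊ H` to `X_Λ ⋊ H` recovers all `G`-equivariant
functions: those with compact support modulo `G` for the tensor product (`lowerEquiv`), those with
arbitrary support for `Hom` (`upperEquiv`).

It remains to compare the cohomology of `G` in the `H`-invariant functions with that of `H` in the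
`G`-equivariant functions; conceptually, both are the cohomology of `G × H` in the locally constant
functions `X → M`. An explicit comparison comes from the equivariant map `coc : X → G` with `x ∈ coc
x • D`: a homogeneous `G`-cochain `u` is sent to `(h₀, …, hₙ) ↦ (x ↦ u(coc (h₀⁻¹ x), …, coc (hₙ⁻¹
x))(x))`. The transfer there and back substitutes, at each point `x`, one vertex map for the
identity, and the prism operator of `prism_identity` is a homotopy between the two
(`transferCohomology_transferCohomology`).

For homology the coefficients are written as traces `∑ ρ(g) k(g⁻¹ x)` of compactly supported
functions `k`. Cutting `k` into pieces on which the relevant values of `coc` are constant reduces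
everything to small simplices, on which the transfer merely relabels vertices and exchanges one
trace for the other (`transferChain_hsingle`, `chain_hom_ext`). The same prism gives the homotopy.

In homogeneous form a cup product is the pointwise product of front and back faces, which a
substitution of vertices respects; the cap product obeys a projection formula (`transferChain_cap`).
For trivial coefficients the induction maps are constants, then transfer, then passage to functions
on the orbit space, and each of these is multiplicative. -/

namespace CouplingInduction

noncomputable section

set_option linter.unusedSectionVars false

/-! ### Homogeneous form of cochains and chains -/

/-! ### Faces of sequences and the prism over two sequences. -/

section Simplicial

variable {α : Type*}

/-- Omission of the `j`-th term of a sequence. -/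
def face (j : ℕ) (s : ℕ → α) : ℕ → α := fun i => if i < j then s i else s (i + 1)

/-- The `i`-th simplex `(s₀, …, sᵢ, tᵢ, tᵢ₊₁, …)` of the prism over two sequences. -/
def mix (i : ℕ) (s t : ℕ → α) : ℕ → α := fun a => if a ≤ i then s a else t (a - 1)

/-- For `j ≤ i` the term `t j` does not occur in the prism simplex, so only `s j` is lost and one
more term of `s` moves below the break. In the next lemma, `i < j`, it is `t j` that is lost, and it
sits in position `j + 1`. -/
theorem mix_face_of_le {i j : ℕ} (h : j ≤ i) (s t : ℕ → α) :
    mix i (face j s) (face j t) = face j (mix (i + 1) s t) := by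
  funext a
  simp only [mix, face]
  split_ifs <;> first | rfl | (exfalso; omega) | (congr 1; omega)

theorem mix_face_of_lt {i j : ℕ} (h : i < j) (s t : ℕ → α) :
    mix i (face j s) (face j t) = face (j + 1) (mix i s t) := by
  funext a
  simp only [mix, face]
  split_ifs <;> first | rfl | (exfalso; omega) | (congr 1; omega)

/-- The face shared by two neighbouring simplices of the prism; it makes the diagonal terms
telescope. -/
theorem face_mix_succ (i : ℕ) (s t : ℕ → α) :
    face (i + 1) (mix i s t) = face (i + 1) (mix (i + 1) s t) := by
  funext a
  simp only [mix, face]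
  split_ifs <;> first | rfl | (exfalso; omega)

theorem face_comp {β : Type*} (φ : α → β) (j : ℕ) (s : ℕ → α) :
    face j (fun i => φ (s i)) = fun i => φ (face j s i) := by
  funext a
  simp only [face]
  split_ifs <;> rfl

/-- The terms with `j < i` and `i + 1 < j` are reindexed so as to match the prism over the faces of
the two sequences. The terms with `j = i` and `j = i + 1` are kept apart: they are the top, bottom
and interior walls of the prism. -/
theorem sum_range_prism {W : Type*} [AddCommGroup W] (g : ℕ → ℕ → W) (n : ℕ) :
    ∑ i ∈ Finset.range (n + 1), ∑ j ∈ Finset.range (n + 2), g i j =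
      ∑ i ∈ Finset.range n, ∑ j ∈ Finset.range (n + 1), (if j ≤ i then g (i + 1) j else g i (j + 1)) +
        ∑ i ∈ Finset.range (n + 1), (g i i + g i (i + 1)) := by
  have h1 (i : ℕ) (hi : i ∈ Finset.range (n + 1)) : ∑ j ∈ Finset.range (n + 2), g i j =
      ∑ j ∈ Finset.range (n + 2), (if j < i then g i j else 0) +
        ∑ j ∈ Finset.range (n + 2), (if i + 1 < j then g i j else 0) + (g i i + g i (i + 1)) := by
    rw [Finset.mem_range] at hi
    have e1 : g i i = ∑ j ∈ Finset.range (n + 2), if j = i then g i j else 0 := by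
      rw [Finset.sum_ite_eq' , if_pos (Finset.mem_range.2 (by omega))]
    have e2 : g i (i + 1) = ∑ j ∈ Finset.range (n + 2), if j = i + 1 then g i j else 0 := by
      rw [Finset.sum_ite_eq' , if_pos (Finset.mem_range.2 (by omega))]
    rw [e1, e2, ← Finset.sum_add_distrib, ← Finset.sum_add_distrib, ← Finset.sum_add_distrib]
    refine Finset.sum_congr rfl fun j _ => ?_
    rcases lt_trichotomy j i with h | rfl | h
    · simp [h, show ¬ (i + 1 < j) by omega, show j ≠ i by omega, show j ≠ i + 1 by omega]
    · simp
    · rcases Nat.lt_or_ge (i + 1) j with h' | h'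
      · simp [h', show ¬ (j < i) by omega, show j ≠ i by omega, show j ≠ i + 1 by omega]
      · obtain rfl : j = i + 1 := by omega
        simp
  rw [Finset.sum_congr rfl h1, Finset.sum_add_distrib, Finset.sum_add_distrib]
  congr 1
  have h2 : ∑ i ∈ Finset.range (n + 1), ∑ j ∈ Finset.range (n + 2), (if j < i then g i j else 0) =
      ∑ i ∈ Finset.range n, ∑ j ∈ Finset.range (n + 1), if j ≤ i then g (i + 1) j else 0 := by
    rw [Finset.sum_range_succ']
    simp only [not_lt_zero, if_false, Finset.sum_const_zero, add_zero]
    refine Finset.sum_congr rfl fun i hi => ?_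
    rw [Finset.mem_range] at hi
    rw [Finset.sum_range_succ, if_neg (by omega), add_zero]
    exact Finset.sum_congr rfl fun j _ => by simp only [Nat.lt_succ_iff]
  have h3 : ∑ i ∈ Finset.range (n + 1), ∑ j ∈ Finset.range (n + 2),
      (if i + 1 < j then g i j else 0) =
      ∑ i ∈ Finset.range n, ∑ j ∈ Finset.range (n + 1), if j ≤ i then 0 else g i (j + 1) := by
    rw [Finset.sum_range_succ, Finset.sum_eq_zero (s := Finset.range (n + 2)), add_zero]
    · refine Finset.sum_congr rfl fun i _ => ?_
      rw [Finset.sum_range_succ', if_neg (by omega), add_zero]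
      refine Finset.sum_congr rfl fun j _ => ?_
      by_cases h : j ≤ i
      · rw [if_neg (by omega), if_pos h]
      · rw [if_pos (by omega), if_neg h]
    · intro j hj
      rw [Finset.mem_range] at hj
      rw [if_neg (by omega)]
  rw [h2, h3, ← Finset.sum_add_distrib]
  refine Finset.sum_congr rfl fun i _ => ?_
  rw [← Finset.sum_add_distrib]
  refine Finset.sum_congr rfl fun j _ => ?_
  split_ifs <;> simp

/-- The homotopy formula for the prism over two sequences. -/
theorem prism_identity {R W : Type*} [CommRing R] [AddCommGroup W] [Module R W]
    (F : (ℕ → α) → W) (n : ℕ) (hF : ∀ s t, (∀ i ≤ n, s i = t i) → F s = F t) (s t : ℕ → α) :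
    ∑ i ∈ Finset.range (n + 1), (-1 : R) ^ i •
        ∑ j ∈ Finset.range (n + 2), (-1 : R) ^ j • F (face j (mix i s t)) +
      ∑ j ∈ Finset.range (n + 1), (-1 : R) ^ j •
        ∑ i ∈ Finset.range n, (-1 : R) ^ i • F (mix i (face j s) (face j t)) = F t - F s := by
  have h1 : ∑ i ∈ Finset.range (n + 1), (-1 : R) ^ i •
        ∑ j ∈ Finset.range (n + 2), (-1 : R) ^ j • F (face j (mix i s t)) =
      ∑ i ∈ Finset.range (n + 1), ∑ j ∈ Finset.range (n + 2),
        (-1 : R) ^ (i + j) • F (face j (mix i s t)) := by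
    simp only [Finset.smul_sum, smul_smul, pow_add]
  have h2 : ∑ j ∈ Finset.range (n + 1), (-1 : R) ^ j •
        ∑ i ∈ Finset.range n, (-1 : R) ^ i • F (mix i (face j s) (face j t)) =
      -∑ i ∈ Finset.range n, ∑ j ∈ Finset.range (n + 1),
        (if j ≤ i then (-1 : R) ^ (i + 1 + j) • F (face j (mix (i + 1) s t))
          else (-1 : R) ^ (i + (j + 1)) • F (face (j + 1) (mix i s t))) := by
    simp only [Finset.smul_sum, smul_smul, ← pow_add]
    rw [Finset.sum_comm, ← Finset.sum_neg_distrib]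
    refine Finset.sum_congr rfl fun i _ => ?_
    rw [← Finset.sum_neg_distrib]
    refine Finset.sum_congr rfl fun j _ => ?_
    split_ifs with h
    · rw [mix_face_of_le h, ← neg_smul]; congr 1; ring
    · rw [mix_face_of_lt (by omega), ← neg_smul]; congr 1; ring
  rw [h1, h2, sum_range_prism (fun i j => (-1 : R) ^ (i + j) • F (face j (mix i s t)))]
  rw [add_comm, neg_add_cancel_left]
  -- The two diagonal terms carry opposite signs, and the second is rewritten through the common
  -- wall, so that the sum over `i` telescopes.
  have h3 (i : ℕ) : (-1 : R) ^ (i + i) • F (face i (mix i s t)) +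
      (-1 : R) ^ (i + (i + 1)) • F (face (i + 1) (mix i s t)) =
      F (face i (mix i s t)) - F (face (i + 1) (mix (i + 1) s t)) := by
    rw [← face_mix_succ, ← add_assoc, pow_succ, ← two_mul, pow_mul]
    simp [sub_eq_add_neg]
  simp only [h3]
  rw [Finset.sum_range_sub']
  congr 1
  -- The last term of the telescope agrees with `s` only in the positions up to `n`; this is where
  -- `F` must ignore the later ones.
  refine hF _ _ fun i hi => ?_
  simp [face, mix, show i < n + 1 by omega, show i ≤ n + 1 by omega]

end Simplicial

/-! ### Homogeneous cochains and chains. -/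

section Homogeneous

variable {R G : Type u} [CommRing R] [Group G] {A B C : Rep.{u} R G}

/-- The inhomogeneous simplex attached to a homogeneous one. -/
def bar (n : ℕ) (s : ℕ → G) : Fin n → G := fun i => (s i)⁻¹ * s (i + 1)

/-- The partial products of a tuple. -/
def partialProd {n : ℕ} (g : Fin n → G) (i : ℕ) : G := seqProd (toSeq g) i

theorem bar_congr {n : ℕ} {s t : ℕ → G} (h : ∀ i ≤ n, s i = t i) : bar n s = bar n t := by
  funext i
  rw [bar, bar, h i (by omega), h (i + 1) (by omega)]

theorem bar_mul_left (n : ℕ) (g : G) (s : ℕ → G) : bar n (fun i => g * s i) = bar n s := by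
  funext i
  simp [bar, mul_assoc]

theorem partialProd_zero {n : ℕ} (g : Fin n → G) : partialProd g 0 = 1 := by
  simp [partialProd, seqProd]

theorem bar_partialProd {n : ℕ} (g : Fin n → G) : bar n (partialProd g) = g := by
  funext i
  rw [bar, partialProd, partialProd, seqProd_succ, inv_mul_cancel_left, toSeq, dif_pos i.2]

theorem seqProd_diff (s : ℕ → G) (m : ℕ) :
    seqProd (fun i => (s i)⁻¹ * s (i + 1)) m = (s 0)⁻¹ * s m := by
  induction m with
  | zero => simp [seqProd]
  | succ m ih => rw [seqProd_succ, ih]; group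

theorem seqProd_congr {s t : ℕ → G} {m : ℕ} (h : ∀ i < m, s i = t i) : seqProd s m = seqProd t m := by
  induction m with
  | zero => simp [seqProd]
  | succ m ih => rw [seqProd_succ, seqProd_succ, ih fun i hi => h i (by omega), h m (by omega)]

theorem partialProd_bar (n : ℕ) (s : ℕ → G) {i : ℕ} (hi : i ≤ n) :
    partialProd (bar n s) i = (s 0)⁻¹ * s i := by
  rw [← seqProd_diff, partialProd]
  exact seqProd_congr fun j hj => by rw [toSeq, dif_pos (by omega)]; rfl

theorem bar_eq_seqTake (n : ℕ) (s : ℕ → G) :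
    bar n s = seqTake (fun i => (s i)⁻¹ * s (i + 1)) n := rfl

theorem seqShift_diff_one (s : ℕ → G) :
    seqShift (fun i => (s i)⁻¹ * s (i + 1)) 1 = fun i => (face 0 s i)⁻¹ * face 0 s (i + 1) := by
  funext i
  simp [seqShift, face, add_comm]

theorem seqContract_diff (s : ℕ → G) (j : ℕ) :
    seqContract (fun i => (s i)⁻¹ * s (i + 1)) j =
      fun i => (face (j + 1) s i)⁻¹ * face (j + 1) s (i + 1) := by
  funext i
  simp only [seqContract, face]
  rcases lt_trichotomy i j with h | rfl | h
  · rw [if_pos h, if_pos (by omega), if_pos (by omega)]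
  · rw [if_neg (by omega), if_pos rfl, if_pos (by omega), if_neg (by omega)]
    group
  · rw [if_neg (by omega), if_neg (by omega), if_neg (by omega), if_neg (by omega)]

/-- The homogeneous form of a cochain. -/
def homog {n : ℕ} (u : (Fin n → G) → A.V) (s : ℕ → G) : A.V := A.ρ (s 0) (u (bar n s))

theorem homog_congr {n : ℕ} (u : (Fin n → G) → A.V) {s t : ℕ → G} (h : ∀ i ≤ n, s i = t i) :
    homog u s = homog u t := by
  rw [homog, homog, bar_congr h, h 0 (Nat.zero_le _)]

theorem homog_mul_left {n : ℕ} (u : (Fin n → G) → A.V) (g : G) (s : ℕ → G) :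
    homog u (fun i => g * s i) = A.ρ g (homog u s) := by
  rw [homog, homog, bar_mul_left, map_mul, Module.End.mul_apply]

theorem homog_partialProd {n : ℕ} (u : (Fin n → G) → A.V) (g : Fin n → G) :
    homog u (partialProd g) = u g := by
  rw [homog, partialProd_zero, bar_partialProd, map_one, Module.End.one_apply]

/-- Every tuple is the `bar` of its partial products, a sequence starting at `1`. Identities of
cochains may therefore be checked in homogeneous form. -/
theorem homog_injective {n : ℕ} {u v : (Fin n → G) → A.V} (h : ∀ s, homog u s = homog v s) :
    u = v := by
  funext g
  rw [← homog_partialProd u, h, homog_partialProd]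

/-- The twisted first term of the inhomogeneous differential becomes the face omitting `s 0`, and
the contraction at `j` becomes the face omitting `s (j + 1)`. -/
theorem homog_cochainD {n : ℕ} (u : (Fin n → G) → A.V) (s : ℕ → G) :
    homog (cochainD A n u) s =
      ∑ j ∈ Finset.range (n + 2), (-1 : R) ^ j • homog u (face j s) := by
  rw [Finset.sum_range_succ', homog, bar_eq_seqTake, cochainD_seq, seqShift_diff_one, map_add,
    add_comm, map_sum]
  congr 1
  · refine Finset.sum_congr rfl fun j _ => ?_
    rw [map_smul, seqContract_diff, homog, bar_eq_seqTake]
    rfl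
  · rw [← Module.End.mul_apply, ← map_mul, mul_inv_cancel_left, pow_zero, one_smul]
    rfl

/-- Homogeneous cochains absorb the twist by `g₁ ⋯ g_m`; what remains is front face times back face.
-/
theorem homog_cupCochain (c : A.V →ₗ[R] B.V →ₗ[R] C.V)
    (hc : ∀ g a b, c (A.ρ g a) (B.ρ g b) = C.ρ g (c a b)) {m n N : ℕ} (h : m + n = N)
    (u : (Fin m → G) → A.V) (v : (Fin n → G) → B.V) (s : ℕ → G) :
    homog (A := C) (cupCochain c h u v) s = c (homog u s) (homog v (seqShift s m)) := by
  rw [homog, bar_eq_seqTake, cupCochain_seq, ← hc, seqProd_diff, ← Module.End.mul_apply,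
    ← map_mul, mul_inv_cancel_left]
  rfl

/-- The chain attached to a homogeneous simplex. -/
def hsingle (n : ℕ) (s : ℕ → G) : A.V →ₗ[R] ((Fin n → G) →₀ A.V) :=
  Finsupp.lsingle (bar n s) ∘ₗ A.ρ (s 0)⁻¹

theorem hsingle_apply (n : ℕ) (s : ℕ → G) (a : A.V) :
    hsingle n s a = Finsupp.single (bar n s) (A.ρ (s 0)⁻¹ a) := rfl

theorem hsingle_congr (n : ℕ) {s t : ℕ → G} (h : ∀ i ≤ n, s i = t i) :
    hsingle (A := A) n s = hsingle n t := by
  rw [hsingle, hsingle, bar_congr h, h 0 (Nat.zero_le _)]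

theorem hsingle_partialProd {n : ℕ} (g : Fin n → G) (a : A.V) :
    hsingle n (partialProd g) a = Finsupp.single g a := by
  rw [hsingle_apply, bar_partialProd, partialProd_zero, inv_one, map_one, Module.End.one_apply]

theorem chainD_hsingle (n : ℕ) (s : ℕ → G) (a : A.V) :
    chainD A n (hsingle (n + 1) s a) =
      ∑ j ∈ Finset.range (n + 2), (-1 : R) ^ j • hsingle n (face j s) a := by
  rw [Finset.sum_range_succ', hsingle_apply, bar_eq_seqTake, chainD_seq, seqShift_diff_one,
    add_comm]
  congr 1
  · refine Finset.sum_congr rfl fun j _ => ?_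
    rw [seqContract_diff, hsingle_apply, bar_eq_seqTake]
    rfl
  · rw [← Module.End.mul_apply, ← map_mul, ← mul_inv_rev, mul_inv_cancel_left, pow_zero, one_smul]
    rfl

/-- Here too the twist disappears: `u` is evaluated on the last `m + 1` vertices, and the first `k +
1` vertices survive. -/
theorem capChain_hsingle (c : A.V →ₗ[R] B.V →ₗ[R] C.V)
    (hc : ∀ g a b, c (A.ρ g a) (B.ρ g b) = C.ρ g (c a b)) {k m N : ℕ} (h : k + m = N)
    (u : (Fin m → G) → A.V) (s : ℕ → G) (b : B.V) :
    capChain c h u (hsingle N s b) = hsingle k s (c (homog u (seqShift s k)) b) := by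
  rw [hsingle_apply, bar_eq_seqTake, capChain_seq, hsingle_apply, ← hc, homog,
    ← Module.End.mul_apply, ← map_mul, seqProd_diff]
  rfl

end Homogeneous

/-! ### Maps on (co)homology given by formulas for (co)chains -/

section Complexes

variable {R G H : Type u} [CommRing R] [Group G] [Group H] {A A' : Rep.{u} R G} {B B' : Rep.{u} R H}

section Cohomology

variable (t : ∀ n, ((Fin n → G) → A.V) →ₗ[R] ((Fin n → H) → B.V))
  (ht : ∀ n u, cochainD B n (t n u) = t (n + 1) (cochainD A n u))

/-- The morphism of complexes of inhomogeneous cochains given by linear maps that commute with the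
differentials. -/
def cochainsHom : groupCohomology.inhomogeneousCochains A ⟶
    groupCohomology.inhomogeneousCochains B where
  f n := ModuleCat.ofHom (t n)
  comm' i j hij := by
    obtain rfl : i + 1 = j := hij
    rw [groupCohomology.inhomogeneousCochains.d_def, groupCohomology.inhomogeneousCochains.d_def]
    exact ModuleCat.hom_ext (LinearMap.ext fun u => ht i u)

/-- The map on cohomology given by linear maps of cochains that commute with the differentials. -/
def cohomologyHom (n : ℕ) : groupCohomology A n ⟶ groupCohomology B n :=
  HomologicalComplex.homologyMap (cochainsHom t ht) n

theorem cochainOf_injective {n : ℕ} {z z' : groupCohomology.cocycles A n}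
    (h : cochainOf z = cochainOf z') : z = z' :=
  (ModuleCat.mono_iff_injective _).1
    (inferInstanceAs (Mono ((groupCohomology.inhomogeneousCochains A).iCycles n))) h

theorem chainOf_injective {n : ℕ} {z z' : groupHomology.cycles A n}
    (h : chainOf z = chainOf z') : z = z' :=
  (ModuleCat.mono_iff_injective _).1
    (inferInstanceAs (Mono ((groupHomology.inhomogeneousChains A).iCycles n))) h

/-- The map on cocycles given by linear maps of cochains that commute with the differentials. -/
def cocyclesHom (n : ℕ) (z : groupCohomology.cocycles A n) : groupCohomology.cocycles B n :=
  (HomologicalComplex.cyclesMap (cochainsHom t ht) n).hom z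

theorem cochainOf_cocyclesHom {n : ℕ} (z : groupCohomology.cocycles A n) :
    cochainOf (cocyclesHom t ht n z) = t n (cochainOf z) :=
  congrArg (fun f => f.hom z) (HomologicalComplex.cyclesMap_i (cochainsHom t ht) n)

theorem cohomologyHom_π {n : ℕ} (z : groupCohomology.cocycles A n) :
    (cohomologyHom t ht n).hom ((groupCohomology.π A n).hom z) =
      (groupCohomology.π B n).hom (cocyclesHom t ht n z) :=
  congrArg (fun f => f.hom z) (HomologicalComplex.homologyπ_naturality (cochainsHom t ht) n)

/-- In degree `0` there are no coboundaries, so equality on cocycles is required there; in higher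
degrees a cobounding cochain for each single cocycle suffices. -/
theorem cohomologyHom_eq_self_of_homotopy
    (t : ∀ n, ((Fin n → G) → A.V) →ₗ[R] ((Fin n → G) → A.V))
    (ht : ∀ n u, cochainD A n (t n u) = t (n + 1) (cochainD A n u))
    (h0 : ∀ u, cochainD A 0 u = 0 → t 0 u = u)
    (h : ∀ n u, cochainD A (n + 1) u = 0 → ∃ y, cochainD A n y = t (n + 1) u - u) {n : ℕ}
    (x : groupCohomology A n) : (cohomologyHom t ht n).hom x = x := by
  obtain ⟨z, rfl⟩ := exists_cocycle x
  rw [cohomologyHom_π, class_eq_iff, cochainOf_cocyclesHom]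
  cases n with
  | zero => exact ⟨0, 0, by rw [h0 _ (cochainD_cochainOf z), map_zero, sub_self]⟩
  | succ n =>
    obtain ⟨y, hy⟩ := h n _ (cochainD_cochainOf z)
    refine ⟨n, y, ?_⟩
    rw [groupCohomology.inhomogeneousCochains.d_def]
    exact hy

theorem cohomologyHom_naturality (t' : ∀ n, ((Fin n → G) → A'.V) →ₗ[R] ((Fin n → H) → B'.V))
    (ht' : ∀ n u, cochainD B' n (t' n u) = t' (n + 1) (cochainD A' n u))
    (φ : A ⟶ A') (ψ : B ⟶ B')
    (h : ∀ n u, t' n (fun g => φ.hom (u g)) = fun g => ψ.hom (t n u g)) (n : ℕ) :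
    (groupCohomology.functor R G n).map φ ≫ cohomologyHom t' ht' n =
      cohomologyHom t ht n ≫ (groupCohomology.functor R H n).map ψ := by
  change HomologicalComplex.homologyMap _ n ≫ HomologicalComplex.homologyMap _ n =
    HomologicalComplex.homologyMap _ n ≫ HomologicalComplex.homologyMap _ n
  rw [← HomologicalComplex.homologyMap_comp, ← HomologicalComplex.homologyMap_comp]
  congr 1
  ext n : 1
  exact ModuleCat.hom_ext (LinearMap.ext fun u => h n u)

theorem cohomologyHom_comp {K : Type u} [Group K] {C : Rep.{u} R K}
    (t' : ∀ n, ((Fin n → H) → B.V) →ₗ[R] ((Fin n → K) → C.V))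
    (ht' : ∀ n u, cochainD C n (t' n u) = t' (n + 1) (cochainD B n u)) {n : ℕ}
    (x : groupCohomology A n) :
    (cohomologyHom t' ht' n).hom ((cohomologyHom t ht n).hom x) =
      (cohomologyHom (fun n => t' n ∘ₗ t n) (fun n u => by
        rw [LinearMap.comp_apply, ht', ht]; rfl) n).hom x := by
  obtain ⟨z, rfl⟩ := exists_cocycle x
  rw [cohomologyHom_π, cohomologyHom_π, cohomologyHom_π]
  congr 1
  apply cochainOf_injective
  simp only [cochainOf_cocyclesHom]
  rfl

theorem cohomologyHom_cup {A₁ A₂ A₃ : Rep.{u} R G} {B₁ B₂ B₃ : Rep.{u} R H}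
    {t₁ : ∀ n, ((Fin n → G) → A₁.V) →ₗ[R] ((Fin n → H) → B₁.V)}
    {t₂ : ∀ n, ((Fin n → G) → A₂.V) →ₗ[R] ((Fin n → H) → B₂.V)}
    {t₃ : ∀ n, ((Fin n → G) → A₃.V) →ₗ[R] ((Fin n → H) → B₃.V)}
    (ht₁ : ∀ n u, cochainD B₁ n (t₁ n u) = t₁ (n + 1) (cochainD A₁ n u))
    (ht₂ : ∀ n u, cochainD B₂ n (t₂ n u) = t₂ (n + 1) (cochainD A₂ n u))
    (ht₃ : ∀ n u, cochainD B₃ n (t₃ n u) = t₃ (n + 1) (cochainD A₃ n u))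
    (c : A₁.V →ₗ[R] A₂.V →ₗ[R] A₃.V) (hc : ∀ g a b, c (A₁.ρ g a) (A₂.ρ g b) = A₃.ρ g (c a b))
    (c' : B₁.V →ₗ[R] B₂.V →ₗ[R] B₃.V) (hc' : ∀ g a b, c' (B₁.ρ g a) (B₂.ρ g b) = B₃.ρ g (c' a b))
    {m n N : ℕ} (h : m + n = N)
    (hcup : ∀ u v, t₃ N (cupCochain c h u v) = cupCochain c' h (t₁ m u) (t₂ n v))
    (x : groupCohomology A₁ m) (y : groupCohomology A₂ n) :
    (cohomologyHom t₃ ht₃ N).hom (cup c hc h x y) =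
      cup c' hc' h ((cohomologyHom t₁ ht₁ m).hom x) ((cohomologyHom t₂ ht₂ n).hom y) := by
  obtain ⟨z, rfl⟩ := exists_cocycle x
  obtain ⟨w, rfl⟩ := exists_cocycle y
  rw [cup_π, cohomologyHom_π, cohomologyHom_π, cohomologyHom_π, cup_π]
  congr 1
  apply cochainOf_injective
  rw [cochainOf_cocyclesHom, cochainOf_cupCocycle, cochainOf_cupCocycle, hcup,
    cochainOf_cocyclesHom, cochainOf_cocyclesHom]

end Cohomology

section Homology

variable (t : ∀ n, ((Fin n → G) →₀ A.V) →ₗ[R] ((Fin n → H) →₀ B.V))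
  (ht : ∀ n u, chainD B n (t (n + 1) u) = t n (chainD A n u))

/-- The morphism of complexes of inhomogeneous chains given by linear maps that commute with the
differentials. -/
def chainsHom : groupHomology.inhomogeneousChains A ⟶ groupHomology.inhomogeneousChains B where
  f n := ModuleCat.ofHom (t n)
  comm' i j hij := by
    obtain rfl : j + 1 = i := hij
    rw [groupHomology.inhomogeneousChains.d_def, groupHomology.inhomogeneousChains.d_def]
    exact ModuleCat.hom_ext (LinearMap.ext fun u => ht j u)

/-- The map on homology given by linear maps of chains that commute with the differentials. -/
def homologyHom (n : ℕ) : groupHomology A n ⟶ groupHomology B n :=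
  HomologicalComplex.homologyMap (chainsHom t ht) n

/-- The map on cycles given by linear maps of chains that commute with the differentials. -/
def cyclesHom (n : ℕ) (z : groupHomology.cycles A n) : groupHomology.cycles B n :=
  (HomologicalComplex.cyclesMap (chainsHom t ht) n).hom z

theorem chainOf_cyclesHom {n : ℕ} (z : groupHomology.cycles A n) :
    chainOf (cyclesHom t ht n z) = t n (chainOf z) :=
  congrArg (fun f => f.hom z) (HomologicalComplex.cyclesMap_i (chainsHom t ht) n)

theorem homologyHom_π {n : ℕ} (z : groupHomology.cycles A n) :
    (homologyHom t ht n).hom ((groupHomology.π A n).hom z) =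
      (groupHomology.π B n).hom (cyclesHom t ht n z) :=
  congrArg (fun f => f.hom z) (HomologicalComplex.homologyπ_naturality (chainsHom t ht) n)

theorem chainD_chainOf {n : ℕ} (z : groupHomology.cycles A (n + 1)) :
    chainD A n (chainOf z) = 0 := by
  have h := d_chainOf z n
  rw [groupHomology.inhomogeneousChains.d_def] at h
  exact h

theorem homologyHom_eq_self_of_homotopy
    (t : ∀ n, ((Fin n → G) →₀ A.V) →ₗ[R] ((Fin n → G) →₀ A.V))
    (ht : ∀ n u, chainD A n (t (n + 1) u) = t n (chainD A n u))
    (h0 : ∀ u, ∃ y, chainD A 0 y = t 0 u - u)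
    (h : ∀ n u, chainD A n u = 0 → ∃ y, chainD A (n + 1) y = t (n + 1) u - u) {n : ℕ}
    (x : groupHomology A n) : (homologyHom t ht n).hom x = x := by
  obtain ⟨z, rfl⟩ := exists_cycle x
  rw [homologyHom_π, homology_class_eq_iff, chainOf_cyclesHom]
  cases n with
  | zero => exact h0 _
  | succ n => exact h n _ (chainD_chainOf z)

theorem homologyHom_naturality (t' : ∀ n, ((Fin n → G) →₀ A'.V) →ₗ[R] ((Fin n → H) →₀ B'.V))
    (ht' : ∀ n u, chainD B' n (t' (n + 1) u) = t' n (chainD A' n u))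
    (φ : A ⟶ A') (ψ : B ⟶ B')
    (h : ∀ n, t' n ∘ₗ Finsupp.mapRange.linearMap φ.hom.toLinearMap =
      Finsupp.mapRange.linearMap ψ.hom.toLinearMap ∘ₗ t n) (n : ℕ) :
    (groupHomology.functor R G n).map φ ≫ homologyHom t' ht' n =
      homologyHom t ht n ≫ (groupHomology.functor R H n).map ψ := by
  change HomologicalComplex.homologyMap _ n ≫ HomologicalComplex.homologyMap _ n =
    HomologicalComplex.homologyMap _ n ≫ HomologicalComplex.homologyMap _ n
  rw [← HomologicalComplex.homologyMap_comp, ← HomologicalComplex.homologyMap_comp]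
  congr 1
  ext n : 1
  refine ModuleCat.hom_ext ?_
  rw [HomologicalComplex.comp_f, HomologicalComplex.comp_f, ModuleCat.hom_comp, ModuleCat.hom_comp]
  refine Eq.trans ?_ ((h n).trans ?_)
  · congr 1
    exact groupHomology.chainsMap_id_f_hom_eq_mapRange n φ
  · congr 1
    exact (groupHomology.chainsMap_id_f_hom_eq_mapRange n ψ).symm

theorem homologyHom_comp {K : Type u} [Group K] {C : Rep.{u} R K}
    (t' : ∀ n, ((Fin n → H) →₀ B.V) →ₗ[R] ((Fin n → K) →₀ C.V))
    (ht' : ∀ n u, chainD C n (t' (n + 1) u) = t' n (chainD B n u)) {n : ℕ}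
    (x : groupHomology A n) :
    (homologyHom t' ht' n).hom ((homologyHom t ht n).hom x) =
      (homologyHom (fun n => t' n ∘ₗ t n) (fun n u => by
        rw [LinearMap.comp_apply, ht', ht]; rfl) n).hom x := by
  obtain ⟨z, rfl⟩ := exists_cycle x
  rw [homologyHom_π, homologyHom_π, homologyHom_π]
  congr 1
  apply chainOf_injective
  simp only [chainOf_cyclesHom]
  rfl

end Homology

section FunctorMap

variable (φ : A ⟶ A')

/-- The map of cochains induced by a map of coefficients. -/
def coeffCochains (n : ℕ) : ((Fin n → G) → A.V) →ₗ[R] ((Fin n → G) → A'.V) :=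
  φ.hom.toLinearMap.compLeft _

/-- The map of chains induced by a map of coefficients. -/
def coeffChains (n : ℕ) : ((Fin n → G) →₀ A.V) →ₗ[R] ((Fin n → G) →₀ A'.V) :=
  Finsupp.mapRange.linearMap φ.hom.toLinearMap

theorem cochainD_coeffCochains (n : ℕ) (u : (Fin n → G) → A.V) :
    cochainD A' n (coeffCochains φ n u) = coeffCochains φ (n + 1) (cochainD A n u) := by
  have h := congrArg (fun f => f.hom u)
    ((groupCohomology.cochainsMap (MonoidHom.id G) φ).comm n (n + 1))
  rw [groupCohomology.inhomogeneousCochains.d_def, groupCohomology.inhomogeneousCochains.d_def] at h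
  exact h

theorem chainD_coeffChains (n : ℕ) (u : (Fin (n + 1) → G) →₀ A.V) :
    chainD A' n (coeffChains φ (n + 1) u) = coeffChains φ n (chainD A n u) := by
  have h := congrArg (fun f => f.hom u)
    ((groupHomology.chainsMap (MonoidHom.id G) φ).comm (n + 1) n)
  rw [groupHomology.inhomogeneousChains.d_def, groupHomology.inhomogeneousChains.d_def,
    ModuleCat.hom_comp, ModuleCat.hom_comp, groupHomology.chainsMap_id_f_hom_eq_mapRange,
    groupHomology.chainsMap_id_f_hom_eq_mapRange] at h
  exact h

theorem groupCohomology_functor_map (n : ℕ) : (groupCohomology.functor R G n).map φ =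
    cohomologyHom (coeffCochains φ) (cochainD_coeffCochains φ) n := by
  change HomologicalComplex.homologyMap _ n = HomologicalComplex.homologyMap _ n
  congr 1

theorem groupHomology_functor_map (n : ℕ) : (groupHomology.functor R G n).map φ =
    homologyHom (coeffChains φ) (chainD_coeffChains φ) n := by
  change HomologicalComplex.homologyMap _ n = HomologicalComplex.homologyMap _ n
  congr 1
  ext n : 1
  exact ModuleCat.hom_ext (groupHomology.chainsMap_id_f_hom_eq_mapRange n φ)

end FunctorMap

end Complexes

/-! ### Equivariant locally constant functions -/

section LocallyConstant

variable {X J M : Type*} [TopologicalSpace X]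

/-- Near a point the index `q x` is frozen and a single member of the family remains. This permits
substituting group elements that depend on the point. -/
theorem isLocallyConstant_diag {q : X → J} (hq : IsLocallyConstant q) {F : J → X → M}
    (hF : ∀ j, IsLocallyConstant (F j)) : IsLocallyConstant fun x => F (q x) x := by
  rw [IsLocallyConstant.iff_eventually_eq]
  intro x
  filter_upwards [hq.eventually_eq x, (hF (q x)).eventually_eq x] with y h1 h2
  rw [h1, h2]

theorem isLocallyConstant_pi {ι : Type*} [Finite ι] {q : X → ι → J}
    (hq : ∀ i, IsLocallyConstant fun x => q x i) : IsLocallyConstant q := by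
  rw [IsLocallyConstant.iff_eventually_eq]
  intro x
  filter_upwards [Filter.eventually_all.2 fun i => (hq i).eventually_eq x] with y hy
  exact funext hy

theorem isLocallyConstant_smul {G : Type*} [Group G] [MulAction G X] [ContinuousConstSMul G X]
    {q : X → J} (hq : IsLocallyConstant q) (g : G) : IsLocallyConstant fun x => q (g • x) :=
  hq.comp_continuous (continuous_const_smul g)

theorem finite_image_of_isCompact {q : X → J} (hq : IsLocallyConstant q) {K : Set X}
    (hK : IsCompact K) : (q '' K).Finite := by
  -- For the discrete topology local constancy is continuity, and a compact discrete image is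
  -- finite.
  let : TopologicalSpace J := ⊥
  have : DiscreteTopology J := ⟨rfl⟩
  exact (hK.image hq.continuous).finite_of_discrete

theorem isLocallyConstant_indicator [Zero M] {f : X → M} (hf : IsLocallyConstant f) {U : Set X}
    (hU : IsClopen U) : IsLocallyConstant (U.indicator f) := by
  rw [IsLocallyConstant.iff_eventually_eq]
  intro x
  by_cases hx : x ∈ U
  · filter_upwards [hf.eventually_eq x, hU.isOpen.mem_nhds hx] with y h1 h2
    rw [Set.indicator_of_mem h2, Set.indicator_of_mem hx, h1]
  · filter_upwards [hU.compl.isOpen.mem_nhds hx] with y h2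
    rw [Set.indicator_of_notMem h2, Set.indicator_of_notMem hx]

end LocallyConstant

/-! ### The equivariant map to the group given by a fundamental domain. -/

namespace ClopenDomain

variable {G X : Type*} [Group G] [TopologicalSpace X] [MulAction G X] (D : ClopenDomain G X)

/-- The element `g` with `x ∈ g D`. -/
def coc (x : X) : G := (D.toDom x)⁻¹

theorem coc_inv_smul_mem (x : X) : (D.coc x)⁻¹ • x ∈ D.carrier := by
  rw [coc, inv_inv]; exact D.toDom_mem x

theorem coc_unique {x : X} {g : G} (h : g⁻¹ • x ∈ D.carrier) : D.coc x = g := by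
  rw [coc, ← D.toDom_unique h, inv_inv]

/-- The equivariance on which both transfers rest: moving `x` by `g` multiplies every vertex built
from `coc` by `g`. -/
theorem coc_smul (g : G) (x : X) : D.coc (g • x) = g * D.coc x :=
  D.coc_unique (by rw [mul_inv_rev, mul_smul, inv_smul_smul]; exact D.coc_inv_smul_mem x)

theorem coc_eq_one_iff {x : X} : D.coc x = 1 ↔ x ∈ D.carrier := by
  constructor
  · intro h
    have := D.coc_inv_smul_mem x
    rwa [h, inv_one, one_smul] at this
  · intro h
    exact D.coc_unique (by rwa [inv_one, one_smul])

/-- The translate of `D` that contains `x` is open, and `coc` is constant on it. -/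
theorem isLocallyConstant_coc [ContinuousConstSMul G X] : IsLocallyConstant D.coc := by
  rw [IsLocallyConstant.iff_eventually_eq]
  intro x
  have h : IsOpen {y : X | (D.coc x)⁻¹ • y ∈ D.carrier} :=
    D.isClopen.isOpen.preimage (continuous_const_smul _)
  filter_upwards [h.mem_nhds (D.coc_inv_smul_mem x)] with y hy
  exact D.coc_unique hy

end ClopenDomain

/-! ### Equivariant functions, support conditions, and the action of a commuting group. -/

section Functions

variable {R G H X M : Type*} [CommRing R] [Group G] [Group H] [TopologicalSpace X]
  [MulAction G X] [MulAction H X] [AddCommGroup M] [Module R M]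

variable (X) in
/-- The translation action on functions with values in a representation. -/
def translate (ρ : Representation R G M) : Representation R G (X → M) where
  toFun g := LinearMap.pi fun x => ρ g ∘ₗ LinearMap.proj (g⁻¹ • x)
  map_one' := by ext f x; simp
  map_mul' g h := by ext f x; simp [mul_smul]

theorem translate_apply (ρ : Representation R G M) (g : G) (f : X → M) (x : X) :
    translate X ρ g f x = ρ g (f (g⁻¹ • x)) := rfl

variable (X) in
/-- The equivariant locally constant functions. -/
def eqFun (ρ : Representation R G M) : Submodule R (X → M) where
  carrier := {f | IsLocallyConstant f ∧ ∀ g x, f (g • x) = ρ g (f x)}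
  add_mem' hf hk := ⟨hf.1.add hk.1, fun g x => by simp [hf.2, hk.2]⟩
  zero_mem' := ⟨IsLocallyConstant.const 0, fun g x => by simp⟩
  smul_mem' c f hf := ⟨hf.1.comp (c • ·), fun g x => by simp [hf.2]⟩

variable (X) in
/-- The equivariant locally constant functions with compact support modulo the group. -/
def eqFunC (ρ : Representation R G M) : Submodule R (X → M) where
  carrier := {f | f ∈ eqFun X ρ ∧ ∃ K : Set X, IsCompact K ∧ ∀ x, f x ≠ 0 → ∃ g : G, g • x ∈ K}
  add_mem' := by
    rintro f k ⟨hf, K, hK, hfK⟩ ⟨hk, L, hL, hkL⟩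
    refine ⟨add_mem hf hk, K ∪ L, hK.union hL, fun x hx => ?_⟩
    by_cases h : f x = 0
    · obtain ⟨g, hg⟩ := hkL x fun h' => hx (by simp [h, h'])
      exact ⟨g, Or.inr hg⟩
    · obtain ⟨g, hg⟩ := hfK x h
      exact ⟨g, Or.inl hg⟩
  zero_mem' := ⟨zero_mem _, ∅, isCompact_empty, fun x hx => (hx rfl).elim⟩
  smul_mem' := by
    rintro c f ⟨hf, K, hK, hfK⟩
    exact ⟨Submodule.smul_mem _ c hf, K, hK, fun x hx => hfK x fun h => hx (by simp [h])⟩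

variable (R X M) in
/-- The locally constant functions with compact support. -/
def lcc : Submodule R (X → M) where
  carrier := {f | IsLocallyConstant f ∧ ∃ K : Set X, IsCompact K ∧ ∀ x, f x ≠ 0 → x ∈ K}
  add_mem' := by
    rintro f k ⟨hf, K, hK, hfK⟩ ⟨hk, L, hL, hkL⟩
    refine ⟨hf.add hk, K ∪ L, hK.union hL, fun x hx => ?_⟩
    by_cases h : f x = 0
    · exact Or.inr (hkL x fun h' => hx (by simp [h, h']))
    · exact Or.inl (hfK x h)
  zero_mem' := ⟨IsLocallyConstant.const 0, ∅, isCompact_empty, fun x hx => (hx rfl).elim⟩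
  smul_mem' := by
    rintro c f ⟨hf, K, hK, hfK⟩
    exact ⟨hf.comp (c • ·), K, hK, fun x hx => hfK x fun h => hx (by simp [h])⟩

variable [ContinuousConstSMul G X] [ContinuousConstSMul H X]

theorem isLocallyConstant_translate (ρ : Representation R G M) (g : G) {f : X → M}
    (hf : IsLocallyConstant f) : IsLocallyConstant (translate X ρ g f) :=
  (isLocallyConstant_smul hf g⁻¹).comp (ρ g)

theorem translate_mem_lcc (ρ : Representation R G M) (g : G) {f : X → M}
    (hf : f ∈ lcc R X M) : translate X ρ g f ∈ lcc R X M := by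
  obtain ⟨hf, K, hK, hfK⟩ := hf
  refine ⟨isLocallyConstant_translate ρ g hf, (g • ·) '' K, hK.image (continuous_const_smul g),
    fun x hx => ⟨g⁻¹ • x, hfK _ fun h => hx ?_, smul_inv_smul g x⟩⟩
  rw [translate_apply, h, map_zero]

variable (X) in
/-- The translation action on locally constant functions with compact support. -/
def lccRep (ρ : Representation R G M) : Representation R G (lcc R X M) where
  toFun g := (translate X ρ g).restrict fun _ hf => translate_mem_lcc ρ g hf
  map_one' := by ext f : 2; change translate X ρ 1 f.1 = f.1; rw [map_one]; rfl
  map_mul' g h := by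
    ext f : 2
    change translate X ρ (g * h) f.1 = translate X ρ g (translate X ρ h f.1)
    rw [map_mul]; rfl

theorem lccRep_apply (ρ : Representation R G M) (g : G) (f : lcc R X M) (x : X) :
    (lccRep X ρ g f).1 x = ρ g (f.1 (g⁻¹ • x)) := rfl

variable [SMulCommClass G H X] (ρ : Representation R G M) (σ : Representation R H M)
  (hc : ∀ g h, Commute (ρ g) (σ h))

include hc in
theorem translate_mem_eqFun (h : H) {f : X → M} (hf : f ∈ eqFun X ρ) :
    translate X σ h f ∈ eqFun X ρ :=
  ⟨isLocallyConstant_translate σ h hf.1, fun g x => by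
    rw [translate_apply, translate_apply, ← smul_comm g h⁻¹, hf.2]
    exact (LinearMap.congr_fun (hc g h) _).symm⟩

include hc in
theorem translate_mem_eqFunC (h : H) {f : X → M} (hf : f ∈ eqFunC X ρ) :
    translate X σ h f ∈ eqFunC X ρ := by
  obtain ⟨hf, K, hK, hfK⟩ := hf
  refine ⟨translate_mem_eqFun ρ σ hc h hf, (h • ·) '' K, hK.image (continuous_const_smul h),
    fun x hx => ?_⟩
  obtain ⟨g, hg⟩ := hfK (h⁻¹ • x) fun h' => hx (by rw [translate_apply, h', map_zero])
  exact ⟨g, g • h⁻¹ • x, hg, by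
    change h • g • h⁻¹ • x = g • x
    rw [← smul_comm g h, smul_inv_smul]⟩

variable (X) in
/-- The action of a commuting group on equivariant functions. -/
def eqAction : Representation R H (eqFun X ρ) where
  toFun h := (translate X σ h).restrict fun _ hf => translate_mem_eqFun ρ σ hc h hf
  map_one' := by ext f : 2; change translate X σ 1 f.1 = f.1; rw [map_one]; rfl
  map_mul' g h := by
    ext f : 2
    change translate X σ (g * h) f.1 = translate X σ g (translate X σ h f.1)
    rw [map_mul]; rfl

variable (X) in
/-- The action of a commuting group on equivariant functions with compact support modulo the
group. -/
def eqActionC : Representation R H (eqFunC X ρ) where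
  toFun h := (translate X σ h).restrict fun _ hf => translate_mem_eqFunC ρ σ hc h hf
  map_one' := by ext f : 2; change translate X σ 1 f.1 = f.1; rw [map_one]; rfl
  map_mul' g h := by
    ext f : 2
    change translate X σ (g * h) f.1 = translate X σ g (translate X σ h f.1)
    rw [map_mul]; rfl

end Functions

/-! ### Equivariant functions as traces of compactly supported functions. -/

section Trace

variable {R G H X M : Type*} [CommRing R] [Group G] [Group H] [TopologicalSpace X]
  [MulAction G X] [MulAction H X] [AddCommGroup M] [Module R M]
  [ContinuousConstSMul G X] [ContinuousConstSMul H X]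
  (D : ClopenDomain G X) (ρ : Representation R G M) (σ : Representation R H M)
  (hc : ∀ g h, Commute (ρ g) (σ h))

theorem ClopenDomain.finite_coc (k : lcc R X M) : (D.coc '' {x | k.1 x ≠ 0}).Finite := by
  obtain ⟨hk, K, hK, hkK⟩ := k.2
  exact (finite_image_of_isCompact D.isLocallyConstant_coc hK).subset (Set.image_mono hkK)

/-- The sum of the translates of a function with compact support. -/
def traceFun (k : X → M) (x : X) : M := ∑ᶠ g : G, ρ g (k (g⁻¹ • x))

include D in
-- Since `coc x = g * coc (g⁻¹ • x)`, a contributing `g` is determined by `coc x` and a value of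
-- `coc` on the support of `k`; compactness leaves finitely many such values.
theorem finite_support_trace (k : lcc R X M) (x : X) :
    (Function.support fun g : G => ρ g (k.1 (g⁻¹ • x))).Finite := by
  refine ((D.finite_coc k).image fun c => D.coc x * c⁻¹).subset fun g hg => ?_
  refine ⟨D.coc (g⁻¹ • x), ⟨_, fun h => hg ?_, rfl⟩, ?_⟩
  · change ρ g (k.1 (g⁻¹ • x)) = 0
    rw [h, map_zero]
  · simp [D.coc_smul]

include D in
theorem isLocallyConstant_trace (k : lcc R X M) : IsLocallyConstant (traceFun ρ k.1) := by
  classical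
  -- A finite set of summands that depends on `x` only through `coc x`: where `coc` is constant, the
  -- trace is one fixed finite sum of locally constant functions.
  let S (c : G) : Finset G := (D.finite_coc k).toFinset.image fun c' => c * c'⁻¹
  have h : traceFun ρ k.1 = fun x => ∑ g ∈ S (D.coc x), ρ g (k.1 (g⁻¹ • x)) := by
    funext x
    refine finsum_eq_sum_of_support_subset _ fun g hg => ?_
    simp only [S, Finset.coe_image, Set.Finite.coe_toFinset]
    refine ⟨D.coc (g⁻¹ • x), ⟨_, fun h => hg ?_, rfl⟩, ?_⟩
    · change ρ g (k.1 (g⁻¹ • x)) = 0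
      rw [h, map_zero]
    · simp [D.coc_smul]
  rw [h]
  refine isLocallyConstant_diag (F := fun c x => ∑ g ∈ S c, ρ g (k.1 (g⁻¹ • x)))
    D.isLocallyConstant_coc fun c => ?_
  induction S c using Finset.induction_on with
  | empty => exact IsLocallyConstant.const 0
  | insert g s hg ih =>
    simp only [Finset.sum_insert hg]
    exact (isLocallyConstant_translate ρ g k.2.1).add ih

include D in
theorem traceFun_mem (k : lcc R X M) : traceFun ρ k.1 ∈ eqFunC X ρ := by
  refine ⟨⟨isLocallyConstant_trace D ρ k, fun g x => ?_⟩, ?_⟩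
  · rw [traceFun, traceFun, ← finsum_comp_equiv (Equiv.mulLeft g)]
    refine Eq.trans ?_ (map_finsum (ρ g) (finite_support_trace D ρ k x)).symm
    refine finsum_congr fun g' => ?_
    rw [Equiv.coe_mulLeft, map_mul, mul_inv_rev, mul_smul, inv_smul_smul, Module.End.mul_apply]
  · obtain ⟨hk, K, hK, hkK⟩ := k.2
    refine ⟨K, hK, fun x hx => ?_⟩
    by_contra! h
    refine hx (finsum_eq_zero_of_forall_eq_zero fun g => ?_)
    have : k.1 (g⁻¹ • x) = 0 := by_contra fun h' => h g⁻¹ (hkK _ h')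
    rw [this, map_zero]

/-- The sum of the translates, as a linear map. -/
def trace : lcc R X M →ₗ[R] eqFunC X ρ where
  toFun k := ⟨traceFun ρ k.1, traceFun_mem D ρ k⟩
  map_add' k k' := by
    ext x
    change ∑ᶠ g : G, ρ g (k.1 (g⁻¹ • x) + k'.1 (g⁻¹ • x)) = _
    simp only [map_add]
    exact finsum_add_distrib (finite_support_trace D ρ k x) (finite_support_trace D ρ k' x)
  map_smul' c k := by
    ext x
    change ∑ᶠ g : G, ρ g (c • k.1 (g⁻¹ • x)) = c • ∑ᶠ g : G, ρ g (k.1 (g⁻¹ • x))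
    simp only [map_smul]
    rw [smul_finsum' c (finite_support_trace D ρ k x)]

theorem trace_apply (k : lcc R X M) (x : X) :
    (trace D ρ k).1 x = ∑ᶠ g : G, ρ g (k.1 (g⁻¹ • x)) := rfl

/-- Translation only reindexes the sum over the group; the trace thus factors through coinvariants.
-/
theorem trace_lccRep (g : G) (k : lcc R X M) : trace D ρ (lccRep X ρ g k) = trace D ρ k := by
  ext x
  rw [trace_apply, trace_apply,
    ← finsum_comp_equiv (Equiv.mulRight g) (f := fun g => ρ g (k.1 (g⁻¹ • x)))]
  refine finsum_congr fun g' => ?_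
  rw [lccRep_apply, ← Module.End.mul_apply, ← map_mul, ← mul_smul, ← mul_inv_rev]
  rfl

theorem trace_eqActionC [SMulCommClass G H X] (h : H) (k : lcc R X M) :
    eqActionC X ρ σ hc h (trace D ρ k) = trace D ρ (lccRep X σ h k) := by
  ext x
  change σ h (∑ᶠ g : G, ρ g (k.1 (g⁻¹ • h⁻¹ • x))) = ∑ᶠ g : G, ρ g (σ h (k.1 (h⁻¹ • g⁻¹ • x)))
  rw [map_finsum (σ h) (finite_support_trace D ρ k _)]
  refine finsum_congr fun g => ?_
  rw [smul_comm g⁻¹ h⁻¹]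
  exact (LinearMap.congr_fun (hc g h) _).symm

/-- A point of `D` represents its own orbit. If one of its translates lies in the compact set `K`,
the point lies in the image of `K` under the continuous projection to `D`. -/
theorem indicator_mem_lcc (f : eqFunC X ρ) : D.carrier.indicator f.1 ∈ lcc R X M := by
  obtain ⟨f, hf, K, hK, hfK⟩ := f
  refine ⟨isLocallyConstant_indicator hf.1 D.isClopen, (fun x => (D.proj x).1) '' K,
    hK.image (continuous_subtype_val.comp D.continuous_proj), fun x hx => ?_⟩
  have hxD : x ∈ D.carrier := Set.mem_of_indicator_ne_zero hx
  rw [Set.indicator_of_mem hxD] at hx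
  obtain ⟨g, hg⟩ := hfK x hx
  exact ⟨g • x, hg, by
    change (D.proj (g • x)).1 = x
    rw [D.proj_smul]
    exact congrArg Subtype.val (D.proj_coe ⟨x, hxD⟩)⟩

/-- The restriction to the fundamental domain. -/
def cut : eqFunC X ρ →ₗ[R] lcc R X M where
  toFun f := ⟨D.carrier.indicator f.1, indicator_mem_lcc D ρ f⟩
  map_add' _ _ := Subtype.ext (Set.indicator_add _ _ _)
  map_smul' c f := Subtype.ext (Set.indicator_const_smul _ c f.1)

/-- Exactly one translate of `D` contains `x`, so a single summand survives and equivariance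
evaluates it. In particular the trace is surjective. -/
theorem trace_cut (f : eqFunC X ρ) : trace D ρ (cut D ρ f) = f := by
  ext x
  rw [trace_apply]
  change ∑ᶠ g : G, ρ g (D.carrier.indicator f.1 (g⁻¹ • x)) = f.1 x
  rw [finsum_eq_single _ (D.coc x) fun g hg => ?_]
  · rw [Set.indicator_of_mem (D.coc_inv_smul_mem x), ← f.2.1.2, smul_inv_smul]
  · rw [Set.indicator_of_notMem, map_zero]
    exact fun h => hg (D.coc_unique h).symm

/-- When `k` lives on the single translate `c • D`, only its translate by `c⁻¹` meets `D`. -/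
theorem cut_trace {k : lcc R X M} {c : G} (hk : ∀ x, k.1 x ≠ 0 → D.coc x = c) :
    cut D ρ (trace D ρ k) = lccRep X ρ c⁻¹ k := by
  ext x
  change D.carrier.indicator (traceFun ρ k.1) x = ρ c⁻¹ (k.1 (c⁻¹⁻¹ • x))
  by_cases hx : x ∈ D.carrier
  · rw [Set.indicator_of_mem hx, traceFun, finsum_eq_single _ c⁻¹ fun g hg => ?_]
    have : k.1 (g⁻¹ • x) = 0 := by
      by_contra h
      have := hk _ h
      rw [D.coc_smul, D.coc_eq_one_iff.2 hx, mul_one] at this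
      exact hg (by rw [← this, inv_inv])
    rw [this, map_zero]
  · rw [Set.indicator_of_notMem hx]
    have : k.1 (c⁻¹⁻¹ • x) = 0 := by
      by_contra h
      have := hk _ h
      rw [D.coc_smul, inv_inv, mul_eq_left] at this
      exact hx (D.coc_eq_one_iff.1 this)
    rw [this, map_zero]

end Trace

/-! ### Decomposition of compactly supported functions along a locally constant map. -/

section Split

variable {R X J M W : Type*} [CommRing R] [TopologicalSpace X] [AddCommGroup M] [Module R M]
  [AddCommGroup W] [Module R W] {q : X → J} (hq : IsLocallyConstant q)

/-- The restriction of a function to a closed-open set. -/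
def lccIndicator {U : Set X} (hU : IsClopen U) : lcc R X M →ₗ[R] lcc R X M where
  toFun k := ⟨U.indicator k.1, isLocallyConstant_indicator k.2.1 hU, by
    obtain ⟨hk, K, hK, hkK⟩ := k.2
    exact ⟨K, hK, fun x hx => hkK x fun h => hx (by
      classical rw [Set.indicator_apply, h, ite_self])⟩⟩
  map_add' _ _ := Subtype.ext (Set.indicator_add _ _ _)
  map_smul' c f := Subtype.ext (Set.indicator_const_smul _ c f.1)

theorem lccIndicator_eq_self {U : Set X} (hU : IsClopen U) {k : lcc R X M}
    (h : ∀ x, k.1 x ≠ 0 → x ∈ U) : lccIndicator hU k = k :=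
  Subtype.ext (show U.indicator k.1 = k.1 from Set.indicator_eq_self.2 h)

theorem finite_support_split (k : lcc R X M) :
    (Function.support fun j => lccIndicator (hq.isClopen_fiber j) k).Finite := by
  obtain ⟨hk, K, hK, hkK⟩ := k.2
  refine (finite_image_of_isCompact hq hK).subset fun j hj => ?_
  by_contra h
  refine hj (Subtype.ext (funext fun x => ?_))
  change Set.indicator {x | q x = j} k.1 x = 0
  rw [Set.indicator_apply_eq_zero]
  rintro rfl
  by_contra h'
  exact h ⟨x, hkK x h', rfl⟩

/-- The decomposition of a function according to the values of a locally constant map. -/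
def split : lcc R X M →ₗ[R] (J →₀ lcc R X M) where
  toFun k := Finsupp.ofSupportFinite _ (finite_support_split hq k)
  map_add' k k' := by
    ext j : 1
    exact map_add (lccIndicator (hq.isClopen_fiber j)) k k'
  map_smul' c k := by
    ext j : 1
    exact map_smul (lccIndicator (hq.isClopen_fiber j)) c k

theorem split_apply (k : lcc R X M) (j : J) :
    split hq k j = lccIndicator (hq.isClopen_fiber j) k := rfl

theorem split_eq_single {k : lcc R X M} {j : J} (h : ∀ x, k.1 x ≠ 0 → q x = j) :
    split hq k = Finsupp.single j k := by
  classical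
  ext j' : 1
  rw [split_apply, Finsupp.single_apply]
  split_ifs with hj
  · subst hj
    exact lccIndicator_eq_self _ h
  · refine Subtype.ext (funext fun x => ?_)
    change Set.indicator {x | q x = j'} k.1 x = 0
    rw [Set.indicator_apply_eq_zero]
    rintro rfl
    by_contra h'
    exact hj (h x h').symm

theorem split_sum (k : lcc R X M) : ((split hq k).sum fun _ k' => k') = k := by
  classical
  ext x
  rw [Finsupp.sum, AddSubmonoidClass.coe_finsetSum, Finset.sum_apply]
  have h (j : J) : (split hq k j).1 x = if j = q x then k.1 x else 0 := by
    change Set.indicator {x | q x = j} k.1 x = _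
    rw [Set.indicator_apply]
    exact if_congr ⟨fun h => h.symm, fun h => h.symm⟩ rfl rfl
  simp only [h]
  rw [Finset.sum_ite_eq']
  split_ifs with hx
  · rfl
  · rw [Finsupp.notMem_support_iff] at hx
    have := h (q x)
    rw [hx, if_pos rfl] at this
    exact this

include hq in
/-- Linear maps agree if they agree on the functions on whose support a given locally constant map
is constant. -/
theorem lcc_hom_ext {f f' : lcc R X M →ₗ[R] W}
    (h : ∀ (j : J) (k : lcc R X M), (∀ x, k.1 x ≠ 0 → q x = j) → f k = f' k) : f = f' := by
  ext k
  rw [← split_sum hq k, Finsupp.sum, map_sum, map_sum]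
  refine Finset.sum_congr rfl fun j _ => h j _ fun x hx => ?_
  exact Set.mem_of_indicator_ne_zero (s := {x | q x = j}) (f := k.1) hx

end Split

/-! ### Transfer of cohomology between commuting actions -/

section TransferCohomology

variable {R G H X M : Type u} [CommRing R] [Group G] [Group H] [TopologicalSpace X]
  [MulAction G X] [MulAction H X] [SMulCommClass G H X] [SMulCommClass H G X]
  [ContinuousConstSMul G X] [ContinuousConstSMul H X] [AddCommGroup M] [Module R M]
  (D : ClopenDomain G X) (D' : ClopenDomain H X)
  {ρ : Representation R G M} {σ : Representation R H M}
  (hc : ∀ g h, Commute (ρ g) (σ h)) (hc' : ∀ h g, Commute (σ h) (ρ g))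

variable (X) in
/-- The representation of `H` on the `G`-equivariant functions. -/
abbrev eqRep (hc : ∀ g h, Commute (ρ g) (σ h)) : Rep.{u} R H :=
  Rep.of (X := eqFun X ρ) (eqAction X ρ σ hc)

/-- The evaluation at a point. -/
def evalAt (ρ : Representation R G M) (x : X) : eqFun X ρ →ₗ[R] M :=
  LinearMap.proj x ∘ₗ (eqFun X ρ).subtype

theorem evalAt_smul (x : X) (h : H) (f : (eqRep X hc).V) :
    evalAt ρ x ((eqRep X hc).ρ h f) = σ h (evalAt ρ (h⁻¹ • x) f) := rfl

theorem evalAt_homog_mul {n : ℕ} (u : (Fin n → H) → (eqRep X hc).V) (h : H) (s : ℕ → H) (x : X) :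
    evalAt ρ x (homog u fun i => h * s i) = σ h (evalAt ρ (h⁻¹ • x) (homog u s)) := by
  rw [homog_mul_left, evalAt_smul]

theorem isLocallyConstant_evalAt_homog {n : ℕ} (u : (Fin n → H) → (eqRep X hc).V) {s : X → ℕ → H}
    (hs : ∀ i, IsLocallyConstant fun x => s x i) :
    IsLocallyConstant fun x => evalAt ρ x (homog u (s x)) := by
  -- Only the terms `0, …, n` of the sequence matter. Padding with `1` expresses the value through a
  -- finite tuple, which is jointly locally constant.
  let J (j : Fin (n + 1) → H) (i : ℕ) : H := if hi : i < n + 1 then j ⟨i, hi⟩ else 1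
  have h : (fun x => evalAt ρ x (homog u (s x))) =
      fun x => evalAt ρ x (homog u (J fun i : Fin (n + 1) => s x i)) := by
    funext x
    congr 1
    refine homog_congr u fun i hi => ?_
    simp only [J]
    rw [dif_pos (by omega)]
  rw [h]
  exact isLocallyConstant_diag (F := fun j x => evalAt ρ x (homog u (J j)))
    (isLocallyConstant_pi fun i : Fin (n + 1) => hs i) fun j => (homog u (J j)).2.1

/-- Transfer of cochains. -/
def transferCochain (n : ℕ) :
    ((Fin n → G) → (eqRep X hc').V) →ₗ[R] ((Fin n → H) → (eqRep X hc).V) where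
  toFun u h := ⟨fun x => evalAt σ x (homog u fun i => D.coc ((partialProd h i)⁻¹ • x)),
    isLocallyConstant_evalAt_homog hc' u fun i => isLocallyConstant_smul D.isLocallyConstant_coc _,
    -- The vertices `coc (h⁻¹ • x)` are all multiplied by `g` when `x` is; the homogeneous cochain
    -- then produces `ρ g` and cancels the translation of the point.
    fun g x => by
      simp only [← smul_comm g, D.coc_smul]
      rw [evalAt_homog_mul, inv_smul_smul]⟩
  map_add' u v := by
    funext h
    refine Subtype.ext (funext fun x => ?_)
    change ((eqRep X hc').ρ _ _ : eqFun X σ).1 x = _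
    rw [Pi.add_apply, map_add]
    rfl
  map_smul' c u := by
    funext h
    refine Subtype.ext (funext fun x => ?_)
    change ((eqRep X hc').ρ _ _ : eqFun X σ).1 x = _
    rw [Pi.smul_apply, map_smul]
    rfl

theorem evalAt_transferCochain {n : ℕ} (u : (Fin n → G) → (eqRep X hc').V) (h : Fin n → H)
    (x : X) : evalAt ρ x (transferCochain D hc hc' n u h) =
      evalAt σ x (homog u fun i => D.coc ((partialProd h i)⁻¹ • x)) := rfl

/-- The `σ`-equivariance of the values of `u` undoes the twist by `s 0`. What remains is the
substitution of the vertex map `h ↦ coc (h⁻¹ • x)` at the fixed point `x`. -/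
theorem evalAt_homog_transferCochain {n : ℕ} (u : (Fin n → G) → (eqRep X hc').V) (s : ℕ → H)
    (x : X) : evalAt ρ x (homog (transferCochain D hc hc' n u) s) =
      evalAt σ x (homog u fun i => D.coc ((s i)⁻¹ • x)) := by
  rw [homog, evalAt_smul, evalAt_transferCochain]
  have h : homog u (fun i => D.coc ((partialProd (bar n s) i)⁻¹ • (s 0)⁻¹ • x)) =
      homog u fun i => D.coc ((s i)⁻¹ • x) := by
    refine homog_congr u fun i hi => ?_
    rw [partialProd_bar n s hi, ← mul_smul, ← mul_inv_rev, mul_inv_cancel_left]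
  rw [h]
  change σ (s 0) ((homog u fun i => D.coc ((s i)⁻¹ • x) : eqFun X σ).1 ((s 0)⁻¹ • x)) = _
  rw [← (homog u fun i => D.coc ((s i)⁻¹ • x) : eqFun X σ).2.2, smul_inv_smul]
  rfl

theorem eqRep_ext {f f' : (eqRep X hc).V} (h : ∀ x, evalAt ρ x f = evalAt ρ x f') : f = f' :=
  Subtype.ext (funext h)

/-- At each point the transfer applies one map to all vertices, and this commutes with omitting a
vertex. -/
theorem cochainD_transferCochain (n : ℕ) (u : (Fin n → G) → (eqRep X hc').V) :
    cochainD (eqRep X hc) n (transferCochain D hc hc' n u) =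
      transferCochain D hc hc' (n + 1) (cochainD (eqRep X hc') n u) := by
  refine homog_injective fun s => eqRep_ext hc fun x => ?_
  rw [evalAt_homog_transferCochain, homog_cochainD, homog_cochainD, map_sum, map_sum]
  refine Finset.sum_congr rfl fun j _ => ?_
  rw [map_smul, map_smul, evalAt_homog_transferCochain]
  congr 3
  exact (face_comp (fun h : H => D.coc (h⁻¹ • x)) j s).symm

/-- Transfer of cohomology classes. -/
def transferCohomology (n : ℕ) :
    groupCohomology (eqRep X hc') n ⟶ groupCohomology (eqRep X hc) n :=
  cohomologyHom (transferCochain D hc hc') (cochainD_transferCochain D hc hc') n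

/-- The cochain homotopy between the double transfer and the identity. -/
def prismCochain (n : ℕ) (u : (Fin (n + 1) → G) → (eqRep X hc').V) :
    (Fin n → G) → (eqRep X hc').V := fun g =>
  ⟨fun x => ∑ i ∈ Finset.range (n + 1), (-1 : R) ^ i • evalAt σ x (homog u (mix i (partialProd g)
      fun a => D.coc ((D'.coc ((partialProd g a)⁻¹ • x))⁻¹ • x))), by
    have h (i : ℕ) : IsLocallyConstant fun x => (-1 : R) ^ i • evalAt σ x
        (homog u (mix i (partialProd g)
          fun a => D.coc ((D'.coc ((partialProd g a)⁻¹ • x))⁻¹ • x))) := by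
      refine (isLocallyConstant_evalAt_homog hc' u fun a => ?_).comp ((-1 : R) ^ i • ·)
      by_cases ha : a ≤ i
      · simp only [mix, if_pos ha]
        exact IsLocallyConstant.const _
      · simp only [mix, if_neg ha]
        exact isLocallyConstant_diag (F := fun (h : H) (x : X) => D.coc (h⁻¹ • x))
          (isLocallyConstant_smul D'.isLocallyConstant_coc _)
          fun h => isLocallyConstant_smul D.isLocallyConstant_coc _
    induction Finset.range (n + 1) using Finset.induction_on with
    | empty => exact IsLocallyConstant.const 0
    | insert i s hi ih =>
      simp only [Finset.sum_insert hi]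
      exact (h i).add ih, fun h x => by
    rw [map_sum]
    refine Finset.sum_congr rfl fun i _ => ?_
    rw [map_smul]
    congr 1
    -- The vertex map of the double transfer does not change when `x` is moved by `h`: the two
    -- occurrences of `h` cancel. Hence the prism inherits its `H`-equivariance from the values of
    -- `u`.
    have e (a : ℕ) : D.coc ((D'.coc ((partialProd g a)⁻¹ • h • x))⁻¹ • h • x) =
        D.coc ((D'.coc ((partialProd g a)⁻¹ • x))⁻¹ • x) := by
      rw [smul_comm (partialProd g a)⁻¹ h x, D'.coc_smul, mul_inv_rev, mul_smul, inv_smul_smul]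
    simp only [e]
    exact (homog u _ : eqFun X σ).2.2 h x⟩

/-- The vertex map of the double transfer is `G`-equivariant jointly in vertex and point, just as
the identity is, so the twist by `s 0` passes through the whole prism. -/
theorem evalAt_homog_prismCochain (n : ℕ) (u : (Fin (n + 1) → G) → (eqRep X hc').V) (s : ℕ → G)
    (x : X) : evalAt σ x (homog (prismCochain D D' hc' n u) s) =
      ∑ i ∈ Finset.range (n + 1), (-1 : R) ^ i • evalAt σ x (homog u (mix i s
        fun a => D.coc ((D'.coc ((s a)⁻¹ • x))⁻¹ • x))) := by
  rw [homog, evalAt_smul]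
  change ρ (s 0) (∑ i ∈ Finset.range (n + 1), (-1 : R) ^ i • evalAt σ ((s 0)⁻¹ • x) (homog u
    (mix i (partialProd (bar n s)) fun a => D.coc ((D'.coc ((partialProd (bar n s) a)⁻¹ •
      (s 0)⁻¹ • x))⁻¹ • (s 0)⁻¹ • x)))) = _
  rw [map_sum]
  refine Finset.sum_congr rfl fun i hi => ?_
  rw [Finset.mem_range] at hi
  rw [map_smul, ← evalAt_homog_mul]
  congr 2
  refine homog_congr u fun a ha => ?_
  simp only [mix]
  split_ifs with hai
  · rw [partialProd_bar n s (by omega), mul_inv_cancel_left]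
  · rw [partialProd_bar n s (by omega), ← mul_smul _ (s 0)⁻¹, ← mul_inv_rev, mul_inv_cancel_left,
      ← smul_comm (s 0)⁻¹, D.coc_smul, mul_inv_cancel_left]

theorem evalAt_homog_transfer_transfer {n : ℕ} (u : (Fin n → G) → (eqRep X hc').V) (s : ℕ → G)
    (x : X) : evalAt σ x (homog (transferCochain D' hc' hc n (transferCochain D hc hc' n u)) s) =
      evalAt σ x (homog u fun a => D.coc ((D'.coc ((s a)⁻¹ • x))⁻¹ • x)) := by
  rw [evalAt_homog_transferCochain, evalAt_homog_transferCochain]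

/-- At each point `x` the double transfer substitutes the vertex map `g ↦ coc (coc' (g⁻¹ x)⁻¹ x)`,
with `coc` and `coc'` belonging to `D` and `D'`. The prism between a simplex and its image under
this map cobounds the difference: of the two double sums in `prism_identity`, one is the
differential of the prism cochain and the other vanishes on cocycles. -/
theorem transferCohomology_transferCohomology (n : ℕ) (x : groupCohomology (eqRep X hc') n) :
    (transferCohomology D' hc' hc n).hom ((transferCohomology D hc hc' n).hom x) = x := by
  rw [transferCohomology, transferCohomology, cohomologyHom_comp]
  have key (n : ℕ) (u : (Fin n → G) → (eqRep X hc').V) (hu : cochainD (eqRep X hc') n u = 0)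
      (s : ℕ → G) (x : X) := prism_identity (R := R) (fun s => evalAt σ x (homog u s)) n
        (fun s t h => by rw [homog_congr u h]) s
        (fun a => D.coc ((D'.coc ((s a)⁻¹ • x))⁻¹ • x))
  -- The cocycle condition in homogeneous form; it kills each inner sum over the faces of a prism
  -- simplex.
  have key' (n : ℕ) (u : (Fin n → G) → (eqRep X hc').V) (hu : cochainD (eqRep X hc') n u = 0)
      (s : ℕ → G) (x : X) : ∑ j ∈ Finset.range (n + 2), (-1 : R) ^ j •
        evalAt σ x (homog u (face j s)) = 0 := by
    have h := congrArg (evalAt σ x) (homog_cochainD u s)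
    simp only [map_sum, map_smul] at h
    rw [← h, hu, homog]
    change evalAt σ x ((eqRep X hc').ρ (s 0) 0) = 0
    rw [map_zero, map_zero]
  refine cohomologyHom_eq_self_of_homotopy _ _ (fun u hu => ?_) (fun n u hu => ?_) x
  -- In degree `0` the sum over the faces of the two sequences is empty, so the prism identity gives
  -- equality on cocycles.
  · refine homog_injective fun s => eqRep_ext hc' fun x => ?_
    have h := key 0 u hu s x
    simp only [key' 0 u hu, smul_zero, Finset.sum_const_zero, Finset.range_zero, Finset.sum_empty,
      add_zero] at h
    exact (evalAt_homog_transfer_transfer D D' hc hc' u s x).trans (sub_eq_zero.1 h.symm)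
  · refine ⟨prismCochain D D' hc' n u, homog_injective fun s => eqRep_ext hc' fun x => ?_⟩
    have h := key (n + 1) u hu s x
    simp only [key' (n + 1) u hu, smul_zero, Finset.sum_const_zero, zero_add] at h
    rw [homog_cochainD, map_sum]
    have h1 : evalAt σ x (homog (((transferCochain D' hc' hc (n + 1)) ∘ₗ
        (transferCochain D hc hc' (n + 1))) u - u) s) =
        evalAt σ x (homog u fun a => D.coc ((D'.coc ((s a)⁻¹ • x))⁻¹ • x)) -
          evalAt σ x (homog u s) := by
      rw [← evalAt_homog_transfer_transfer D D' hc hc' u s x, ← map_sub]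
      congr 1
      exact map_sub ((eqRep X hc').ρ (s 0)) _ _
    rw [h1, ← h]
    refine Finset.sum_congr rfl fun j _ => ?_
    rw [map_smul, evalAt_homog_prismCochain]
    congr 1
    refine Finset.sum_congr rfl fun i _ => ?_
    rw [face_comp (fun g : G => D.coc ((D'.coc (g⁻¹ • x))⁻¹ • x))]

/-- The transfer is an isomorphism on cohomology. -/
def transferCohomologyIso (n : ℕ) :
    groupCohomology (eqRep X hc') n ≅ groupCohomology (eqRep X hc) n where
  hom := transferCohomology D hc hc' n
  inv := transferCohomology D' hc' hc n
  hom_inv_id := ModuleCat.hom_ext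
    (LinearMap.ext (transferCohomology_transferCohomology D D' hc hc' n))
  inv_hom_id := ModuleCat.hom_ext
    (LinearMap.ext (transferCohomology_transferCohomology D' D hc' hc n))

end TransferCohomology

/-! ### Transfer of homology between commuting actions -/

section TransferHomology

variable {R G H X M : Type u} [CommRing R] [Group G] [Group H] [TopologicalSpace X]
  [MulAction G X] [MulAction H X] [SMulCommClass G H X] [SMulCommClass H G X]
  [ContinuousConstSMul G X] [ContinuousConstSMul H X] [AddCommGroup M] [Module R M]
  (D : ClopenDomain G X) (D' : ClopenDomain H X)
  {ρ : Representation R G M} {σ : Representation R H M}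
  (hc : ∀ g h, Commute (ρ g) (σ h)) (hc' : ∀ h g, Commute (σ h) (ρ g))

variable (X) in
/-- The representation of `H` on the `G`-equivariant functions with compact support modulo `G`. -/
abbrev eqRepC (hc : ∀ g h, Commute (ρ g) (σ h)) : Rep.{u} R H :=
  Rep.of (X := eqFunC X ρ) (eqActionC X ρ σ hc)

/-- The linear map on chains that decomposes the restriction of a coefficient to the fundamental
domain according to the values of locally constant maps. -/
def pushChain {J J' V : Type u} [AddCommGroup V] [Module R V] {q : J → X → J'}
    (hq : ∀ g, IsLocallyConstant (q g)) (τ : lcc R X M →ₗ[R] V) :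
    (J →₀ (eqFunC X σ)) →ₗ[R] (J' →₀ V) :=
  Finsupp.lsum R fun g => Finsupp.mapRange.linearMap τ ∘ₗ split (hq g) ∘ₗ cut D' σ

/-- If `k` is supported in the translate `h • D'`, cutting its trace to `D'` returns `k` moved back
by `h⁻¹`. The function `q g` is constant on the support of the result, so the splitting has one
piece. -/
theorem pushChain_single {J J' V : Type u} [AddCommGroup V] [Module R V] {q : J → X → J'}
    (hq : ∀ g, IsLocallyConstant (q g)) (τ : lcc R X M →ₗ[R] V) (g : J) {j : J'} {k : lcc R X M}
    {h : H} (hk : ∀ x, k.1 x ≠ 0 → D'.coc x = h ∧ q g (h⁻¹ • x) = j) :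
    pushChain D' hq τ (Finsupp.single g (trace D' σ k)) =
      Finsupp.single j (τ (lccRep X σ h⁻¹ k)) := by
  rw [pushChain, Finsupp.lsum_single, LinearMap.comp_apply, LinearMap.comp_apply,
    cut_trace D' σ fun x hx => (hk x hx).1, split_eq_single (j := j),
    Finsupp.mapRange.linearMap_apply, Finsupp.mapRange_single]
  intro x hx
  have h' : k.1 (h⁻¹⁻¹ • x) ≠ 0 := fun h' => hx (by rw [lccRep_apply, h', map_zero])
  have := (hk _ h').2
  rwa [inv_inv, inv_smul_smul] at this

theorem trace_ρ (g : G) (k : lcc R X M) :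
    (eqRepC X hc').ρ g (trace D' σ k) = trace D' σ (lccRep X ρ g k) :=
  trace_eqActionC D' σ ρ hc' g k

theorem isLocallyConstant_bar {n : ℕ} {s : X → ℕ → H}
    (hs : ∀ i, IsLocallyConstant fun x => s x i) : IsLocallyConstant fun x => bar n (s x) :=
  isLocallyConstant_pi fun i => (hs i).comp₂ (hs (i + 1)) fun a b => a⁻¹ * b

/-- Transfer of chains. -/
def transferChain (n : ℕ) : ((Fin n → G) →₀ (eqRepC X hc').V) →ₗ[R] ((Fin n → H) →₀ (eqRepC X hc).V) :=
  pushChain D' (σ := σ) (q := fun g x => bar n fun i => D'.coc ((partialProd g i)⁻¹ • x))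
    (fun _ => isLocallyConstant_bar fun _ => isLocallyConstant_smul D'.isLocallyConstant_coc _)
    (trace D ρ)

/-- This characterizes the transfer on small simplices, those whose coefficient is a trace of a
function `k` on whose support the new vertices `coc' ((s i)⁻¹ x)` are constant: vertices are
relabelled and the trace over `H` becomes the trace over `G`. All later computations use this
formula instead of the definition. -/
theorem transferChain_hsingle (n : ℕ) (s : ℕ → G) (h : ℕ → H) (k : lcc R X M)
    (hk : ∀ x, k.1 x ≠ 0 → ∀ i ≤ n, D'.coc ((s i)⁻¹ • x) = h i) :
    transferChain D D' hc hc' n (hsingle (A := eqRepC X hc') n s (trace D' σ k)) =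
      hsingle (A := eqRepC X hc) n h (trace D ρ k) := by
  rw [hsingle_apply, trace_ρ, hsingle_apply]
  refine (pushChain_single D' _ _ _ (h := h 0) (j := bar n h) fun x hx => ?_).trans ?_
  · have hx' : k.1 (s 0 • x) ≠ 0 := fun h' => hx (by rw [lccRep_apply, inv_inv, h', map_zero])
    have h1 := hk _ hx'
    constructor
    · rw [← h1 0 (Nat.zero_le _), inv_smul_smul]
    · rw [← bar_mul_left n (h 0)⁻¹ h]
      refine bar_congr fun i hi => ?_
      rw [partialProd_bar n s hi, mul_inv_rev, inv_inv, mul_smul, smul_comm (s 0) (h 0)⁻¹ x,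
        smul_comm (s i)⁻¹ (h 0)⁻¹ (s 0 • x), D'.coc_smul, h1 i hi]
  · congr 1
    -- The translation by `(h 0)⁻¹` commutes with the trace over `G`, and that trace absorbs the
    -- translation by `(s 0)⁻¹`.
    rw [← trace_eqActionC D ρ σ hc, trace_lccRep]

include D D' in
/-- Linear maps on chains agree if they agree on small simplices. -/
theorem chain_hom_ext {n : ℕ} {W : Type*} [AddCommGroup W] [Module R W]
    {f f' : ((Fin n → G) →₀ (eqRepC X hc').V) →ₗ[R] W}
    (hf : ∀ (s : ℕ → G) (h : ℕ → H) (t : ℕ → G) (k : lcc R X M),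
      (∀ x, k.1 x ≠ 0 → ∀ i ≤ n, D'.coc ((s i)⁻¹ • x) = h i ∧ D.coc ((h i)⁻¹ • x) = t i) →
        f (hsingle (A := eqRepC X hc') n s (trace D' σ k)) =
          f' (hsingle (A := eqRepC X hc') n s (trace D' σ k))) : f = f' := by
  refine Finsupp.lhom_ext' fun g => LinearMap.ext fun e => ?_
  -- The map `q` records the vertices after one transfer and after two. Each coefficient is the
  -- trace of its restriction to the domain, and splitting that restriction along `q` leaves small
  -- simplices only.
  let q (x : X) (i : Fin (n + 1)) : H × G :=
    (D'.coc ((partialProd g i)⁻¹ • x), D.coc ((D'.coc ((partialProd g i)⁻¹ • x))⁻¹ • x))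
  have hq : IsLocallyConstant q := isLocallyConstant_pi fun i => by
    have h1 : IsLocallyConstant fun x : X => D'.coc ((partialProd g i)⁻¹ • x) :=
      isLocallyConstant_smul D'.isLocallyConstant_coc _
    exact h1.prodMk (isLocallyConstant_diag (F := fun (h : H) (x : X) => D.coc (h⁻¹ • x)) h1
      fun h => isLocallyConstant_smul D.isLocallyConstant_coc _)
  have key : (f ∘ₗ Finsupp.lsingle g) ∘ₗ trace D' σ = (f' ∘ₗ Finsupp.lsingle g) ∘ₗ trace D' σ := by
    refine lcc_hom_ext hq fun j k hk => ?_
    have := hf (partialProd g) (fun i => if hi : i < n + 1 then (j ⟨i, hi⟩).1 else 1)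
      (fun i => if hi : i < n + 1 then (j ⟨i, hi⟩).2 else 1) k fun x hx i hi => by
        have h1 := congrFun (hk x hx) ⟨i, by omega⟩
        rw [dif_pos (by omega), dif_pos (by omega), ← h1]
        exact ⟨rfl, rfl⟩
    rw [hsingle_partialProd] at this
    exact this
  have := LinearMap.congr_fun key (cut D' σ e)
  simp only [LinearMap.comp_apply, trace_cut] at this
  exact this

/-- Faces of a small simplex are small with the same `k`, and relabelling vertices commutes with
omitting one. -/
theorem chainD_transferChain (n : ℕ) (u : (Fin (n + 1) → G) →₀ (eqRepC X hc').V) :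
    chainD (eqRepC X hc) n (transferChain D D' hc hc' (n + 1) u) =
      transferChain D D' hc hc' n (chainD (eqRepC X hc') n u) := by
  have key : chainD (eqRepC X hc) n ∘ₗ transferChain D D' hc hc' (n + 1) =
      transferChain D D' hc hc' n ∘ₗ chainD (eqRepC X hc') n := by
    refine chain_hom_ext D D' hc' fun s h t k hk => ?_
    rw [LinearMap.comp_apply, LinearMap.comp_apply,
      transferChain_hsingle D D' hc hc' (n + 1) s h k fun x hx i hi => (hk x hx i hi).1,
      chainD_hsingle, chainD_hsingle, map_sum]
    refine Finset.sum_congr rfl fun j _ => ?_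
    rw [map_smul, transferChain_hsingle D D' hc hc' n (face j s) (face j h) k]
    intro x hx i hi
    simp only [face]
    split_ifs
    · exact (hk x hx i (by omega)).1
    · exact (hk x hx (i + 1) (by omega)).1
  exact LinearMap.congr_fun key u

/-- Transfer of homology classes. -/
def transferHomology (n : ℕ) :
    groupHomology (eqRepC X hc') n ⟶ groupHomology (eqRepC X hc) n :=
  homologyHom (transferChain D D' hc hc') (chainD_transferChain D D' hc hc') n

/-- The chain homotopy between the double transfer and the identity. -/
def prismChain (n : ℕ) :
    ((Fin n → G) →₀ (eqRepC X hc').V) →ₗ[R] ((Fin (n + 1) → G) →₀ (eqRepC X hc').V) :=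
  ∑ i ∈ Finset.range (n + 1), (-1 : R) ^ i • pushChain D' (σ := σ)
    (q := fun g x => bar (n + 1) (mix i (partialProd g)
      fun a => D.coc ((D'.coc ((partialProd g a)⁻¹ • x))⁻¹ • x)))
    (fun g => isLocallyConstant_bar fun a => by
      by_cases ha : a ≤ i
      · simp only [mix, if_pos ha]
        exact IsLocallyConstant.const _
      · simp only [mix, if_neg ha]
        exact isLocallyConstant_diag (F := fun (h : H) (x : X) => D.coc (h⁻¹ • x))
          (isLocallyConstant_smul D'.isLocallyConstant_coc _)
          fun h => isLocallyConstant_smul D.isLocallyConstant_coc _)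
    (trace D' σ)

/-- On the support of `k` the double transfer of the vertices `s` is the constant sequence of
elements `t`, so the homotopy becomes the genuine prism between `s` and `t`. -/
theorem prismChain_hsingle (n : ℕ) (s : ℕ → G) (h : ℕ → H) (t : ℕ → G) (k : lcc R X M)
    (hk : ∀ x, k.1 x ≠ 0 → ∀ i ≤ n, D'.coc ((s i)⁻¹ • x) = h i ∧ D.coc ((h i)⁻¹ • x) = t i) :
    prismChain D D' hc' n (hsingle (A := eqRepC X hc') n s (trace D' σ k)) =
      ∑ i ∈ Finset.range (n + 1), (-1 : R) ^ i •
        hsingle (A := eqRepC X hc') (n + 1) (mix i s t) (trace D' σ k) := by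
  rw [prismChain, LinearMap.sum_apply]
  refine Finset.sum_congr rfl fun i hi => ?_
  rw [Finset.mem_range] at hi
  rw [LinearMap.smul_apply, hsingle_apply, trace_ρ, hsingle_apply, trace_ρ]
  congr 1
  refine (pushChain_single D' _ _ _ (h := h 0) (j := bar (n + 1) (mix i s t))
    fun x hx => ?_).trans ?_
  · have hx' : k.1 (s 0 • x) ≠ 0 := fun h' => hx (by rw [lccRep_apply, inv_inv, h', map_zero])
    have h1 := hk _ hx'
    constructor
    · rw [← (h1 0 (Nat.zero_le _)).1, inv_smul_smul]
    · rw [← bar_mul_left (n + 1) (s 0)⁻¹ (mix i s t)]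
      refine bar_congr fun a ha => ?_
      simp only [mix]
      split_ifs with hai
      · rw [partialProd_bar n s (by omega)]
      · obtain ⟨h2, h3⟩ := h1 (a - 1) (by omega)
        rw [partialProd_bar n s (by omega), mul_inv_rev, inv_inv, mul_smul,
          smul_comm (s 0) (h 0)⁻¹ x, smul_comm (s (a - 1))⁻¹ (h 0)⁻¹ (s 0 • x), D'.coc_smul, h2,
          mul_inv_rev, inv_inv, mul_smul, smul_inv_smul, ← h3,
          smul_comm (h (a - 1))⁻¹ (s 0) x, D.coc_smul, inv_mul_cancel_left]
  · rw [trace_lccRep]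
    rfl

/-- A small simplex goes from vertices `s` to `h` and then to `t`, keeping the same `k`. The prism
identity for `s ↦ hsingle n s a` is thus a chain homotopy on small simplices, and these determine
linear maps. -/
theorem transferHomology_transferHomology (n : ℕ) (x : groupHomology (eqRepC X hc') n) :
    (transferHomology D' D hc' hc n).hom ((transferHomology D D' hc hc' n).hom x) = x := by
  rw [transferHomology, transferHomology, homologyHom_comp]
  have key (n : ℕ) (s : ℕ → G) (h : ℕ → H) (t : ℕ → G) (k : lcc R X M)
      (hk : ∀ x, k.1 x ≠ 0 → ∀ i ≤ n, D'.coc ((s i)⁻¹ • x) = h i ∧ D.coc ((h i)⁻¹ • x) = t i) :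
      (transferChain D' D hc' hc n ∘ₗ transferChain D D' hc hc' n)
        (hsingle (A := eqRepC X hc') n s (trace D' σ k)) =
      hsingle (A := eqRepC X hc') n t (trace D' σ k) := by
    rw [LinearMap.comp_apply,
      transferChain_hsingle D D' hc hc' n s h k fun x hx i hi => (hk x hx i hi).1,
      transferChain_hsingle D' D hc' hc n h t k fun x hx i hi => (hk x hx i hi).2]
  have key' (n : ℕ) (s : ℕ → G) (h : ℕ → H) (t : ℕ → G) (k : lcc R X M)
      (hk : ∀ x, k.1 x ≠ 0 → ∀ i ≤ n, D'.coc ((s i)⁻¹ • x) = h i ∧ D.coc ((h i)⁻¹ • x) = t i) :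
      chainD (eqRepC X hc') n
        (prismChain D D' hc' n (hsingle (A := eqRepC X hc') n s (trace D' σ k))) =
      ∑ i ∈ Finset.range (n + 1), (-1 : R) ^ i • ∑ j ∈ Finset.range (n + 2), (-1 : R) ^ j •
        hsingle (A := eqRepC X hc') n (face j (mix i s t)) (trace D' σ k) := by
    rw [prismChain_hsingle D D' hc' n s h t k hk, map_sum]
    refine Finset.sum_congr rfl fun i _ => ?_
    rw [map_smul, chainD_hsingle]
  have pr (n : ℕ) (s t : ℕ → G) (a : (eqRepC X hc').V) :=
    prism_identity (R := R) (fun s => hsingle (A := eqRepC X hc') n s a) n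
      (fun s t h => by rw [hsingle_congr (A := eqRepC X hc') n h]) s t
  refine homologyHom_eq_self_of_homotopy _ _ (fun u => ⟨prismChain D D' hc' 0 u, ?_⟩)
    (fun n u hu => ⟨prismChain D D' hc' (n + 1) u, ?_⟩) x
  · have : chainD (eqRepC X hc') 0 ∘ₗ prismChain D D' hc' 0 +
        LinearMap.id (R := R) (M := (Fin 0 → G) →₀ (eqRepC X hc').V) =
        transferChain D' D hc' hc 0 ∘ₗ transferChain D D' hc hc' 0 := by
      refine chain_hom_ext D D' hc' fun s h t k hk => ?_
      rw [LinearMap.add_apply, LinearMap.comp_apply, key' 0 s h t k hk, key 0 s h t k hk,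
        LinearMap.id_apply, ← eq_sub_iff_add_eq, ← pr 0 s t]
      simp
    rw [← this, LinearMap.add_apply, LinearMap.id_apply, add_sub_cancel_right]
    rfl
  · have : chainD (eqRepC X hc') (n + 1) ∘ₗ prismChain D D' hc' (n + 1) +
        prismChain D D' hc' n ∘ₗ chainD (eqRepC X hc') n +
        LinearMap.id (R := R) (M := (Fin (n + 1) → G) →₀ (eqRepC X hc').V) =
        transferChain D' D hc' hc (n + 1) ∘ₗ transferChain D D' hc hc' (n + 1) := by
      refine chain_hom_ext D D' hc' fun s h t k hk => ?_
      rw [LinearMap.add_apply, LinearMap.add_apply, LinearMap.comp_apply, LinearMap.comp_apply,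
        key' (n + 1) s h t k hk, key (n + 1) s h t k hk,
        LinearMap.id_apply, ← eq_sub_iff_add_eq, ← pr (n + 1) s t, chainD_hsingle, map_sum]
      congr 1
      refine Finset.sum_congr rfl fun j _ => ?_
      rw [map_smul, prismChain_hsingle D D' hc' n (face j s) (face j h) (face j t) k]
      intro x hx i hi
      simp only [face]
      split_ifs
      · exact hk x hx i (by omega)
      · exact hk x hx (i + 1) (by omega)
    rw [← this, LinearMap.add_apply, LinearMap.id_apply, add_sub_cancel_right,
      LinearMap.add_apply, LinearMap.comp_apply, LinearMap.comp_apply, hu, map_zero, add_zero]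

/-- The transfer is an isomorphism on homology. -/
def transferHomologyIso (n : ℕ) :
    groupHomology (eqRepC X hc') n ≅ groupHomology (eqRepC X hc) n where
  hom := transferHomology D D' hc hc' n
  inv := transferHomology D' D hc' hc n
  hom_inv_id := ModuleCat.hom_ext
    (LinearMap.ext (transferHomology_transferHomology D D' hc hc' n))
  inv_hom_id := ModuleCat.hom_ext
    (LinearMap.ext (transferHomology_transferHomology D' D hc' hc n))

end TransferHomology

/-! ### Compatibility with cup and cap products -/

section CoefficientProducts

variable {R G : Type u} [CommRing R] [Group G] {A₁ A₂ A₃ B₁ B₂ B₃ : Rep.{u} R G}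
  (c : A₁.V →ₗ[R] A₂.V →ₗ[R] A₃.V) (hc : ∀ g a b, c (A₁.ρ g a) (A₂.ρ g b) = A₃.ρ g (c a b))
  (c' : B₁.V →ₗ[R] B₂.V →ₗ[R] B₃.V) (hc' : ∀ g a b, c' (B₁.ρ g a) (B₂.ρ g b) = B₃.ρ g (c' a b))
  (φ₁ : A₁ ⟶ B₁) (φ₂ : A₂ ⟶ B₂) (φ₃ : A₃ ⟶ B₃)
  (hφ : ∀ a b, φ₃.hom (c a b) = c' (φ₁.hom a) (φ₂.hom b))

include hφ in
theorem functor_map_cup {m n N : ℕ} (h : m + n = N) (x : groupCohomology A₁ m)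
    (y : groupCohomology A₂ n) :
    ((groupCohomology.functor R G N).map φ₃).hom (cup c hc h x y) =
      cup c' hc' h (((groupCohomology.functor R G m).map φ₁).hom x)
        (((groupCohomology.functor R G n).map φ₂).hom y) := by
  simp only [groupCohomology_functor_map]
  refine cohomologyHom_cup _ _ _ c hc c' hc' h (fun u v => ?_) x y
  funext g
  change φ₃.hom (c (u _) (A₂.ρ _ (v _))) = c' (φ₁.hom (u _)) (B₂.ρ _ (φ₂.hom (v _)))
  rw [hφ, Rep.hom_comm_apply]

theorem homologyHom_cap {H : Type u} [Group H] {C₁ C₂ C₃ : Rep.{u} R H}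
    {t₁ : ∀ n, ((Fin n → G) → A₁.V) →ₗ[R] ((Fin n → H) → C₁.V)}
    {t₂ : ∀ n, ((Fin n → G) →₀ A₂.V) →ₗ[R] ((Fin n → H) →₀ C₂.V)}
    {t₃ : ∀ n, ((Fin n → G) →₀ A₃.V) →ₗ[R] ((Fin n → H) →₀ C₃.V)}
    (ht₁ : ∀ n u, cochainD C₁ n (t₁ n u) = t₁ (n + 1) (cochainD A₁ n u))
    (ht₂ : ∀ n u, chainD C₂ n (t₂ (n + 1) u) = t₂ n (chainD A₂ n u))
    (ht₃ : ∀ n u, chainD C₃ n (t₃ (n + 1) u) = t₃ n (chainD A₃ n u))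
    (d : C₁.V →ₗ[R] C₂.V →ₗ[R] C₃.V) (hd : ∀ g a b, d (C₁.ρ g a) (C₂.ρ g b) = C₃.ρ g (d a b))
    {k m N : ℕ} (h : k + m = N)
    (hcap : ∀ u z, t₃ k (capChain c h u z) = capChain d h (t₁ m u) (t₂ N z))
    (x : groupCohomology A₁ m) (y : groupHomology A₂ N) :
    (homologyHom t₃ ht₃ k).hom (cap c hc h x y) =
      cap d hd h ((cohomologyHom t₁ ht₁ m).hom x) ((homologyHom t₂ ht₂ N).hom y) := by
  obtain ⟨z, rfl⟩ := exists_cocycle x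
  obtain ⟨w, rfl⟩ := exists_cycle y
  rw [cap_π, cohomologyHom_π, homologyHom_π, homologyHom_π, cap_π]
  congr 1
  apply chainOf_injective
  rw [chainOf_cyclesHom, chainOf_capCycle, chainOf_capCycle, hcap, cochainOf_cocyclesHom,
    chainOf_cyclesHom]

include hφ in
theorem functor_map_cap {k m N : ℕ} (h : k + m = N) (x : groupCohomology A₁ m)
    (y : groupHomology A₂ N) :
    ((groupHomology.functor R G k).map φ₃).hom (cap c hc h x y) =
      cap c' hc' h (((groupCohomology.functor R G m).map φ₁).hom x)
        (((groupHomology.functor R G N).map φ₂).hom y) := by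
  simp only [groupCohomology_functor_map, groupHomology_functor_map]
  refine homologyHom_cap c hc _ _ _ c' hc' h (fun u z => ?_) x y
  have key : coeffChains φ₃ k ∘ₗ capChain c h u =
      capChain c' h (coeffCochains φ₁ m u) ∘ₗ coeffChains φ₂ N := by
    refine Finsupp.lhom_ext fun g a => ?_
    simp only [LinearMap.comp_apply, capChain, coeffChains, Finsupp.lsum_single,
      Finsupp.lsingle_apply, Finsupp.mapRange.linearMap_apply, Finsupp.mapRange_single]
    congr 1
    refine (hφ _ _).trans ?_
    rw [Rep.hom_comm_apply]
    rfl
  exact LinearMap.congr_fun key z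

end CoefficientProducts

/-! ### Invariant functions: the transfers respect cup and cap products. -/

section TransferProducts

variable {R G H X : Type u} [CommRing R] [Group G] [Group H] [TopologicalSpace X]
  [MulAction G X] [MulAction H X] [SMulCommClass G H X] [SMulCommClass H G X]
  [ContinuousConstSMul G X] [ContinuousConstSMul H X]
  (D : ClopenDomain G X) (D' : ClopenDomain H X)

theorem trivial_commute (R G H M : Type*) [CommRing R] [Group G] [Group H] [AddCommGroup M]
    [Module R M] (ρ : Representation R G M) (g : G) (h : H) :
    Commute (ρ g) (Representation.trivial R H M h) :=
  Commute.one_right _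

theorem commute_trivial (R G H M : Type*) [CommRing R] [Group G] [Group H] [AddCommGroup M]
    [Module R M] (ρ : Representation R G M) (h : H) (g : G) :
    Commute (Representation.trivial R H M h) (ρ g) :=
  Commute.one_left _

variable (R G X) in
/-- The multiplication of invariant functions. -/
def eqFunMul : eqFun X (Representation.trivial R G R) →ₗ[R]
    eqFun X (Representation.trivial R G R) →ₗ[R] eqFun X (Representation.trivial R G R) :=
  LinearMap.mk₂ R (fun a b => ⟨a.1 * b.1, a.2.1.mul b.2.1, fun g x => by
      change a.1 (g • x) * b.1 (g • x) = a.1 x * b.1 x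
      rw [a.2.2, b.2.2]; rfl⟩)
    (fun a a' b => Subtype.ext (add_mul a.1 a'.1 b.1))
    (fun r a b => Subtype.ext (smul_mul_assoc r a.1 b.1))
    (fun a b b' => Subtype.ext (mul_add a.1 b.1 b'.1))
    (fun r a b => Subtype.ext (mul_smul_comm r a.1 b.1))

variable (R G X) in
/-- The multiplication of invariant functions with invariant functions with compact support modulo
the group. -/
def eqFunMulC : eqFun X (Representation.trivial R G R) →ₗ[R]
    eqFunC X (Representation.trivial R G R) →ₗ[R] eqFunC X (Representation.trivial R G R) :=
  LinearMap.mk₂ R (fun a b => ⟨a.1 * b.1, (eqFunMul R G X a ⟨b.1, b.2.1⟩).2, by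
      obtain ⟨hb, K, hK, hbK⟩ := b.2
      refine ⟨K, hK, fun x hx => hbK x fun h => hx ?_⟩
      rw [Pi.mul_apply, h, mul_zero]⟩)
    (fun a a' b => Subtype.ext (add_mul a.1 a'.1 b.1))
    (fun r a b => Subtype.ext (smul_mul_assoc r a.1 b.1))
    (fun a b b' => Subtype.ext (mul_add a.1 b.1 b'.1))
    (fun r a b => Subtype.ext (mul_smul_comm r a.1 b.1))

/-- The multiplication of functions with compact support with locally constant functions. -/
def lccMul {f : X → R} (hf : IsLocallyConstant f) (k : lcc R X R) : lcc R X R :=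
  ⟨f * k.1, hf.mul k.2.1, by
    obtain ⟨hk, K, hK, hkK⟩ := k.2
    refine ⟨K, hK, fun x hx => hkK x fun h => hx ?_⟩
    rw [Pi.mul_apply, h, mul_zero]⟩

variable (R G H X) in
/-- The representation of `H` on the `G`-invariant functions. -/
abbrev invRep : Rep.{u} R H :=
  eqRep X (trivial_commute R G H R (Representation.trivial R G R))

variable (R G H X) in
/-- The representation of `H` on the `G`-invariant functions with compact support modulo `G`. -/
abbrev invRepC : Rep.{u} R H :=
  eqRepC X (trivial_commute R G H R (Representation.trivial R G R))

theorem eqFunMul_equivariant (h : H) (a b : (invRep R G H X).V) :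
    eqFunMul R G X ((invRep R G H X).ρ h a) ((invRep R G H X).ρ h b) =
      (invRep R G H X).ρ h (eqFunMul R G X a b) := rfl

theorem eqFunMulC_equivariant (h : H) (a : (invRep R G H X).V) (b : (invRepC R G H X).V) :
    eqFunMulC R G X ((invRep R G H X).ρ h a) ((invRepC R G H X).ρ h b) =
      (invRepC R G H X).ρ h (eqFunMulC R G X a b) := rfl

/-- An invariant factor can be moved inside the sum over the group. -/
theorem eqFunMulC_trace (a : eqFun X (Representation.trivial R G R)) (k : lcc R X R) :
    eqFunMulC R G X a (trace D _ k) = trace D _ (lccMul a.2.1 k) := by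
  ext x
  change a.1 x * (∑ᶠ g : G, k.1 (g⁻¹ • x)) = ∑ᶠ g : G, a.1 (g⁻¹ • x) * k.1 (g⁻¹ • x)
  refine (mul_finsum' _ _
    (finite_support_trace D (Representation.trivial R G R) k x)).trans (finsum_congr fun g => ?_)
  rw [a.2.2]
  rfl

variable (R) in
/-- The transfer of cohomology for invariant functions. -/
abbrev invTransferCochain (n : ℕ) :
    ((Fin n → G) → (invRep R H G X).V) →ₗ[R] ((Fin n → H) → (invRep R G H X).V) :=
  transferCochain D (trivial_commute R G H R (Representation.trivial R G R))
    (trivial_commute R H G R (Representation.trivial R H R)) n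

variable (R) in
/-- The transfer of homology for invariant functions. -/
abbrev invTransferChain (n : ℕ) :
    ((Fin n → G) →₀ (invRepC R H G X).V) →ₗ[R] ((Fin n → H) →₀ (invRepC R G H X).V) :=
  transferChain D D' (trivial_commute R G H R (Representation.trivial R G R))
    (trivial_commute R H G R (Representation.trivial R H R)) n

theorem evalAt_eqFunMul (x : X) (a b : eqFun X (Representation.trivial R G R)) :
    evalAt _ x (eqFunMul R G X a b) = evalAt _ x a * evalAt _ x b := rfl

/-- Evaluation at a point is multiplicative and the substitution of vertices respects front and back
faces, so compatibility already holds for cochains. -/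
theorem transferCohomology_cup {m n N : ℕ} (h : m + n = N)
    (x : groupCohomology (invRep R H G X) m) (y : groupCohomology (invRep R H G X) n) :
    (transferCohomology D _ _ N).hom
        (cup (eqFunMul R H X) (eqFunMul_equivariant (G := H) (H := G)) h x y) =
      cup (eqFunMul R G X) (eqFunMul_equivariant (G := G) (H := H)) h
        ((transferCohomology D _ _ m).hom x) ((transferCohomology D _ _ n).hom y) := by
  refine cohomologyHom_cup (t₁ := invTransferCochain R D) (t₂ := invTransferCochain R D)
    (t₃ := invTransferCochain R D) _ _ _ _ _ _ _ h (fun u v => ?_) x y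
  refine homog_injective (A := invRep R G H X) fun s => eqRep_ext _ fun x => ?_
  rw [homog_cupCochain _ (eqFunMul_equivariant (G := G) (H := H)), evalAt_homog_transferCochain,
    homog_cupCochain _ (eqFunMul_equivariant (G := H) (H := G)), evalAt_eqFunMul, evalAt_eqFunMul,
    evalAt_homog_transferCochain, evalAt_homog_transferCochain]
  rfl

/-- A projection formula on chains, in which the cochain is pulled back from `H` and the chain is
pushed to `H`. -/
theorem transferChain_cap {k m N : ℕ} (h : k + m = N) (w : (Fin m → H) → (invRep R G H X).V)
    (z : (Fin N → G) →₀ (invRepC R H G X).V) :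
    invTransferChain R D D' k (capChain (A := invRep R H G X) (B := invRepC R H G X)
        (C := invRepC R H G X) (eqFunMulC R H X) h (invTransferCochain R D' m w) z) =
      capChain (A := invRep R G H X) (B := invRepC R G H X) (C := invRepC R G H X)
        (eqFunMulC R G X) h w (invTransferChain R D D' N z) := by
  have key : invTransferChain R D D' k ∘ₗ capChain (A := invRep R H G X) (B := invRepC R H G X)
        (C := invRepC R H G X) (eqFunMulC R H X) h (invTransferCochain R D' m w) =
      capChain (A := invRep R G H X) (B := invRepC R G H X) (C := invRepC R G H X)
        (eqFunMulC R G X) h w ∘ₗ invTransferChain R D D' N := by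
    refine chain_hom_ext (W := (Fin k → H) →₀ (invRepC R G H X).V) D D'
      (trivial_commute R H G R (Representation.trivial R H R)) fun s t t' l hl => ?_
    rw [LinearMap.comp_apply, LinearMap.comp_apply,
      transferChain_hsingle D D' _ _ N s t l fun x hx i hi => (hl x hx i hi).1,
      capChain_hsingle _ (eqFunMulC_equivariant (G := H) (H := G)),
      capChain_hsingle _ (eqFunMulC_equivariant (G := G) (H := H)), eqFunMulC_trace,
      eqFunMulC_trace]
    -- On the support of `l` the vertices that the transfer of `w` substitutes are exactly the
    -- vertices of the transferred simplex, so both cochains multiply `l` by the same values.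
    have e : lccMul (homog (A := invRep R H G X) (invTransferCochain R D' m w)
        (seqShift s k) : eqFun X (Representation.trivial R H R)).2.1 l =
        lccMul (homog (A := invRep R G H X) w (seqShift t k) :
          eqFun X (Representation.trivial R G R)).2.1 l := by
      refine Subtype.ext (funext fun x => ?_)
      change evalAt _ x (homog (A := invRep R H G X) (invTransferCochain R D' m w)
        (seqShift s k)) * l.1 x = evalAt _ x (homog (A := invRep R G H X) w (seqShift t k)) * l.1 x
      by_cases hx : l.1 x = 0
      · rw [hx, mul_zero, mul_zero]
      · rw [evalAt_homog_transferCochain]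
        congr 2
        exact homog_congr w fun i hi => (hl x hx (k + i) (by omega)).1
    rw [e, transferChain_hsingle D D' _ _ k s t]
    intro x hx i hi
    refine (hl x (fun h => hx ?_) i (by omega)).1
    change _ * l.1 x = 0
    rw [h, mul_zero]
  exact LinearMap.congr_fun key z

/-- The projection formula needs a cochain pulled back from `H`. As the two transfers are inverse to
each other, every class `x` is the pull-back of its own transfer. -/
theorem transferHomology_cap {k m N : ℕ} (h : k + m = N)
    (x : groupCohomology (invRep R H G X) m) (y : groupHomology (invRepC R H G X) N) :
    (transferHomology D D' _ _ k).hom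
        (cap (A := invRep R H G X) (B := invRepC R H G X) (C := invRepC R H G X)
          (eqFunMulC R H X) (eqFunMulC_equivariant (G := H) (H := G)) h x y) =
      cap (A := invRep R G H X) (B := invRepC R G H X) (C := invRepC R G H X)
        (eqFunMulC R G X) (eqFunMulC_equivariant (G := G) (H := H)) h
        ((transferCohomology D (trivial_commute R G H R (Representation.trivial R G R))
          (trivial_commute R H G R (Representation.trivial R H R)) m).hom x)
        ((transferHomology D D' (trivial_commute R G H R (Representation.trivial R G R))
          (trivial_commute R H G R (Representation.trivial R H R)) N).hom y) := by
  rw [← transferCohomology_transferCohomology D D' (trivial_commute R G H R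
    (Representation.trivial R G R)) (trivial_commute R H G R (Representation.trivial R H R)) m x,
    transferCohomology_transferCohomology D' D]
  obtain ⟨w, hw⟩ := exists_cocycle
    ((transferCohomology D (trivial_commute R G H R (Representation.trivial R G R))
          (trivial_commute R H G R (Representation.trivial R H R)) m).hom x)
  obtain ⟨z, rfl⟩ := exists_cycle y
  rw [← hw, transferCohomology, transferHomology, transferHomology, cohomologyHom_π, cap_π,
    homologyHom_π, homologyHom_π, cap_π]
  congr 1
  apply chainOf_injective
  rw [chainOf_cyclesHom, chainOf_capCycle, chainOf_capCycle, cochainOf_cocyclesHom,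
    chainOf_cyclesHom]
  exact transferChain_cap D D' h _ _

end TransferProducts

/-! ### Crossed products -/

section CrossedProduct

variable {R Y G : Type*} [CommRing R] [TopologicalSpace Y] [Group G] [MulAction G Y]
  [ContinuousConstSMul G Y]

/-- The coefficient of a group element. -/
def coeffHom (g : G) : CrossedProduct R Y G →+ LocallyConstant Y R where
  toFun s := SkewMonoidAlgebra.coeff s g
  map_zero' := rfl
  map_add' s s' := DFunLike.congr_fun (SkewMonoidAlgebra.coeff_add s s') g

theorem crossed_ext {s s' : CrossedProduct R Y G} (h : ∀ g y, coeffHom g s y = coeffHom g s' y) :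
    s = s' :=
  SkewMonoidAlgebra.ext fun g => LocallyConstant.ext fun y => h g y

theorem coeffHom_mono [DecidableEq G] (g h : G) (f : LocallyConstant Y R) :
    coeffHom h (mono g f) = if g = h then f else 0 :=
  SkewMonoidAlgebra.coeff_single_apply (k := LocallyConstant Y R) (a := g) (a' := h) (b := f)

theorem finite_support_coeffHom (s : CrossedProduct R Y G) :
    (Function.support fun g => coeffHom g s).Finite :=
  (SkewMonoidAlgebra.coeff s).hasFiniteSupport

theorem mono_add (g : G) (f f' : LocallyConstant Y R) :
    (mono g (f + f') : CrossedProduct R Y G) = mono g f + mono g f' :=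
  SkewMonoidAlgebra.single_add g f f'

theorem mono_zero (g : G) : (mono g 0 : CrossedProduct R Y G) = 0 :=
  SkewMonoidAlgebra.single_zero_right g

theorem smul_mono (c : R) (g : G) (f : LocallyConstant Y R) :
    c • (mono g f : CrossedProduct R Y G) = mono g (c • f) :=
  SkewMonoidAlgebra.smul_single c g f

theorem incl_of (g : G) : incl R Y G (MonoidAlgebra.of R G g) = mono g 1 :=
  MonoidAlgebra.lift_of (A := CrossedProduct R Y G)
    (show G →* CrossedProduct R Y G from SkewMonoidAlgebra.of (LocallyConstant Y R) G) g

theorem crossed_induction {p : CrossedProduct R Y G → Prop} (s : CrossedProduct R Y G)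
    (zero : p 0) (single : ∀ g f, p (mono g f)) (add : ∀ s s', p s → p s' → p (s + s')) : p s :=
  SkewMonoidAlgebra.induction_on s zero single add

theorem coeffHom_mono_one_mul (f : LocallyConstant Y R) (s : CrossedProduct R Y G) (g : G) :
    coeffHom g (mono 1 f * s) = f * coeffHom g s := by
  classical
  induction s using crossed_induction with
  | zero => rw [mul_zero, map_zero, mul_zero]
  | add s s' h h' => rw [mul_add, map_add, map_add, mul_add, h, h']
  | single g' f' =>
    rw [mono_mul_mono, one_mul, one_smul, coeffHom_mono, coeffHom_mono, mul_ite, mul_zero]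

theorem coeffHom_mul_mono_one (f : LocallyConstant Y R) (s : CrossedProduct R Y G) (g : G) :
    coeffHom g (s * mono 1 f) = coeffHom g s * g • f := by
  classical
  induction s using crossed_induction with
  | zero => rw [zero_mul, map_zero, zero_mul]
  | add s s' h h' => rw [add_mul, map_add, map_add, add_mul, h, h']
  | single g' f' =>
    rw [mono_mul_mono, mul_one, coeffHom_mono, coeffHom_mono, ite_mul, zero_mul]
    split_ifs with h
    · rw [h]
    · rfl

theorem charFn_apply {U : TopologicalSpace.Clopens Y} [DecidablePred (· ∈ U)] (y : Y) :
    LocallyConstant.charFn R U.isClopen y = if y ∈ U then 1 else 0 := by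
  classical
  rw [LocallyConstant.coe_charFn, Set.indicator_apply]
  exact if_congr Iff.rfl rfl rfl

theorem coeffHom_chi_mul (U : TopologicalSpace.Clopens Y) [DecidablePred (· ∈ U)]
    (s : CrossedProduct R Y G) (g : G) (y : Y) :
    coeffHom g (chi R G U * s) y = if y ∈ U then coeffHom g s y else 0 := by
  rw [chi, coeffHom_mono_one_mul, LocallyConstant.mul_apply, charFn_apply, ite_mul, one_mul,
    zero_mul]

theorem coeffHom_mul_chi (U : TopologicalSpace.Clopens Y) [DecidablePred (· ∈ U)]
    (s : CrossedProduct R Y G) (g : G) (y : Y) :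
    coeffHom g (s * chi R G U) y = if g⁻¹ • y ∈ U then coeffHom g s y else 0 := by
  rw [chi, coeffHom_mul_mono_one, LocallyConstant.mul_apply, smul_locallyConstant_apply,
    charFn_apply, mul_ite, mul_one, mul_zero]

/-- Left multiplication by `χ_U` restricts the targets `y` of the arrows, right multiplication their
sources `g⁻¹ • y`. -/
theorem mem_corner_iff {U : TopologicalSpace.Clopens Y} {s : CrossedProduct R Y G} :
    s ∈ Subsemigroup.corner (chi R G U) ↔
      ∀ g y, coeffHom g s y ≠ 0 → y ∈ U ∧ g⁻¹ • y ∈ U := by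
  classical
  rw [Subsemigroup.mem_corner_iff (isIdempotentElem_chi R G U)]
  constructor
  · rintro ⟨h1, h2⟩ g y h
    constructor
    · by_contra hy
      rw [← h1, coeffHom_chi_mul, if_neg hy] at h
      exact h rfl
    · by_contra hy
      rw [← h2, coeffHom_mul_chi, if_neg hy] at h
      exact h rfl
  · refine fun h => ⟨crossed_ext fun g y => ?_, crossed_ext fun g y => ?_⟩
    · rw [coeffHom_chi_mul, ite_eq_left_iff]
      exact fun hy => by_contra fun h' => hy (h g y (Ne.symm h')).1
    · rw [coeffHom_mul_chi, ite_eq_left_iff]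
      exact fun hy => by_contra fun h' => hy (h g y (Ne.symm h')).2

end CrossedProduct

/-! ### Equivariant functions as modules over the crossed product -/

section CrossAct

variable {R G H X M : Type*} [CommRing R] [Group G] [Group H] [TopologicalSpace X]
  [MulAction G X] [MulAction H X] [SMulCommClass G H X]
  [ContinuousConstSMul G X] [ContinuousConstSMul H X] [AddCommGroup M] [Module R M]
  (D : ClopenDomain G X) {ρ : Representation R G M} {σ : Representation R H M}
  (hc : ∀ g h, Commute (ρ g) (σ h))

theorem ClopenDomain.smul_proj (h : H) (x : X) : h • D.proj x = D.proj (h • x) := by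
  change D.proj (h • D.toDom x • x) = _
  rw [← smul_comm (D.toDom x) h, D.proj_smul]

theorem ClopenDomain.exists_smul_eq_of_proj_eq {x y : X} (h : D.proj x = D.proj y) :
    ∃ g : G, g • x = y := by
  refine ⟨(D.toDom y)⁻¹ * D.toDom x, ?_⟩
  rw [mul_smul, inv_smul_eq_iff]
  exact congrArg Subtype.val h

include D in
theorem ClopenDomain.eq_one_of_smul_eq {x : X} {g : G} (h : g • x = x) : g = 1 := by
  have := D.coc_smul g x
  rwa [h, right_eq_mul] at this

/-- The multiplication by functions on the orbit space. -/
def mulFun (ρ : Representation R G M) : LocallyConstant D.Space R →+* Module.End R (eqFun X ρ) where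
  toFun φ :=
    { toFun := fun f => ⟨fun x => φ (D.proj x) • f.1 x,
        (φ.isLocallyConstant.comp_continuous D.continuous_proj).comp₂ f.2.1 (· • ·),
        fun g x => by simp only [D.proj_smul, f.2.2, map_smul]⟩
      map_add' := fun f f' => Subtype.ext (funext fun x => smul_add _ _ _)
      map_smul' := fun c f => Subtype.ext (funext fun x => smul_comm _ _ _) }
  map_one' := by ext f x; exact one_smul _ _
  map_mul' φ ψ := by ext f x; exact mul_smul _ _ _
  map_zero' := by ext f x; exact zero_smul _ _
  map_add' φ ψ := by ext f x; exact add_smul _ _ _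

/-- The action of the crossed product on equivariant functions. -/
def crossAct : CrossedProduct R D.Space H →+* Module.End R (eqFun X ρ) :=
  SkewMonoidAlgebra.liftNCRingHom (mulFun D ρ) (eqAction X ρ σ hc) (by
    -- The covariance relation of the crossed product: translating by `h` after multiplying by `φ`
    -- is multiplying by the translate of `φ` after translating.
    intro φ h
    ext f x
    change φ (h⁻¹ • D.proj x) • σ h (f.1 (h⁻¹ • x)) = σ h (φ (D.proj (h⁻¹ • x)) • f.1 (h⁻¹ • x))
    rw [(σ h).map_smul, D.smul_proj])

theorem crossAct_mono (h : H) (φ : LocallyConstant D.Space R) (f : eqFun X ρ) (x : X) :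
    (crossAct D hc (mono h φ) f).1 x = φ (D.proj x) • σ h (f.1 (h⁻¹ • x)) := by
  have := SkewMonoidAlgebra.liftNC_single (mulFun D ρ : LocallyConstant D.Space R →+ _)
    (eqAction X ρ σ hc) h φ
  exact congrFun (congrArg Subtype.val (LinearMap.congr_fun this f)) x

theorem crossAct_incl (h : H) :
    crossAct D hc (incl R D.Space H (MonoidAlgebra.of R H h)) = eqAction X ρ σ hc h := by
  ext f x
  rw [incl_of, crossAct_mono]
  exact one_smul _ _

theorem crossAct_smul (c : R) (s : CrossedProduct R D.Space H) (f : eqFun X ρ) :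
    crossAct D hc (c • s) f = c • crossAct D hc s f := by
  induction s using crossed_induction with
  | zero => rw [smul_zero, map_zero, LinearMap.zero_apply, smul_zero]
  | add s s' h h' =>
    rw [smul_add, map_add, map_add, LinearMap.add_apply, LinearMap.add_apply, h, h', smul_add]
  | single h φ =>
    ext x
    rw [smul_mono, crossAct_mono]
    change _ = c • (crossAct D hc (mono h φ) f).1 x
    rw [crossAct_mono, ← mul_smul]
    rfl

theorem crossAct_chi (B : TopologicalSpace.Clopens D.Space) [DecidablePred (· ∈ B)]
    (f : eqFun X ρ) (x : X) :
    (crossAct D hc (chi R H B) f).1 x = if D.proj x ∈ B then f.1 x else 0 := by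
  rw [chi, crossAct_mono, charFn_apply, map_one, ite_smul, one_smul, zero_smul, inv_one, one_smul]
  rfl

theorem finite_support_crossAct (s : CrossedProduct R D.Space H) (f : eqFun X ρ) (x : X) :
    (Function.support fun h => coeffHom h s (D.proj x) • σ h (f.1 (h⁻¹ • x))).Finite :=
  (finite_support_coeffHom s).subset fun h hh h' => hh (by
    change coeffHom h s = 0 at h'
    change coeffHom h s (D.proj x) • _ = 0
    rw [h', LocallyConstant.zero_apply, zero_smul])

theorem crossAct_apply (s : CrossedProduct R D.Space H) (f : eqFun X ρ) (x : X) :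
    (crossAct D hc s f).1 x = ∑ᶠ h : H, coeffHom h s (D.proj x) • σ h (f.1 (h⁻¹ • x)) := by
  classical
  induction s using crossed_induction with
  | zero =>
    rw [map_zero]
    simp only [map_zero, LocallyConstant.zero_apply, zero_smul, finsum_zero]
    rfl
  | add s s' h h' =>
    rw [map_add, LinearMap.add_apply]
    simp only [map_add, LocallyConstant.add_apply, add_smul]
    rw [finsum_add_distrib (finite_support_crossAct D s f x) (finite_support_crossAct D s' f x),
      ← h, ← h']
    rfl
  | single h φ =>
    rw [crossAct_mono, finsum_eq_single _ h fun h' hh => ?_]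
    · rw [coeffHom_mono, if_pos rfl]
    · rw [coeffHom_mono, if_neg hh.symm, LocallyConstant.zero_apply, zero_smul]

end CrossAct

/-! ### Slices, and the transport of crossed products along them -/

section Slice

variable {R G H X M : Type*} [CommRing R] [Group G] [Group H] [TopologicalSpace X]
  [MulAction G X] [MulAction H X] [SMulCommClass G H X] [SMulCommClass H G X]
  [AddCommGroup M] [Module R M]

/-- A compact-open set that embeds into both orbit spaces, with the images `B` and `A`. -/
structure IsSlice (D : ClopenDomain G X) (D' : ClopenDomain H X) (U : Set X)
    (A : TopologicalSpace.Clopens D'.Space) (B : TopologicalSpace.Clopens D.Space) : Prop where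
  isClopen : IsClopen U
  isCompact : IsCompact U
  inj_left (g : G) (x : X) : x ∈ U → g • x ∈ U → g = 1
  inj_right (h : H) (x : X) : x ∈ U → h • x ∈ U → h = 1
  mem_left (x : X) : D.proj x ∈ B ↔ ∃ g : G, g • x ∈ U
  mem_right (x : X) : D'.proj x ∈ A ↔ ∃ h : H, h • x ∈ U

variable {D : ClopenDomain G X} {D' : ClopenDomain H X} {U : Set X}
  {A : TopologicalSpace.Clopens D'.Space} {B : TopologicalSpace.Clopens D.Space}

theorem IsSlice.symm (S : IsSlice D D' U A B) : IsSlice D' D U B A :=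
  ⟨S.isClopen, S.isCompact, S.inj_right, S.inj_left, S.mem_right, S.mem_left⟩

theorem IsSlice.proj_mem (S : IsSlice D D' U A B) {x : X} (hx : x ∈ U) : D.proj x ∈ B :=
  (S.mem_left x).2 ⟨1, by rwa [one_smul]⟩

theorem IsSlice.eq_left (S : IsSlice D D' U A B) {x : X} {g g' : G} (hg : g⁻¹ • x ∈ U)
    (hg' : g'⁻¹ • x ∈ U) : g = g' := by
  have := S.inj_left (g'⁻¹ * g) _ hg (by rwa [smul_smul, mul_inv_cancel_right])
  exact (inv_mul_eq_one.1 this).symm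

variable [ContinuousConstSMul G X] [ContinuousConstSMul H X]

/-- The restriction of a function to a slice. -/
def IsSlice.restrict (S : IsSlice D D' U A B) (R M : Type*) [CommRing R] [AddCommGroup M]
    [Module R M] {f : X → M} (hf : IsLocallyConstant f) : lcc R X M :=
  ⟨U.indicator f, isLocallyConstant_indicator hf S.isClopen, U, S.isCompact,
    fun _ hx => Set.mem_of_indicator_ne_zero hx⟩

/-- `U` meets each `G`-orbit at most once, so a single translate of the restricted function is
nonzero at `g • x`. -/
theorem IsSlice.trace_restrict_smul (S : IsSlice D D' U A B) (ρ : Representation R G M) {f : X → M}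
    (hf : IsLocallyConstant f) (g : G) {x : X} (hx : x ∈ U) :
    (trace D ρ (S.restrict R M hf)).1 (g • x) = ρ g (f x) := by
  rw [trace_apply, finsum_eq_single _ g fun g' hg' => ?_]
  · rw [inv_smul_smul]
    exact congrArg _ (Set.indicator_of_mem hx f)
  · refine (congrArg (ρ g') (Set.indicator_of_notMem (fun h => hg' ?_) f)).trans (map_zero _)
    exact S.eq_left h (by rwa [inv_smul_smul])

theorem IsSlice.trace_restrict (S : IsSlice D D' U A B) (ρ : Representation R G M) {f : X → M}
    (hf : IsLocallyConstant f) {x : X} (hx : x ∈ U) :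
    (trace D ρ (S.restrict R M hf)).1 x = f x := by
  have := S.trace_restrict_smul ρ hf 1 hx
  rwa [one_smul, map_one] at this

theorem IsSlice.trace_restrict_eq_zero (S : IsSlice D D' U A B) (ρ : Representation R G M)
    {f : X → M} (hf : IsLocallyConstant f) {x : X} (hx : D.proj x ∉ B) :
    (trace D ρ (S.restrict R M hf)).1 x = 0 := by
  refine finsum_eq_zero_of_forall_eq_zero fun g => ?_
  refine (congrArg (ρ g) (Set.indicator_of_notMem (fun h => hx ?_) f)).trans (map_zero _)
  exact (S.mem_left x).2 ⟨_, h⟩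

theorem IsSlice.exists_smul (S : IsSlice D D' U A B) {x : X} (hx : D.proj x ∈ B) :
    ∃ (g : G) (y : X), y ∈ U ∧ x = g • y := by
  obtain ⟨g, hg⟩ := (S.mem_left x).1 hx
  exact ⟨g⁻¹, g • x, hg, (inv_smul_smul g x).symm⟩

/-- The extension of functions from a slice: the function on the orbit space of `G`. -/
def IsSlice.extend (S : IsSlice D D' U A B) {f : X → R} (hf : IsLocallyConstant f) :
    LocallyConstant D.Space R :=
  ⟨fun d => (trace D (Representation.trivial R G R) (S.restrict R R hf)).1 d.1,
    (trace D (Representation.trivial R G R) (S.restrict R R hf)).2.1.1.comp_continuous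
      continuous_subtype_val⟩

theorem IsSlice.extend_proj (S : IsSlice D D' U A B) {f : X → R} (hf : IsLocallyConstant f) {x : X}
    (hx : x ∈ U) : S.extend hf (D.proj x) = f x :=
  S.trace_restrict_smul (Representation.trivial R G R) hf (D.toDom x) hx

theorem IsSlice.extend_eq_zero (S : IsSlice D D' U A B) {f : X → R} (hf : IsLocallyConstant f)
    {d : D.Space} (hd : d ∉ B) : S.extend hf d = 0 :=
  S.trace_restrict_eq_zero (Representation.trivial R G R) hf (by rwa [D.proj_coe])

/-- The pull-back to a slice of the coefficient of `g` of the transported element. -/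
def transportFun (D : ClopenDomain G X) (U : Set X) (t : CrossedProduct R D.Space H) (g : G)
    (x : X) : R :=
  ∑ᶠ h : H, U.indicator (fun _ => coeffHom h t (D.proj x)) (h⁻¹ • g⁻¹ • x)

theorem finite_support_transportFun (t : CrossedProduct R D.Space H) (g : G) (x : X) :
    (Function.support fun h : H =>
      U.indicator (fun _ => coeffHom h t (D.proj x)) (h⁻¹ • g⁻¹ • x)).Finite := by
  refine (finite_support_coeffHom t).subset fun h hh h' => hh ?_
  change coeffHom h t = 0 at h'
  change U.indicator _ _ = _
  rw [h', LocallyConstant.zero_apply, Set.indicator_zero]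

theorem transportFun_add (t t' : CrossedProduct R D.Space H) (g : G) (x : X) :
    transportFun D U (t + t') g x = transportFun D U t g x + transportFun D U t' g x := by
  rw [transportFun, transportFun, transportFun, ← finsum_add_distrib
    (finite_support_transportFun t g x) (finite_support_transportFun t' g x)]
  refine finsum_congr fun h => ?_
  simp only [map_add, LocallyConstant.add_apply]
  exact congrFun (Set.indicator_add U _ _) _

/-- `U` also meets each `H`-orbit at most once; hence `h` is determined by `g` and `x`, and the pair
`(x, g)` names one arrow of each groupoid. -/
theorem transportFun_of_mem (S : IsSlice D D' U A B) (t : CrossedProduct R D.Space H) {g : G}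
    {x : X} {h : H} (hx : h⁻¹ • g⁻¹ • x ∈ U) :
    transportFun D U t g x = coeffHom h t (D.proj x) := by
  rw [transportFun, finsum_eq_single _ h fun h' hh' => ?_, Set.indicator_of_mem hx]
  exact Set.indicator_of_notMem (fun hx' => hh' (S.symm.eq_left hx' hx)) _

theorem transportFun_eq_zero (t : CrossedProduct R D.Space H) {g : G}
    {x : X} (hx : ∀ h : H, h⁻¹ • g⁻¹ • x ∉ U) : transportFun D U t g x = 0 :=
  finsum_eq_zero_of_forall_eq_zero fun h => Set.indicator_of_notMem (hx h) _

theorem transportFun_mono (t : LocallyConstant D.Space R) (h : H) (g : G) (x : X) :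
    transportFun D U (mono h t) g x = U.indicator (fun _ => t (D.proj x)) (h⁻¹ • g⁻¹ • x) := by
  classical
  rw [transportFun, finsum_eq_single _ h fun h' hh' => ?_]
  · rw [coeffHom_mono, if_pos rfl]
  · rw [coeffHom_mono, if_neg hh'.symm, LocallyConstant.zero_apply, Set.indicator_zero]

theorem isLocallyConstant_transportFun (hU : IsClopen U) (t : CrossedProduct R D.Space H) (g : G) :
    IsLocallyConstant (transportFun D U t g) := by
  induction t using crossed_induction with
  | zero =>
    convert IsLocallyConstant.const (0 : R)
    funext x
    rw [← mono_zero (1 : H), transportFun_mono]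
    exact Set.indicator_apply_eq_zero.2 fun _ => rfl
  | add t t' h h' =>
    convert h.add h'
    funext x
    exact transportFun_add t t' g x
  | single h t =>
    have hcont : Continuous fun x : X => h⁻¹ • g⁻¹ • x :=
      (continuous_const_smul _).comp (continuous_const_smul _)
    convert isLocallyConstant_indicator
      (t.isLocallyConstant.comp_continuous D.continuous_proj) (hU.preimage hcont)
    funext x
    rw [transportFun_mono]
    rfl

/-- If `y = h⁻¹ g⁻¹ x` lies in `U`, then `g = coc x * (coc (h • y))⁻¹`. There are finitely many `h`
in the support of `t`, and both values of `coc` range over finite sets because `U` is compact. -/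
theorem finite_transport (S : IsSlice D D' U A B) (t : CrossedProduct R D.Space H) :
    {g : G | ∃ x ∈ U, transportFun D U t g x ≠ 0}.Finite := by
  have hfin (h : H) : ((D.coc '' U) ×ˢ ((fun x => D.coc (h • x)) '' U)).Finite :=
    (finite_image_of_isCompact D.isLocallyConstant_coc S.isCompact).prod
      (finite_image_of_isCompact (isLocallyConstant_smul D.isLocallyConstant_coc h) S.isCompact)
  refine ((finite_support_coeffHom t).biUnion fun h _ => (hfin h).image fun p => p.1 * p.2⁻¹).subset
    ?_
  rintro g ⟨x, hx, hg⟩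
  obtain ⟨h, hh⟩ : ∃ h : H, h⁻¹ • g⁻¹ • x ∈ U := by
    by_contra! h
    exact hg (transportFun_eq_zero t h)
  rw [transportFun_of_mem S t hh] at hg
  refine Set.mem_biUnion (x := h) (fun h' => hg ?_) ⟨(_, _), ⟨⟨x, hx, rfl⟩, ⟨_, hh, rfl⟩⟩, ?_⟩
  · change coeffHom h t = 0 at h'
    rw [h', LocallyConstant.zero_apply]
  · change D.coc x * (D.coc (h • h⁻¹ • g⁻¹ • x))⁻¹ = g
    rw [smul_inv_smul, D.coc_smul, mul_inv_rev, inv_inv, mul_inv_cancel_left]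

theorem finite_support_transport (S : IsSlice D D' U A B) (t : CrossedProduct R D.Space H) :
    (Function.support fun g : G =>
      S.symm.extend (isLocallyConstant_transportFun S.isClopen t g)).Finite := by
  refine (finite_transport S t).subset fun g hg => ?_
  by_contra h
  refine hg (LocallyConstant.ext fun d => ?_)
  rw [LocallyConstant.zero_apply]
  by_cases hd : d ∈ A
  · obtain ⟨g', y, hy, hdy⟩ := S.symm.exists_smul (x := d.1) (by rwa [D'.proj_coe])
    rw [← D'.proj_coe d, hdy, D'.proj_smul, S.symm.extend_proj _ hy]
    by_contra h'
    exact h ⟨y, hy, h'⟩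
  · exact S.symm.extend_eq_zero _ hd

/-- The transport of the crossed product along a slice. -/
def transportAux (S : IsSlice D D' U A B) (t : CrossedProduct R D.Space H) :
    CrossedProduct R D'.Space G :=
  (⟨Finsupp.ofSupportFinite _ (finite_support_transport S t)⟩ :
    SkewMonoidAlgebra (LocallyConstant D'.Space R) G)

theorem coeffHom_transportAux (S : IsSlice D D' U A B) (t : CrossedProduct R D.Space H) (g : G)
    {x : X} (hx : x ∈ U) : coeffHom g (transportAux S t) (D'.proj x) = transportFun D U t g x :=
  S.symm.extend_proj (isLocallyConstant_transportFun S.isClopen t g) hx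

theorem coeffHom_transportAux_eq_zero (S : IsSlice D D' U A B) (t : CrossedProduct R D.Space H)
    (g : G) {d : D'.Space} (hd : d ∉ A) : coeffHom g (transportAux S t) d = 0 :=
  S.symm.extend_eq_zero (isLocallyConstant_transportFun S.isClopen t g) hd

theorem crossed_ext_slice (S : IsSlice D D' U A B) {s s' : CrossedProduct R D'.Space G}
    (h : ∀ g, ∀ x ∈ U, coeffHom g s (D'.proj x) = coeffHom g s' (D'.proj x))
    (hs : ∀ g, ∀ d ∉ A, coeffHom g s d = 0) (hs' : ∀ g, ∀ d ∉ A, coeffHom g s' d = 0) :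
    s = s' := by
  refine crossed_ext fun g d => ?_
  by_cases hd : d ∈ A
  · obtain ⟨g', y, hy, hdy⟩ := S.symm.exists_smul (x := d.1) (by rwa [D'.proj_coe])
    rw [← D'.proj_coe d, hdy, D'.proj_smul, h g y hy]
  · rw [hs g d hd, hs' g d hd]

/-- The transport of the crossed product along a slice, as an additive homomorphism. -/
def transport (S : IsSlice D D' U A B) :
    CrossedProduct R D.Space H →+ CrossedProduct R D'.Space G :=
  AddMonoidHom.mk' (transportAux S) fun t t' => by
    refine crossed_ext_slice S (fun g x hx => ?_)
      (fun g d hd => coeffHom_transportAux_eq_zero S _ g hd) fun g d hd => ?_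
    · rw [map_add, LocallyConstant.add_apply, coeffHom_transportAux S _ g hx,
        coeffHom_transportAux S _ g hx, coeffHom_transportAux S _ g hx, transportFun_add]
    · rw [map_add, LocallyConstant.add_apply, coeffHom_transportAux_eq_zero S _ g hd,
        coeffHom_transportAux_eq_zero S _ g hd, add_zero]

theorem coeffHom_transport (S : IsSlice D D' U A B) (t : CrossedProduct R D.Space H) (g : G)
    {x : X} (hx : x ∈ U) : coeffHom g (transport S t) (D'.proj x) = transportFun D U t g x :=
  coeffHom_transportAux S t g hx

theorem coeffHom_transport_eq_zero (S : IsSlice D D' U A B) (t : CrossedProduct R D.Space H)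
    (g : G) {d : D'.Space} (hd : d ∉ A) : coeffHom g (transport S t) d = 0 :=
  coeffHom_transportAux_eq_zero S t g hd

theorem transport_mem_corner (S : IsSlice D D' U A B) (t : CrossedProduct R D.Space H) :
    transport S t ∈ Subsemigroup.corner (chi R G A) := by
  rw [mem_corner_iff]
  intro g d hd
  have hdA : d ∈ A := by
    by_contra h
    exact hd (coeffHom_transport_eq_zero S t g h)
  refine ⟨hdA, ?_⟩
  obtain ⟨g', y, hy, hdy⟩ := S.symm.exists_smul (x := d.1) (by rwa [D'.proj_coe])
  have hdy' : d = D'.proj y := by rw [← D'.proj_coe d, hdy, D'.proj_smul]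
  rw [hdy', coeffHom_transport S t g hy] at hd
  rw [hdy', D'.smul_proj, S.mem_right]
  by_contra! h
  exact hd (transportFun_eq_zero t fun h' => h h'⁻¹)

/-- The actions commute, so the relation `h⁻¹ g⁻¹ x ∈ U` between `g` and `h` is symmetric and the
second transport reads off the original coefficient. -/
theorem transport_transport (S : IsSlice D D' U A B) {t : CrossedProduct R D.Space H}
    (ht : t ∈ Subsemigroup.corner (chi R H B)) : transport S.symm (transport S t) = t := by
  rw [mem_corner_iff] at ht
  refine crossed_ext_slice S.symm (fun h x hx => ?_)
    (fun h d hd => coeffHom_transport_eq_zero S.symm _ h hd)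
    fun h d hd => by_contra fun h' => hd (ht h d h').1
  rw [coeffHom_transport S.symm _ h hx]
  by_cases hp : ∃ g : G, g⁻¹ • h⁻¹ • x ∈ U
  · obtain ⟨g, hg⟩ := hp
    rw [transportFun_of_mem S.symm _ hg, coeffHom_transport S _ g hx, transportFun_of_mem S]
    rwa [smul_comm]
  -- With no such `g`, the point `h⁻¹ • x` projects outside `B`, and there an element of the corner
  -- has zero coefficient anyway.
  · push Not at hp
    rw [transportFun_eq_zero _ hp]
    by_contra h'
    have := (ht h _ (Ne.symm h')).2
    rw [D.smul_proj, S.mem_left] at this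
    obtain ⟨g, hg⟩ := this
    exact hp g⁻¹ (by rwa [inv_inv])

variable {ρ : Representation R G M} {σ : Representation R H M}
  (hc : ∀ g h, Commute (ρ g) (σ h)) (hc' : ∀ h g, Commute (σ h) (ρ g))

/-- The extension of functions from a slice: the passage from `H`-equivariant functions to
`G`-equivariant functions that agree with them on the slice. -/
def transfer (S : IsSlice D D' U A B) (σ : Representation R H M) (ρ : Representation R G M) :
    eqFun X σ →ₗ[R] eqFunC X ρ :=
  trace D ρ ∘ₗ
    { toFun := fun w => S.restrict R M w.2.1
      map_add' := fun _ _ => Subtype.ext (Set.indicator_add _ _ _)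
      map_smul' := fun c f => Subtype.ext (Set.indicator_const_smul _ c f.1) }

/-- The transfer of equivariant functions, without the condition on the supports. -/
def transferFun (S : IsSlice D D' U A B) (σ : Representation R H M) (ρ : Representation R G M) :
    eqFun X σ →ₗ[R] eqFun X ρ :=
  Submodule.inclusion (fun _ (h : _ ∈ eqFunC X ρ) => h.1) ∘ₗ transfer S σ ρ

theorem transferFun_smul (S : IsSlice D D' U A B) (w : eqFun X σ) (g : G) {x : X} (hx : x ∈ U) :
    (transferFun S σ ρ w).1 (g • x) = ρ g (w.1 x) :=
  S.trace_restrict_smul ρ w.2.1 g hx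

theorem transferFun_apply (S : IsSlice D D' U A B) (w : eqFun X σ) {x : X} (hx : x ∈ U) :
    (transferFun S σ ρ w).1 x = w.1 x :=
  S.trace_restrict ρ w.2.1 hx

theorem transferFun_eq_zero (S : IsSlice D D' U A B) (w : eqFun X σ) {x : X} (hx : D.proj x ∉ B) :
    (transferFun S σ ρ w).1 x = 0 :=
  S.trace_restrict_eq_zero ρ w.2.1 hx

theorem eqFun_ext_slice (S : IsSlice D D' U A B) {f f' : eqFun X ρ} (h : ∀ x ∈ U, f.1 x = f'.1 x)
    (hf : ∀ x, D.proj x ∉ B → f.1 x = 0) (hf' : ∀ x, D.proj x ∉ B → f'.1 x = 0) : f = f' := by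
  refine Subtype.ext (funext fun x => ?_)
  by_cases hx : D.proj x ∈ B
  · obtain ⟨g, y, hy, rfl⟩ := S.exists_smul hx
    rw [f.2.2, f'.2.2, h y hy]
  · rw [hf x hx, hf' x hx]

theorem crossAct_chi_transferFun (S : IsSlice D D' U A B) (w : eqFun X σ) :
    crossAct D hc (chi R H B) (transferFun S σ ρ w) = transferFun S σ ρ w := by
  classical
  refine Subtype.ext (funext fun x => ?_)
  rw [crossAct_chi, ite_eq_left_iff]
  exact fun hx => (transferFun_eq_zero S w hx).symm

/-- The term of `h` samples the transferred function at `h⁻¹ x`. If `g` brings that point back to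
`U`, the value there is `ρ g` applied to a value of `w` on `U`; the `H`-equivariance of `w` rewrites
it as the `g`-term of the transported element. Without such a `g` both sides vanish. -/
theorem crossAct_transfer (S : IsSlice D D' U A B) (t : CrossedProduct R D.Space H)
    (w : eqFun X σ) {x : X} (hx : x ∈ U) :
    (crossAct D hc t (transferFun S σ ρ w)).1 x = (crossAct D' hc' (transport S t) w).1 x := by
  induction t using crossed_induction with
  | zero => rw [map_zero, map_zero, map_zero]; rfl
  | add t t' h h' =>
    rw [map_add, map_add, map_add, LinearMap.add_apply, LinearMap.add_apply]
    exact congrArg₂ (· + ·) h h'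
  | single h φ =>
    rw [crossAct_mono, crossAct_apply]
    simp only [coeffHom_transport S _ _ hx, transportFun_mono]
    by_cases hp : ∃ g : G, g⁻¹ • h⁻¹ • x ∈ U
    · obtain ⟨g, hg⟩ := hp
      have hg' : h⁻¹ • g⁻¹ • x ∈ U := by rwa [smul_comm]
      rw [finsum_eq_single _ g fun g' hg'' => ?_]
      · have h1 := transferFun_smul (ρ := ρ) S w g hg
        rw [smul_inv_smul] at h1
        rw [h1, Set.indicator_of_mem hg', smul_comm g⁻¹ h⁻¹, w.2.2]
        congr 1
        refine (LinearMap.congr_fun (hc g h).eq (σ h⁻¹ (w.1 (g⁻¹ • x)))).symm.trans ?_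
        rw [Module.End.mul_apply, Representation.self_inv_apply]
      · rw [Set.indicator_of_notMem, zero_smul]
        intro h'
        rw [smul_comm] at h'
        exact hg'' (S.eq_left h' hg)
    · push Not at hp
      rw [transferFun_eq_zero S w, map_zero, smul_zero, finsum_eq_zero_of_forall_eq_zero]
      · intro g
        rw [Set.indicator_of_notMem, zero_smul]
        rw [smul_comm]
        exact hp g
      · rw [S.mem_left]
        rintro ⟨g, hg⟩
        exact hp g⁻¹ (by rwa [inv_inv])

/-- The transfer of functions is semilinear with respect to the transport of crossed products. -/
theorem chi_crossAct_transferFun (S : IsSlice D D' U A B) (t : CrossedProduct R D.Space H)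
    (w : eqFun X σ) :
    crossAct D hc (chi R H B) (crossAct D hc t (transferFun S σ ρ w)) =
      transferFun S σ ρ (crossAct D' hc' (transport S t) w) := by
  classical
  refine eqFun_ext_slice S (fun x hx => ?_) (fun x hx => ?_) fun x hx => transferFun_eq_zero S _ hx
  · rw [crossAct_chi, if_pos (S.proj_mem hx), crossAct_transfer hc hc' S t w hx,
      transferFun_apply S _ hx]
  · rw [crossAct_chi, if_neg hx]

theorem crossAct_transferFun (S : IsSlice D D' U A B) {t : CrossedProduct R D.Space H}
    (ht : t ∈ Subsemigroup.corner (chi R H B)) (w : eqFun X σ) :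
    crossAct D hc t (transferFun S σ ρ w) =
      transferFun S σ ρ (crossAct D' hc' (transport S t) w) := by
  rw [← chi_crossAct_transferFun hc hc', ← Module.End.mul_apply, ← map_mul,
    ((Subsemigroup.mem_corner_iff (isIdempotentElem_chi R H B)).1 ht).1]

end Slice

/-! ### The isomorphism of groupoid rings -/

section Faithful

variable {R G H X M : Type*} [CommRing R] [Group G] [Group H] [TopologicalSpace X]
  [MulAction G X] [MulAction H X] [SMulCommClass G H X] [SMulCommClass H G X]
  [AddCommGroup M] [Module R M] [ContinuousConstSMul G X] [ContinuousConstSMul H X]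
  {D : ClopenDomain G X} {D' : ClopenDomain H X} {U : Set X}
  {A : TopologicalSpace.Clopens D'.Space} {B : TopologicalSpace.Clopens D.Space}

variable (X) in
/-- The constant functions. -/
def constFun (R G M : Type*) [CommRing R] [Group G] [MulAction G X] [AddCommGroup M] [Module R M] :
    M →ₗ[R] eqFun X (Representation.trivial R G M) where
  toFun m := ⟨fun _ => m, IsLocallyConstant.const m, fun _ _ => rfl⟩
  map_add' _ _ := rfl
  map_smul' _ _ := rfl

theorem crossAct_const (D' : ClopenDomain H X) (ρ : Representation R G M)
    (s : CrossedProduct R D'.Space G) (m : M) (x : X) :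
    (crossAct D' (commute_trivial R G H M ρ) s (constFun X R H M m)).1 x =
      ∑ᶠ g : G, coeffHom g s (D'.proj x) • ρ g m :=
  crossAct_apply D' _ s _ x

/-- Acting on the constant function with value the delta function at `1` lists all coefficients of
`s`; the translation action of `G` on `G → R` thereby makes the crossed product act faithfully. -/
theorem crossAct_const_single [DecidableEq G] (D' : ClopenDomain H X)
    (s : CrossedProduct R D'.Space G) (g : G) (x : X) :
    (crossAct D' (commute_trivial R G H _ (translate G (Representation.trivial R G R))) s
      (constFun X R H _ (Pi.single 1 1))).1 x g = coeffHom g s (D'.proj x) := by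
  rw [crossAct_const]
  refine (map_finsum (LinearMap.proj (R := R) (φ := fun _ : G => R) g) ?_).trans ?_
  · exact (finite_support_coeffHom s).subset fun h hh h' => hh (by
      change coeffHom h s = 0 at h'
      change coeffHom h s (D'.proj x) • _ = 0
      rw [h', LocallyConstant.zero_apply, zero_smul])
  · have h (h : G) : (LinearMap.proj (R := R) (φ := fun _ : G => R) g)
        (coeffHom h s (D'.proj x) • translate G (Representation.trivial R G R) h (Pi.single 1 1)) =
        if h = g then coeffHom h s (D'.proj x) else 0 := by
      change coeffHom h s (D'.proj x) • (Pi.single 1 1 : G → R) (h⁻¹ • g) = _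
      rw [Pi.single_apply, smul_eq_mul, mul_ite, mul_one, mul_zero]
      exact if_congr inv_mul_eq_one rfl rfl
    simp only [h]
    rw [finsum_eq_single _ g fun h hh => if_neg hh, if_pos rfl]

/-- An element of the corner is determined by its action after the transfer. -/
theorem eq_of_transferFun (S : IsSlice D D' U A B) {s s' : CrossedProduct R D'.Space G}
    (hs : s ∈ Subsemigroup.corner (chi R G A)) (hs' : s' ∈ Subsemigroup.corner (chi R G A))
    (h : ∀ w : eqFun X (Representation.trivial R H (G → R)),
      transferFun S (Representation.trivial R H (G → R))
        (translate G (Representation.trivial R G R))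
        (crossAct D' (commute_trivial R G H _ (translate G (Representation.trivial R G R))) s w) =
      transferFun S (Representation.trivial R H (G → R))
        (translate G (Representation.trivial R G R))
        (crossAct D' (commute_trivial R G H _ (translate G (Representation.trivial R G R))) s' w)) :
    s = s' := by
  classical
  rw [mem_corner_iff] at hs hs'
  refine crossed_ext_slice S (fun g x hx => ?_)
    (fun g d hd => by_contra fun h' => hd (hs g d h').1)
    fun g d hd => by_contra fun h' => hd (hs' g d h').1
  have h1 := congrFun (congrFun (congrArg Subtype.val
    (h (constFun X R H _ (Pi.single 1 1)))) x) g
  rwa [transferFun_apply S _ hx, transferFun_apply S _ hx, crossAct_const_single,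
    crossAct_const_single] at h1

/-- No convolution is computed: through the transfer of functions both sides become the composite
action of `t` and `t'`, and elements of the corner are determined by their action. -/
theorem transport_mul (S : IsSlice D D' U A B) {t t' : CrossedProduct R D.Space H}
    (ht : t ∈ Subsemigroup.corner (chi R H B)) (ht' : t' ∈ Subsemigroup.corner (chi R H B)) :
    transport S (t * t') = transport S t * transport S t' := by
  refine eq_of_transferFun S (transport_mem_corner S _)
    (mul_mem (transport_mem_corner S t) (transport_mem_corner S t')) fun w => ?_
  rw [← crossAct_transferFun (trivial_commute R G H _ _) (commute_trivial R G H _ _) S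
    (mul_mem ht ht'), map_mul, map_mul, Module.End.mul_apply, Module.End.mul_apply,
    crossAct_transferFun (trivial_commute R G H _ _) (commute_trivial R G H _ _) S ht',
    crossAct_transferFun (trivial_commute R G H _ _) (commute_trivial R G H _ _) S ht]

/-- The isomorphism of groupoid rings given by a slice. -/
def cornerEquiv (S : IsSlice D D' U A B) : GroupoidRing R H B ≃+* GroupoidRing R G A where
  toFun t := ⟨transport S t.1, transport_mem_corner S t.1⟩
  invFun s := ⟨transport S.symm s.1, transport_mem_corner S.symm s.1⟩
  left_inv t := Subtype.ext (transport_transport S t.2)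
  right_inv s := Subtype.ext (transport_transport S.symm s.2)
  map_mul' t t' := Subtype.ext (transport_mul S t.2 t'.2)
  map_add' t t' := Subtype.ext (map_add (transport S) t.1 t'.1)

end Faithful

/-! ### The slice and the ring isomorphism of a coupling. -/

section Coupling

variable {R Λ Γ X : Type*} [CommRing R] [Group Λ] [Group Γ]
  [TopologicalSpace X] [MulAction Λ X] [MulAction Γ X]
  [SMulCommClass Λ Γ X] [SMulCommClass Γ Λ X] [ContinuousConstSMul Λ X] [ContinuousConstSMul Γ X]
  {C : TopologicalCoupling Λ Γ X}
  {A : TopologicalSpace.Clopens C.domΓ.Space} {B : TopologicalSpace.Clopens C.domΛ.Space}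

/-- The slice is `A` itself, seen inside `X_Γ ⊆ X`. It embeds into `Γ\X` as part of a fundamental
domain, and into `Λ\X` because `f` is injective on `A` and `Λ` acts freely; the image there is `B`.
-/
theorem TopologicalCoupling.IsMatching.isSlice (hAB : C.IsMatching A B) :
    IsSlice C.domΛ C.domΓ (Subtype.val '' (A : Set C.domΓ.Space)) A B where
  isClopen := by
    refine ⟨?_, ?_⟩
    · exact C.domΓ.isClopen.isClosed.isClosedEmbedding_subtypeVal.isClosedMap _ A.isClopen.isClosed
    · exact C.domΓ.isClopen.isOpen.isOpenEmbedding_subtypeVal.isOpenMap _ A.isClopen.isOpen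
  isCompact := hAB.isCompact_left.image continuous_subtype_val
  inj_left := by
    rintro l _ ⟨a, ha, rfl⟩ ⟨a', ha', h⟩
    change a'.1 = l • a.1 at h
    refine C.domΛ.eq_one_of_smul_eq (x := a.1) ?_
    rw [← h]
    refine congrArg Subtype.val (hAB.bijOn.injOn ha' ha ?_)
    change C.domΛ.proj a'.1 = C.domΛ.proj a.1
    rw [h, C.domΛ.proj_smul]
  inj_right := by
    rintro g _ ⟨a, ha, rfl⟩ ⟨a', ha', h⟩
    have h1 := C.domΓ.coc_smul g a.1
    rw [C.domΓ.coc_eq_one_iff.2 a.2, ← show a'.1 = g • a.1 from h,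
      C.domΓ.coc_eq_one_iff.2 a'.2, mul_one] at h1
    exact h1.symm
  mem_left x := by
    constructor
    · intro hx
      obtain ⟨a, ha, h⟩ := hAB.bijOn.surjOn hx
      obtain ⟨l, hl⟩ := C.domΛ.exists_smul_eq_of_proj_eq h.symm
      exact ⟨l, a, ha, hl.symm⟩
    · rintro ⟨l, a, ha, h⟩
      rw [← C.domΛ.proj_smul l, ← h]
      exact hAB.bijOn.mapsTo ha
  mem_right x := by
    constructor
    · exact fun hx => ⟨C.domΓ.toDom x, C.domΓ.proj x, hx, rfl⟩
    · rintro ⟨g, a, ha, h⟩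
      rw [← C.domΓ.proj_smul g, ← h]
      exact (congrArg (· ∈ A) (C.domΓ.proj_coe a)).mpr ha

/-- With `γ` the element bringing `l a` into `X_Γ`, the point `x = γ l a` lies in the slice and `γ⁻¹
l⁻¹ x = a` does too. So the transported coefficient of `l` at `x` is that of `γ` at the image of `x`
in `X_Λ`, which is `γ • f a`. -/
theorem TopologicalCoupling.IsMatching.induces (hAB : C.IsMatching A B) :
    C.Induces (R := R) (cornerEquiv hAB.isSlice) := by
  intro t a l ha hla
  have S := hAB.isSlice
  have hla' : C.domΓ.toDom (l • a.1) • l • a.1 ∈ (Subtype.val '' (A : Set C.domΓ.Space)) :=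
    ⟨_, hla, rfl⟩
  have h1 : l • a = C.domΓ.proj (C.domΓ.toDom (l • a.1) • l • a.1) := by
    rw [C.domΓ.proj_smul]; rfl
  change coeffHom l (transport hAB.isSlice t.1) (l • a) =
    coeffHom (C.domΓ.toDom (l • a.1)) t.1 (C.domΓ.toDom (l • a.1) • C.domΛ.proj a.1)
  rw [h1, coeffHom_transport S _ _ hla', C.domΛ.smul_proj,
    transportFun_of_mem S (h := C.domΓ.toDom (l • a.1))]
  · rw [← smul_comm l, C.domΛ.proj_smul]
  · rw [smul_comm l⁻¹, inv_smul_smul, inv_smul_smul]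
    exact ⟨a, ha, rfl⟩

end Coupling

/-! ### The tensor products as modules of functions -/

section Lift

variable {R T : Type*} [CommRing R] [Ring T]
  {N M P : Type*} [AddCommGroup N] [Module R N] [AddCommGroup M] [Module R M]
  [AddCommGroup P] [Module R P] {r : Tᵐᵒᵖ →+* Module.End R N} {l : T →+* Module.End R M}

/-- The linear map given by a balanced bilinear map. -/
def BalancedTensor.lift (b : N →ₗ[R] M →ₗ[R] P) (hb : ∀ n t m, b (r (op t) n) m = b n (l t m)) :
    BalancedTensor r l →ₗ[R] P :=
  Submodule.liftQ _ (TensorProduct.lift b) (by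
    rw [balancedRel, Submodule.span_le]
    rintro _ ⟨n, t, m, rfl⟩
    rw [SetLike.mem_coe, LinearMap.mem_ker, map_sub, TensorProduct.lift.tmul,
      TensorProduct.lift.tmul, hb, sub_self])

theorem BalancedTensor.lift_mk (b : N →ₗ[R] M →ₗ[R] P)
    (hb : ∀ n t m, b (r (op t) n) m = b n (l t m)) (n : N) (m : M) :
    BalancedTensor.lift b hb (BalancedTensor.mk r l n m) = b n m :=
  TensorProduct.lift.tmul n m

theorem BalancedTensor.induction {p : BalancedTensor r l → Prop} (z : BalancedTensor r l)
    (mk : ∀ n m, p (BalancedTensor.mk r l n m)) (add : ∀ z z', p z → p z' → p (z + z')) : p z := by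
  obtain ⟨z, rfl⟩ := Submodule.Quotient.mk_surjective _ z
  induction z using TensorProduct.induction_on with
  | zero =>
    have := mk 0 0
    rwa [BalancedTensor.mk_zero_left] at this
  | tmul n m => exact mk n m
  | add z z' h h' => exact add _ _ h h'

theorem BalancedTensor.mk_smul_left (c : R) (n : N) (m : M) :
    BalancedTensor.mk r l (c • n) m = c • BalancedTensor.mk r l n m :=
  congrArg Submodule.Quotient.mk (TensorProduct.smul_tmul' c n m).symm

theorem BalancedTensor.mk_sum_left {ι : Type*} (s : Finset ι) (n : ι → N) (m : M) :
    BalancedTensor.mk r l (∑ i ∈ s, n i) m = ∑ i ∈ s, BalancedTensor.mk r l (n i) m := by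
  classical
  induction s using Finset.induction_on with
  | empty => rw [Finset.sum_empty, Finset.sum_empty, BalancedTensor.mk_zero_left]
  | insert i s hi h => rw [Finset.sum_insert hi, Finset.sum_insert hi, BalancedTensor.mk_add_left, h]

end Lift

/-! ### Partitions of a compact space into fibres. -/

section Fibres

variable {R Y J M : Type*} [CommRing R] [TopologicalSpace Y]

variable (R) in
/-- The characteristic function of a fibre of a locally constant function. -/
def fibreFn (q : LocallyConstant Y J) (j : J) : LocallyConstant Y R :=
  LocallyConstant.charFn R (q.isLocallyConstant.isClopen_fiber j)

theorem fibreFn_apply [DecidableEq J] (q : LocallyConstant Y J) (j : J) (y : Y) :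
    fibreFn R q j y = if q y = j then 1 else 0 := by
  classical
  rw [fibreFn, LocallyConstant.coe_charFn, Set.indicator_apply]
  exact if_congr Iff.rfl rfl rfl

theorem sum_apply_locallyConstant {ι : Type*} (s : Finset ι) (f : ι → LocallyConstant Y R) (y : Y) :
    (∑ i ∈ s, f i) y = ∑ i ∈ s, f i y := by
  classical
  induction s using Finset.induction_on with
  | empty => rfl
  | insert i s hi h =>
    rw [Finset.sum_insert hi, Finset.sum_insert hi, LocallyConstant.add_apply, h]

variable [CompactSpace Y]

/-- The finite range of a locally constant function on a compact space. -/
def values (q : LocallyConstant Y J) : Finset J := q.range_finite.toFinset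

theorem mem_values (q : LocallyConstant Y J) (y : Y) : q y ∈ values q :=
  q.range_finite.mem_toFinset.2 ⟨y, rfl⟩

theorem sum_fibreFn [DecidableEq J] (q : LocallyConstant Y J) (f : J → R) (y : Y) :
    (∑ j ∈ values q, f j • fibreFn R q j) y = f (q y) := by
  rw [sum_apply_locallyConstant]
  simp only [LocallyConstant.smul_apply, fibreFn_apply, smul_eq_mul, mul_ite, mul_one, mul_zero]
  rw [Finset.sum_ite_eq, if_pos (mem_values q y)]

theorem fibreFn_map {J' : Type*} [DecidableEq J'] [DecidableEq J] (q : LocallyConstant Y J)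
    (m : J → J') (j' : J') : fibreFn R (q.map m) j' =
      ∑ j ∈ values q with m j = j', fibreFn R q j := by
  refine LocallyConstant.ext fun y => ?_
  rw [sum_apply_locallyConstant, fibreFn_apply]
  simp only [fibreFn_apply]
  rw [Finset.sum_ite_eq]
  refine if_congr ?_ rfl rfl
  rw [Finset.mem_filter, LocallyConstant.map_apply]
  exact ⟨fun h => ⟨mem_values q y, h⟩, fun h => h.2⟩

end Fibres

/-! ### `R(Y ⋊ G) ⊗_{RG} M` as the module of invariant functions. -/

section Full

variable {R G H X : Type u} [CommRing R] [Group G] [Group H] [TopologicalSpace X]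
  [MulAction G X] [MulAction H X] [SMulCommClass G H X] [SMulCommClass H G X]
  [ContinuousConstSMul G X] [ContinuousConstSMul H X] {D' : ClopenDomain H X}

variable (X H) in
/-- The invariant functions with values in a representation. -/
abbrev invFun (M : Rep.{u} R G) : Submodule R (X → M.V) := eqFun X (Representation.trivial R H M.V)

variable (D') in
/-- The module structure of the invariant functions over the crossed product. -/
abbrev invAct (M : Rep.{u} R G) : CrossedProduct R D'.Space G →+* Module.End R (invFun H X M) :=
  crossAct D' (commute_trivial R G H M.V M.ρ)

theorem repLeft_of (M : Rep.{u} R G) (g : G) (m : M.V) :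
    repLeft M (MonoidAlgebra.of R G g) m = M.ρ g m := by
  simp only [repLeft, AlgHom.toRingHom_eq_coe, RingHom.coe_coe, Representation.asAlgebraHom_of]

theorem invAct_incl (M : Rep.{u} R G) (t : MonoidAlgebra R G) (m : M.V) :
    invAct D' M (incl R D'.Space G t) (constFun X R H M.V m) =
      constFun X R H M.V (repLeft M t m) := by
  induction t using MonoidAlgebra.induction_on with
  | of g =>
    rw [crossAct_incl, repLeft_of]
    rfl
  | add a b ha hb =>
    rw [map_add, map_add, map_add, LinearMap.add_apply, LinearMap.add_apply, ha, hb, map_add]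
  | smul c a ha =>
    have h : repLeft M (c • a) m = c • repLeft M a m := by
      simp only [repLeft, AlgHom.toRingHom_eq_coe, RingHom.coe_coe, map_smul, LinearMap.smul_apply]
    rw [map_smul, crossAct_smul, ha, h, map_smul]

variable (D') in
/-- The map `s ⊗ m ↦ s · m`, where `m` is regarded as a constant function. -/
def fullMap (M : Rep.{u} R G) : FullTensor D'.Space M →ₗ[R] invFun H X M :=
  BalancedTensor.lift
    (LinearMap.mk₂ R (fun s m => invAct D' M s (constFun X R H M.V m))
      (fun s s' m => by rw [map_add, LinearMap.add_apply])
      (fun c s m => crossAct_smul D' _ c s _)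
      (fun s m m' => by rw [map_add, map_add])
      (fun c s m => by rw [map_smul, map_smul]))
    (fun s t m => by
      change invAct D' M (s * incl R D'.Space G t) _ = invAct D' M s _
      rw [map_mul, Module.End.mul_apply, invAct_incl])

theorem fullMap_mk (M : Rep.{u} R G) (s : CrossedProduct R D'.Space G) (m : M.V) :
    fullMap D' M (BalancedTensor.mk _ _ s m) = invAct D' M s (constFun X R H M.V m) :=
  BalancedTensor.lift_mk _ _ _ _

theorem fullMap_act (M : Rep.{u} R G) (s : CrossedProduct R D'.Space G)
    (z : FullTensor D'.Space M) :
    fullMap D' M (fullTensorAct D'.Space M s z) = invAct D' M s (fullMap D' M z) := by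
  induction z using BalancedTensor.induction with
  | mk s' m =>
    refine (fullMap_mk M (s * s') m).trans ?_
    rw [fullMap_mk, map_mul, Module.End.mul_apply]
  | add z z' h h' => rw [map_add, map_add, map_add, map_add, h, h']

/-- The factor `g` lies in `RG` and crosses the tensor sign, so the tensors `f ⊗ m` with `f` a
function already span. -/
theorem mk_mono (M : Rep.{u} R G) (g : G) (f : LocallyConstant D'.Space R) (m : M.V) :
    BalancedTensor.mk (fullRightGroup R G D'.Space) (repLeft M) (mono g f) m =
      BalancedTensor.mk (fullRightGroup R G D'.Space) (repLeft M) (mono 1 f) (M.ρ g m) := by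
  rw [← repLeft_of, ← BalancedTensor.mk_balanced]
  congr 1
  change _ = mono 1 f * incl R D'.Space G (MonoidAlgebra.of R G g)
  rw [incl_of, mono_mul_mono, one_mul, one_smul, mul_one]

theorem fullMap_mono_one (M : Rep.{u} R G) (f : LocallyConstant D'.Space R) (m : M.V) (x : X) :
    (fullMap D' M (BalancedTensor.mk _ _ (mono 1 f) m)).1 x = f (D'.proj x) • m := by
  rw [fullMap_mk, crossAct_mono, map_one]
  rfl

variable [CompactSpace D'.Space]

/-- The preimage of a locally constant function `m ∘ q`. -/
def fullSection (D' : ClopenDomain H X) [CompactSpace D'.Space] {J : Type*} (M : Rep.{u} R G)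
    (q : LocallyConstant D'.Space J) (m : J → M.V) : FullTensor D'.Space M :=
  ∑ j ∈ values q, BalancedTensor.mk _ _ (mono 1 (fibreFn R q j)) (m j)

theorem mono_sum {ι : Type*} (g : G) (s : Finset ι) (f : ι → LocallyConstant D'.Space R) :
    (mono g (∑ i ∈ s, f i) : CrossedProduct R D'.Space G) = ∑ i ∈ s, mono g (f i) := by
  classical
  induction s using Finset.induction_on with
  | empty => rw [Finset.sum_empty, Finset.sum_empty, mono_zero]
  | insert i s hi h => rw [Finset.sum_insert hi, Finset.sum_insert hi, mono_add, h]

/-- A fibre of `m ∘ q` is a finite disjoint union of fibres of `q`; the section may therefore be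
computed on any finer partition. -/
theorem fullSection_map {J J' : Type*} (M : Rep.{u} R G) (q : LocallyConstant D'.Space J)
    (m : J → J') (m' : J' → M.V) :
    fullSection D' M (q.map m) m' = fullSection D' M q (m' ∘ m) := by
  classical
  rw [fullSection, fullSection]
  have h (j' : J') : BalancedTensor.mk (fullRightGroup R G D'.Space) (repLeft M)
      (mono 1 (fibreFn R (q.map m) j')) (m' j') = ∑ j ∈ values q with m j = j',
        BalancedTensor.mk (fullRightGroup R G D'.Space) (repLeft M) (mono 1 (fibreFn R q j))
          (m' (m j)) := by
    rw [fibreFn_map, mono_sum, BalancedTensor.mk_sum_left]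
    refine Finset.sum_congr rfl fun j hj => ?_
    rw [(Finset.mem_filter.1 hj).2]
  simp only [h]
  refine Finset.sum_fiberwise_of_maps_to (fun j hj => ?_) _
  obtain ⟨y, rfl⟩ := q.range_finite.mem_toFinset.1 hj
  exact mem_values (q.map m) y

theorem fullSection_add {J : Type*} (M : Rep.{u} R G) (q : LocallyConstant D'.Space J)
    (m m' : J → M.V) :
    fullSection D' M q (m + m') = fullSection D' M q m + fullSection D' M q m' := by
  rw [fullSection, fullSection, fullSection, ← Finset.sum_add_distrib]
  exact Finset.sum_congr rfl fun j _ => BalancedTensor.mk_add_right _ _ _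

theorem fullSection_smul (M : Rep.{u} R G) (q : LocallyConstant D'.Space R) (m : M.V) :
    fullSection D' M q (fun r => r • m) = BalancedTensor.mk _ _ (mono 1 q) m := by
  classical
  have hq : q = ∑ r ∈ values q, r • fibreFn R q r :=
    LocallyConstant.ext fun y => (sum_fibreFn q id y).symm
  conv_rhs => rw [hq]
  rw [mono_sum, BalancedTensor.mk_sum_left]
  refine Finset.sum_congr rfl fun r _ => ?_
  rw [BalancedTensor.mk_smul_right, ← smul_mono, BalancedTensor.mk_smul_left]

theorem fullMap_fullSection {J : Type*} (M : Rep.{u} R G) (q : LocallyConstant D'.Space J)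
    (m : J → M.V) (x : X) : (fullMap D' M (fullSection D' M q m)).1 x = m (q (D'.proj x)) := by
  classical
  rw [fullSection, map_sum, AddSubmonoidClass.coe_finsetSum, Finset.sum_apply]
  simp only [fullMap_mono_one, fibreFn_apply, ite_smul, one_smul, zero_smul]
  rw [Finset.sum_ite_eq, if_pos (mem_values q _)]

/-- The function on the orbit space given by an invariant function. -/
def descend (M : Rep.{u} R G) (w : invFun H X M) : LocallyConstant D'.Space M.V :=
  ⟨fun y => w.1 y.1, w.2.1.comp_continuous continuous_subtype_val⟩

theorem descend_proj (M : Rep.{u} R G) (w : invFun H X M) (x : X) :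
    descend (D' := D') M w (D'.proj x) = w.1 x :=
  w.2.2 (D'.toDom x) x

theorem fullSection_descend_add (M : Rep.{u} R G) (w w' : invFun H X M) :
    fullSection D' M (descend M (w + w')) id =
      fullSection D' M (descend M w) id + fullSection D' M (descend M w') id := by
  -- A common refinement of the partitions belonging to `w`, `w'` and `w + w'`; on it additivity is
  -- evident.
  let q : LocallyConstant D'.Space (M.V × M.V) :=
    ⟨fun y => (w.1 y.1, w'.1 y.1),
      (descend M w).isLocallyConstant.prodMk (descend M w').isLocallyConstant⟩
  have h1 : descend M (w + w') = q.map fun p => p.1 + p.2 := rfl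
  have h2 : descend M w = q.map Prod.fst := rfl
  have h3 : descend M w' = q.map Prod.snd := rfl
  rw [h1, h2, h3, fullSection_map, fullSection_map, fullSection_map, ← fullSection_add]
  rfl

/-- Both maps are additive, so it suffices to treat `f g ⊗ m = f ⊗ g m`, where the section writes
`f` as the combination of the characteristic functions of its fibres. -/
theorem fullSection_fullMap (M : Rep.{u} R G) (z : FullTensor D'.Space M) :
    fullSection D' M (descend M (fullMap D' M z)) id = z := by
  have hs (g : G) (f : LocallyConstant D'.Space R) (m : M.V) :
      fullSection D' M (descend M (fullMap D' M (BalancedTensor.mk _ _ (mono g f) m))) id =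
        BalancedTensor.mk _ _ (mono g f) m := by
    have h : descend (D' := D') M
        (fullMap D' M (BalancedTensor.mk _ _ (mono 1 f) (M.ρ g m))) =
        f.map fun r => r • M.ρ g m :=
      LocallyConstant.ext fun y => by
        refine (fullMap_mono_one M f (M.ρ g m) y.1).trans ?_
        rw [D'.proj_coe]
        rfl
    rw [mk_mono, h, fullSection_map]
    exact fullSection_smul M f (M.ρ g m)
  induction z using BalancedTensor.induction with
  | mk s m =>
    induction s using crossed_induction with
    | zero => rw [← mono_zero (1 : G), hs]
    | single g f => exact hs g f m
    | add s s' h h' => rw [BalancedTensor.mk_add_left, map_add, fullSection_descend_add, h, h']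
  | add z z' h h' => rw [map_add, fullSection_descend_add, h, h']

variable (D') in
/-- The identification of `R(Y ⋊ G) ⊗_{RG} M` with the invariant functions. -/
def fullEquiv (M : Rep.{u} R G) : FullTensor D'.Space M ≃ₗ[R] invFun H X M :=
  LinearEquiv.ofBijective (fullMap D' M) (Function.bijective_iff_has_inverse.2
    ⟨fun w => fullSection D' M (descend M w) id, fullSection_fullMap M, fun w =>
      Subtype.ext (funext fun x => by rw [fullMap_fullSection, descend_proj]; rfl)⟩)

theorem fullEquiv_apply (M : Rep.{u} R G) (z : FullTensor D'.Space M) :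
    fullEquiv D' M z = fullMap D' M z := rfl

end Full

/-! ### `χ_A R(Y ⋊ G) ⊗_{RG} M` as the module of equivariant functions supported over `B`. -/

section Row

variable {R G H X : Type u} [CommRing R] [Group G] [Group H] [TopologicalSpace X]
  [MulAction G X] [MulAction H X] [SMulCommClass G H X] [SMulCommClass H G X]
  [ContinuousConstSMul G X] [ContinuousConstSMul H X] {D : ClopenDomain G X} {D' : ClopenDomain H X}
  {U : Set X} {A : TopologicalSpace.Clopens D'.Space} {B : TopologicalSpace.Clopens D.Space}

theorem chi_mul_row (x : rowIdeal R G A) : chi R G A * x.1 = x.1 := by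
  obtain ⟨x, s, rfl⟩ := x
  change chi R G A * (chi R G A * s) = chi R G A * s
  rw [← mul_assoc, (isIdempotentElem_chi R G A).eq]

theorem chi_mul_mem_row (s : CrossedProduct R D'.Space G) : chi R G A * s ∈ rowIdeal R G A :=
  ⟨s, rfl⟩

/-- The map from `χ_A R(Y ⋊ G) ⊗_{RG} M` to `R(Y ⋊ G) ⊗_{RG} M`. -/
def rowIncl (A : TopologicalSpace.Clopens D'.Space) (M : Rep.{u} R G) :
    RowTensor A M →ₗ[R] FullTensor D'.Space M :=
  BalancedTensor.lift
    (LinearMap.mk₂ R (fun s m => BalancedTensor.mk _ _ s.1 m)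
      (fun _ _ _ => BalancedTensor.mk_add_left _ _ _)
      (fun _ _ _ => BalancedTensor.mk_smul_left _ _ _)
      (fun _ _ _ => BalancedTensor.mk_add_right _ _ _)
      (fun _ _ _ => BalancedTensor.mk_smul_right _ _ _))
    (fun s t m => BalancedTensor.mk_balanced (r := fullRightGroup R G D'.Space) s.1 t m)

theorem rowIncl_mk (M : Rep.{u} R G) (s : rowIdeal R G A) (m : M.V) :
    rowIncl A M (BalancedTensor.mk _ _ s m) = BalancedTensor.mk _ _ s.1 m :=
  BalancedTensor.lift_mk _ _ _ _

/-- The map from `R(Y ⋊ G) ⊗_{RG} M` to `χ_A R(Y ⋊ G) ⊗_{RG} M`, `s ⊗ m ↦ χ_A s ⊗ m`. -/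
def rowProj (A : TopologicalSpace.Clopens D'.Space) (M : Rep.{u} R G) :
    FullTensor D'.Space M →ₗ[R] RowTensor A M :=
  BalancedTensor.lift
    (LinearMap.mk₂ R (fun s m => BalancedTensor.mk _ _ ⟨chi R G A * s, chi_mul_mem_row s⟩ m)
      (fun s s' m => by
        rw [← BalancedTensor.mk_add_left]; congr 1; exact Subtype.ext (mul_add _ _ _))
      (fun c s m => by
        rw [← BalancedTensor.mk_smul_left]; congr 1; exact Subtype.ext (mul_smul_comm _ _ _))
      (fun _ _ _ => BalancedTensor.mk_add_right _ _ _)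
      (fun _ _ _ => BalancedTensor.mk_smul_right _ _ _))
    (fun s t m => by
      refine Eq.trans ?_ (BalancedTensor.mk_balanced (r := rowRightGroup R G A) _ t m)
      change BalancedTensor.mk _ _ _ _ = BalancedTensor.mk _ _ _ _
      congr 1
      exact Subtype.ext (mul_assoc _ _ _).symm)

theorem rowProj_mk (M : Rep.{u} R G) (s : CrossedProduct R D'.Space G) (m : M.V) :
    rowProj A M (BalancedTensor.mk _ _ s m) =
      BalancedTensor.mk _ _ ⟨chi R G A * s, chi_mul_mem_row s⟩ m :=
  BalancedTensor.lift_mk _ _ _ _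

theorem rowProj_rowIncl (M : Rep.{u} R G) (z : RowTensor A M) : rowProj A M (rowIncl A M z) = z := by
  induction z using BalancedTensor.induction with
  | mk s m =>
    rw [rowIncl_mk, rowProj_mk]
    congr 1
    exact Subtype.ext (chi_mul_row s)
  | add z z' h h' => rw [map_add, map_add, h, h']

/-- Together with `rowProj_rowIncl` this exhibits the tensor product with the right ideal as the
range of the idempotent `χ_A` on the full tensor product. -/
theorem rowIncl_rowProj (M : Rep.{u} R G) (z : FullTensor D'.Space M) :
    rowIncl A M (rowProj A M z) = fullTensorAct D'.Space M (chi R G A) z := by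
  induction z using BalancedTensor.induction with
  | mk s m =>
    rw [rowProj_mk, rowIncl_mk]
    rfl
  | add z z' h h' => rw [map_add, map_add, map_add, h, h']

theorem rowIncl_act (M : Rep.{u} R G) (t : GroupoidRing R G A) (z : RowTensor A M) :
    rowIncl A M (rowTensorAct A M t z) = fullTensorAct D'.Space M t.1 (rowIncl A M z) := by
  induction z using BalancedTensor.induction with
  | mk s m => rfl
  | add z z' h h' => rw [map_add, map_add, map_add, map_add, h, h']

theorem fullTensorAct_rowIncl (M : Rep.{u} R G) (z : RowTensor A M) :
    fullTensorAct D'.Space M (chi R G A) (rowIncl A M z) = rowIncl A M z := by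
  rw [← rowIncl_rowProj, rowProj_rowIncl]

/-- The module structure of the equivariant functions over the crossed product. -/
abbrev covAct (D : ClopenDomain G X) (H : Type u) [Group H] [MulAction H X] [SMulCommClass G H X]
    [ContinuousConstSMul H X] (M : Rep.{u} R G) :
    CrossedProduct R D.Space H →+* Module.End R (eqFun X M.ρ) :=
  crossAct D (trivial_commute R G H M.V M.ρ)

/-- The transfer of the functions given by elements of `χ_A R(Y ⋊ G) ⊗_{RG} M`. -/
def rowEval (S : IsSlice D D' U A B) (M : Rep.{u} R G) : RowTensor A M →ₗ[R] eqFun X M.ρ :=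
  transferFun S (Representation.trivial R H M.V) M.ρ ∘ₗ fullMap D' M ∘ₗ rowIncl A M

theorem rowEval_mk (S : IsSlice D D' U A B) (M : Rep.{u} R G) (s : rowIdeal R G A) (m : M.V) :
    rowEval S M (BalancedTensor.mk _ _ s m) = transferFun S (Representation.trivial R H M.V) M.ρ
      (invAct D' M s.1 (constFun X R H M.V m)) := by
  change transferFun S _ _ (fullMap D' M (rowIncl A M _)) = _
  rw [rowIncl_mk, fullMap_mk]

/-- Semilinearity of the transfer: restriction along the ring isomorphism becomes the evident action
on equivariant functions. -/
theorem rowEval_act (S : IsSlice D D' U A B) (M : Rep.{u} R G) (t : GroupoidRing R H B)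
    (z : RowTensor A M) :
    rowEval S M (rowTensorAct A M (cornerEquiv S t) z) = covAct D H M t.1 (rowEval S M z) := by
  change transferFun S _ _ (fullMap D' M (rowIncl A M _)) = _
  rw [rowIncl_act, fullMap_act]
  exact (crossAct_transferFun _ _ S t.2 _).symm

theorem rowEval_chi (S : IsSlice D D' U A B) (M : Rep.{u} R G) (z : RowTensor A M) :
    covAct D H M (chi R H B) (rowEval S M z) = rowEval S M z :=
  crossAct_chi_transferFun _ S _

theorem rowEval_eq_zero (S : IsSlice D D' U A B) (M : Rep.{u} R G) (z : RowTensor A M) {x : X}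
    (hx : D.proj x ∉ B) : (rowEval S M z).1 x = 0 :=
  transferFun_eq_zero S _ hx

/-- Both transfers keep the values on the slice, and these determine an equivariant function that
vanishes off the orbits of the slice. -/
theorem transferFun_symm (S : IsSlice D D' U A B) (M : Rep.{u} R G) {w : invFun H X M}
    (hw : invAct D' M (chi R G A) w = w) :
    transferFun S.symm M.ρ (Representation.trivial R H M.V)
      (transferFun S (Representation.trivial R H M.V) M.ρ w) = w := by
  classical
  refine eqFun_ext_slice S.symm (fun x hx => ?_) (fun x hx => transferFun_eq_zero S.symm _ hx)
    fun x hx => ?_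
  · rw [transferFun_apply S.symm _ hx, transferFun_apply S _ hx]
  · rw [← hw, crossAct_chi, if_neg hx]

theorem transferFun_symm' (S : IsSlice D D' U A B) (M : Rep.{u} R G) {f : eqFun X M.ρ}
    (hf : covAct D H M (chi R H B) f = f) :
    transferFun S (Representation.trivial R H M.V) M.ρ
      (transferFun S.symm M.ρ (Representation.trivial R H M.V) f) = f := by
  classical
  refine eqFun_ext_slice S (fun x hx => ?_) (fun x hx => transferFun_eq_zero S _ hx)
    fun x hx => ?_
  · rw [transferFun_apply S _ hx, transferFun_apply S.symm _ hx]
  · rw [← hf, crossAct_chi, if_neg hx]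

theorem rowEval_injective [CompactSpace D'.Space] (S : IsSlice D D' U A B) (M : Rep.{u} R G) :
    Function.Injective (rowEval S M) := by
  refine Function.LeftInverse.injective (g := fun f => rowProj A M ((fullEquiv D' M).symm
    (transferFun S.symm M.ρ (Representation.trivial R H M.V) f))) fun z => ?_
  change rowProj A M ((fullEquiv D' M).symm (transferFun S.symm _ _ (transferFun S _ _
    (fullMap D' M (rowIncl A M z))))) = z
  rw [transferFun_symm S M]
  · rw [← fullEquiv_apply, LinearEquiv.symm_apply_apply, rowProj_rowIncl]
  · rw [← fullMap_act, fullTensorAct_rowIncl]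

theorem exists_rowEval_eq [CompactSpace D'.Space] (S : IsSlice D D' U A B) (M : Rep.{u} R G)
    {f : eqFun X M.ρ} (hf : covAct D H M (chi R H B) f = f) : ∃ z, rowEval S M z = f := by
  refine ⟨rowProj A M ((fullEquiv D' M).symm
    (transferFun S.symm M.ρ (Representation.trivial R H M.V) f)), ?_⟩
  change transferFun S _ _ (fullMap D' M (rowIncl A M _)) = f
  rw [rowIncl_rowProj, fullMap_act, ← fullEquiv_apply, LinearEquiv.apply_symm_apply,
    crossAct_chi_transferFun _ S.symm, transferFun_symm' S M hf]

/-- The functions supported over `B`. -/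
def fixedFun (B : TopologicalSpace.Clopens D.Space) (H : Type u) [Group H] [MulAction H X]
    [SMulCommClass G H X] [ContinuousConstSMul H X] (M : Rep.{u} R G) :
    Submodule R (eqFun X M.ρ) :=
  LinearMap.eqLocus (covAct D H M (chi R H B)) LinearMap.id

theorem mem_fixedFun {M : Rep.{u} R G} {f : eqFun X M.ρ} :
    f ∈ fixedFun B H M ↔ covAct D H M (chi R H B) f = f := Iff.rfl

/-- The identification of `χ_A R(Y ⋊ G) ⊗_{RG} M` with the functions supported over `B`. -/
def rowEquiv [CompactSpace D'.Space] (S : IsSlice D D' U A B) (M : Rep.{u} R G) :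
    RowTensor A M ≃ₗ[R] fixedFun B H M :=
  LinearEquiv.ofBijective ((rowEval S M).codRestrict _ (rowEval_chi S M))
    ⟨fun _ _ h => rowEval_injective S M (congrArg Subtype.val h), fun f => by
      obtain ⟨z, hz⟩ := exists_rowEval_eq S M f.2
      exact ⟨z, Subtype.ext hz⟩⟩

theorem rowEval_rowEquiv_symm [CompactSpace D'.Space] (S : IsSlice D D' U A B) (M : Rep.{u} R G)
    (f : fixedFun B H M) : rowEval S M ((rowEquiv S M).symm f) = f.1 :=
  congrArg Subtype.val ((rowEquiv S M).apply_symm_apply f)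

/-- The map of equivariant functions given by a map of representations. -/
def eqFunMap {K : Type u} [Group K] {V W : Type u} [AddCommGroup V] [Module R V] [AddCommGroup W]
    [Module R W] [MulAction K X] {ρ : Representation R K V} {ρ' : Representation R K W}
    (f : V →ₗ[R] W) (hf : ∀ k v, f (ρ k v) = ρ' k (f v)) : eqFun X ρ →ₗ[R] eqFun X ρ' where
  toFun h := ⟨fun x => f (h.1 x), h.2.1.comp f, fun k x => by simp only [h.2.2, hf]⟩
  map_add' h h' := Subtype.ext (funext fun x => map_add f _ _)
  map_smul' c h := Subtype.ext (funext fun x => map_smul f _ _)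

variable (X) in
/-- The map of equivariant functions given by a map of representations. -/
abbrev covMap {M M' : Rep.{u} R G} (f : M ⟶ M') : eqFun X M.ρ →ₗ[R] eqFun X M'.ρ :=
  eqFunMap f.hom.toLinearMap fun g v => Rep.hom_comm_apply f g v

variable (H X) in
/-- The map of invariant functions given by a map of representations. -/
abbrev invMap {M M' : Rep.{u} R G} (f : M ⟶ M') : invFun H X M →ₗ[R] invFun H X M' :=
  eqFunMap f.hom.toLinearMap fun _ _ => rfl

theorem invAct_invMap {M M' : Rep.{u} R G} (f : M ⟶ M') (s : CrossedProduct R D'.Space G)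
    (w : invFun H X M) : invMap H X f (invAct D' M s w) = invAct D' M' s (invMap H X f w) := by
  induction s using crossed_induction with
  | zero => rw [map_zero, map_zero, LinearMap.zero_apply, LinearMap.zero_apply, map_zero]
  | add s s' h h' =>
    rw [map_add, map_add, LinearMap.add_apply, LinearMap.add_apply, map_add, h, h']
  | single g φ =>
    refine Subtype.ext (funext fun x => ?_)
    rw [crossAct_mono]
    change f.hom.toLinearMap ((invAct D' M (mono g φ) w).1 x) = _
    rw [crossAct_mono, map_smul]
    congr 1
    exact Rep.hom_comm_apply f g _

theorem covAct_covMap {M M' : Rep.{u} R G} (f : M ⟶ M') (s : CrossedProduct R D.Space H)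
    (w : eqFun X M.ρ) : covMap X f (covAct D H M s w) = covAct D H M' s (covMap X f w) := by
  induction s using crossed_induction with
  | zero => rw [map_zero, map_zero, LinearMap.zero_apply, LinearMap.zero_apply, map_zero]
  | add s s' h h' =>
    rw [map_add, map_add, LinearMap.add_apply, LinearMap.add_apply, map_add, h, h']
  | single g φ =>
    refine Subtype.ext (funext fun x => ?_)
    rw [crossAct_mono]
    change f.hom.toLinearMap ((covAct D H M (mono g φ) w).1 x) = _
    rw [crossAct_mono, map_smul]
    rfl

theorem fullMap_naturality {M M' : Rep.{u} R G} (f : M ⟶ M') (z : FullTensor D'.Space M) :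
    fullMap D' M' (((extRes R G D'.Space).map f).hom.toLinearMap z) =
      invMap H X f (fullMap D' M z) := by
  induction z using BalancedTensor.induction with
  | mk s m =>
    refine (fullMap_mk M' s (f.hom.toLinearMap m)).trans ?_
    rw [fullMap_mk, invAct_invMap]
    rfl
  | add z z' h h' =>
    refine (congrArg (fullMap D' M') (map_add _ z z')).trans ?_
    rw [map_add, map_add, map_add, ← h, ← h']
    rfl

theorem transferFun_naturality (S : IsSlice D D' U A B) {M M' : Rep.{u} R G} (f : M ⟶ M')
    (w : invFun H X M) :
    transferFun S (Representation.trivial R H M'.V) M'.ρ (invMap H X f w) =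
      covMap X f (transferFun S (Representation.trivial R H M.V) M.ρ w) := by
  refine eqFun_ext_slice S (fun x hx => ?_) (fun x hx => transferFun_eq_zero S _ hx)
    fun x hx => ?_
  · rw [transferFun_apply S _ hx]
    change _ = f.hom.toLinearMap ((transferFun S _ _ w).1 x)
    rw [transferFun_apply S _ hx]
    rfl
  · change f.hom.toLinearMap ((transferFun S _ _ w).1 x) = 0
    rw [transferFun_eq_zero S _ hx, map_zero]

theorem rowEval_naturality (S : IsSlice D D' U A B) {M M' : Rep.{u} R G} (f : M ⟶ M')
    (z : RowTensor A M) : rowEval S M' (rowTensorMap A f z) = covMap X f (rowEval S M z) := by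
  induction z using BalancedTensor.induction with
  | mk s m =>
    refine (rowEval_mk S M' s (f.hom.toLinearMap m)).trans ?_
    rw [rowEval_mk, ← transferFun_naturality, invAct_invMap]
    rfl
  | add z z' h h' => rw [map_add, map_add, map_add, map_add, h, h']

end Row

/-! ### The induced module for homology -/

section Lower

variable {R G H X : Type u} [CommRing R] [Group G] [Group H] [TopologicalSpace X]
  [MulAction G X] [MulAction H X] [SMulCommClass G H X] [SMulCommClass H G X]
  [ContinuousConstSMul G X] [ContinuousConstSMul H X] {D : ClopenDomain G X} {D' : ClopenDomain H X}
  {U : Set X} {A : TopologicalSpace.Clopens D'.Space} {B : TopologicalSpace.Clopens D.Space}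

theorem crossAct_mem_eqFunC (M : Rep.{u} R G) (s : CrossedProduct R D.Space H) {f : eqFun X M.ρ}
    (hf : f.1 ∈ eqFunC X M.ρ) : (covAct D H M s f).1 ∈ eqFunC X M.ρ := by
  induction s using crossed_induction with
  | zero => rw [map_zero]; exact zero_mem _
  | add s s' h h' => rw [map_add]; exact add_mem h h'
  | single h φ =>
    obtain ⟨-, K, hK, hfK⟩ := translate_mem_eqFunC M.ρ _ (trivial_commute R G H M.V M.ρ) h hf
    refine ⟨(covAct D H M (mono h φ) f).2, K, hK, fun x hx => hfK x fun h' => hx ?_⟩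
    rw [crossAct_mono]
    exact (congrArg _ h').trans (smul_zero _)

theorem rowEval_mem_eqFunC (S : IsSlice D D' U A B) (M : Rep.{u} R G) (z : RowTensor A M) :
    (rowEval S M z).1 ∈ eqFunC X M.ρ :=
  (transfer S _ _ _).2

/-- The map `s ⊗ z ↦ s · z` into the equivariant functions. -/
def lowerMap (S : IsSlice D D' U A B) (M : Rep.{u} R G) :
    IndLower (cornerEquiv S).toRingHom M →ₗ[R] eqFun X M.ρ :=
  BalancedTensor.lift
    (LinearMap.mk₂ R (fun s z => covAct D H M s.1 (rowEval S M z))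
      (fun s s' z => by
        change covAct D H M (s.1 + s'.1) _ = _
        rw [map_add, LinearMap.add_apply])
      (fun c s z => crossAct_smul D _ c s.1 _)
      (fun s z z' => by rw [map_add, map_add])
      (fun c s z => by rw [map_smul, map_smul]))
    (fun s t z => by
      change covAct D H M (s.1 * t.1) _ = covAct D H M s.1 _
      rw [map_mul, Module.End.mul_apply]
      exact congrArg _ (rowEval_act S M t z).symm)

theorem lowerMap_mk (S : IsSlice D D' U A B) (M : Rep.{u} R G) (s : colIdeal R H B)
    (z : RowTensor A M) :
    lowerMap S M (BalancedTensor.mk _ _ s z) = covAct D H M s.1 (rowEval S M z) :=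
  BalancedTensor.lift_mk _ _ _ _

theorem lowerMap_mem_eqFunC (S : IsSlice D D' U A B) (M : Rep.{u} R G)
    (z : IndLower (cornerEquiv S).toRingHom M) : (lowerMap S M z).1 ∈ eqFunC X M.ρ := by
  induction z using BalancedTensor.induction with
  | mk s z => rw [lowerMap_mk]; exact crossAct_mem_eqFunC M _ (rowEval_mem_eqFunC S M z)
  | add z z' h h' => rw [map_add]; exact add_mem h h'

/-- The left action of the crossed product on the induced module. -/
abbrev lowerAct (S : IsSlice D D' U A B) (M : Rep.{u} R G) :
    CrossedProduct R D.Space H →+* Module.End R (IndLower (cornerEquiv S).toRingHom M) :=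
  BalancedTensor.leftAction _ _ (colLeft B) (fun t' _ n => Subtype.ext (mul_assoc t' n.1 _).symm)

theorem lowerMap_act (S : IsSlice D D' U A B) (M : Rep.{u} R G) (s : CrossedProduct R D.Space H)
    (z : IndLower (cornerEquiv S).toRingHom M) :
    lowerMap S M (lowerAct S M s z) = covAct D H M s (lowerMap S M z) := by
  induction z using BalancedTensor.induction with
  | mk s' z =>
    refine (lowerMap_mk S M _ z).trans ?_
    rw [lowerMap_mk, ← Module.End.mul_apply, ← map_mul]
    rfl
  | add z z' h h' => rw [map_add, map_add, map_add, map_add, h, h']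

theorem lowerMap_naturality (S : IsSlice D D' U A B) {M M' : Rep.{u} R G} (f : M ⟶ M')
    (z : IndLower (cornerEquiv S).toRingHom M) :
    lowerMap S M' (indLowerMap (cornerEquiv S).toRingHom f z) = covMap X f (lowerMap S M z) := by
  induction z using BalancedTensor.induction with
  | mk s z =>
    refine (lowerMap_mk S M' _ _).trans ?_
    rw [lowerMap_mk, covAct_covMap, ← rowEval_naturality]
    rfl
  | add z z' h h' => rw [map_add, map_add, map_add, map_add, h, h']

theorem mul_chi_of_support {s : CrossedProduct R D.Space H}
    (hs : ∀ h y, coeffHom h s y ≠ 0 → h⁻¹ • y ∈ B) : s * chi R H B = s := by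
  classical
  refine crossed_ext fun h y => ?_
  rw [coeffHom_mul_chi, ite_eq_left_iff]
  exact fun hy => by_contra fun h' => hy (hs h y (Ne.symm h'))

theorem coeffHom_mono_ne_zero {h h' : H} {φ : LocallyConstant D.Space R} {y : D.Space}
    (hy : coeffHom h' (mono h φ) y ≠ 0) : h = h' ∧ φ y ≠ 0 := by
  classical
  rw [coeffHom_mono] at hy
  split_ifs at hy with h1
  · exact ⟨h1, hy⟩
  · exact (hy rfl).elim

theorem mul_chi_eq (s : colIdeal R H B) : s.1 * chi R H B = s.1 := by
  obtain ⟨s, x, rfl⟩ := s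
  change x * chi R H B * chi R H B = x * chi R H B
  rw [mul_assoc, (isIdempotentElem_chi R H B).eq]

theorem chi_mul_mul_mem (s : colIdeal R H B) (s' : CrossedProduct R D.Space H) :
    chi R H B * s' * s.1 ∈ Subsemigroup.corner (chi R H B : CrossedProduct R D.Space H) := by
  rw [Subsemigroup.mem_corner_iff (isIdempotentElem_chi R H B)]
  constructor
  · rw [← mul_assoc, ← mul_assoc, (isIdempotentElem_chi R H B).eq]
  · rw [mul_assoc, mul_chi_eq]

variable [CompactSpace D'.Space]

/-- The map `s ⊗ z ↦ (χ_B h⁻¹ s) z`. -/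
def lowerCut (S : IsSlice D D' U A B) (M : Rep.{u} R G) (h : H) :
    IndLower (cornerEquiv S).toRingHom M →ₗ[R] RowTensor A M :=
  (rowEquiv S M).symm.toLinearMap ∘ₗ
    ((covAct D H M (chi R H B * mono h⁻¹ 1)).codRestrict (fixedFun B H M) (fun f => by
      rw [mem_fixedFun, ← Module.End.mul_apply, ← map_mul, ← mul_assoc,
        (isIdempotentElem_chi R H B).eq])) ∘ₗ lowerMap S M

theorem rowEval_lowerCut (S : IsSlice D D' U A B) (M : Rep.{u} R G) (h : H)
    (z : IndLower (cornerEquiv S).toRingHom M) :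
    rowEval S M (lowerCut S M h z) = covAct D H M (chi R H B * mono h⁻¹ 1) (lowerMap S M z) :=
  rowEval_rowEquiv_symm S M _

/-- The product `χ_B h⁻¹ s` lies in the corner and so acts on `z` before any induction. By its
definition `lowerCut` depends only on the image under `lowerMap`; by this formula it is algebraic in
`s ⊗ z`. Injectivity of `lowerMap` comes from playing the two off against each other. -/
theorem lowerCut_mk (S : IsSlice D D' U A B) (M : Rep.{u} R G) (h : H) (s : colIdeal R H B)
    (z : RowTensor A M) : lowerCut S M h (BalancedTensor.mk _ _ s z) =
      rowTensorAct A M (cornerEquiv S ⟨_, chi_mul_mul_mem s (mono h⁻¹ 1)⟩) z := by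
  refine rowEval_injective S M ?_
  refine Eq.trans ?_ (rowEval_act S M _ z).symm
  rw [rowEval_lowerCut, lowerMap_mk, ← Module.End.mul_apply, ← map_mul]

theorem mono_mem_col {h : H} {φ : LocallyConstant D.Space R} (hφ : ∀ y, φ y ≠ 0 → h⁻¹ • y ∈ B) :
    (mono h φ : CrossedProduct R D.Space H) ∈ colIdeal R H B :=
  ⟨mono h φ, mul_chi_of_support fun h' y hy => by
    obtain ⟨rfl, h2⟩ := coeffHom_mono_ne_zero hy
    exact hφ y h2⟩

/-- For `φ` supported in `h B` one has `φ s = (φ h)(χ_B h⁻¹ s)`; the second factor is in the corner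
and crosses the tensor sign. -/
theorem lowerAct_mono_one (S : IsSlice D D' U A B) (M : Rep.{u} R G) {h : H}
    {φ : LocallyConstant D.Space R} (hφ : ∀ y, φ y ≠ 0 → h⁻¹ • y ∈ B)
    (z : IndLower (cornerEquiv S).toRingHom M) :
    lowerAct S M (mono 1 φ) z = BalancedTensor.mk _ _ ⟨mono h φ, mono_mem_col hφ⟩
      (lowerCut S M h z) := by
  induction z using BalancedTensor.induction with
  | mk s z =>
    rw [lowerCut_mk]
    refine Eq.trans ?_ (BalancedTensor.mk_balanced (r := colRight (R := R) (G := H) B)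
      (l := (rowTensorAct A M).comp (cornerEquiv S).toRingHom) _
      ⟨_, chi_mul_mul_mem s (mono h⁻¹ 1)⟩ z)
    refine (BalancedTensor.leftAction_mk _ _ _ _ _).trans ?_
    congr 1
    refine Subtype.ext ?_
    change mono 1 φ * s.1 = mono h φ * (chi R H B * mono h⁻¹ 1 * s.1)
    rw [← mul_assoc, ← mul_assoc, mul_chi_eq ⟨mono h φ, mono_mem_col hφ⟩, mono_mul_mono,
      mul_inv_cancel, smul_one, mul_one]
  | add z z' h h' => rw [map_add, map_add, h, h', BalancedTensor.mk_add_right]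

/-- Multiplying by the characteristic function of `h B` and by its complement peels one translate
off the cover. -/
theorem split_support (B : TopologicalSpace.Clopens D.Space) [DecidableEq H] {F : Finset H} {h : H}
    {φ : LocallyConstant D.Space R} (hφ : ∀ y, φ y ≠ 0 → ∃ k ∈ insert h F, k⁻¹ • y ∈ B) :
    ∃ φ₁ φ₂ : LocallyConstant D.Space R, φ = φ₁ + φ₂ ∧ (∀ y, φ₁ y ≠ 0 → h⁻¹ • y ∈ B) ∧
      ∀ y, φ₂ y ≠ 0 → ∃ k ∈ F, k⁻¹ • y ∈ B := by
  classical
  let χ : LocallyConstant D.Space R := h • LocallyConstant.charFn R B.isClopen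
  have hχ (y : D.Space) : χ y = if h⁻¹ • y ∈ B then 1 else 0 := by
    rw [← charFn_apply]
    rfl
  refine ⟨φ * χ, φ * (1 - χ), by ring, fun y hy => ?_, fun y hy => ?_⟩
  · by_contra h'
    rw [LocallyConstant.mul_apply, hχ, if_neg h', mul_zero] at hy
    exact hy rfl
  · rw [LocallyConstant.mul_apply, LocallyConstant.sub_apply, hχ, LocallyConstant.one_apply] at hy
    obtain ⟨k, hk, hky⟩ := hφ y fun h' => hy (by rw [h', zero_mul])
    rcases Finset.mem_insert.1 hk with rfl | hk
    · rw [if_pos hky, sub_self, mul_zero] at hy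
      exact (hy rfl).elim
    · exact ⟨k, hk, hky⟩

/-- After `φ` is split along the translates of `B`, each piece acts through some `lowerCut`, and
these vanish with `lowerMap S M z`. -/
theorem lowerAct_eq_zero (S : IsSlice D D' U A B) (M : Rep.{u} R G)
    {z : IndLower (cornerEquiv S).toRingHom M} (hz : lowerMap S M z = 0) (F : Finset H)
    {φ : LocallyConstant D.Space R} (hφ : ∀ y, φ y ≠ 0 → ∃ k ∈ F, k⁻¹ • y ∈ B) :
    lowerAct S M (mono 1 φ) z = 0 := by
  classical
  induction F using Finset.induction_on generalizing φ with
  | empty =>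
    have : φ = 0 := LocallyConstant.ext fun y => by
      by_contra h
      obtain ⟨k, hk, -⟩ := hφ y h
      exact absurd hk (Finset.notMem_empty k)
    rw [this, mono_zero, map_zero, LinearMap.zero_apply]
  | insert h F _ ih =>
    obtain ⟨φ₁, φ₂, rfl, h1, h2⟩ := split_support B hφ
    rw [mono_add, map_add, LinearMap.add_apply, ih h2, add_zero, lowerAct_mono_one S M h1]
    have : lowerCut S M h z = 0 :=
      rowEval_injective S M (by rw [rowEval_lowerCut, hz, map_zero, map_zero])
    rw [this]
    exact Submodule.Quotient.mk_eq_zero _ |>.2 (by rw [TensorProduct.tmul_zero]; exact zero_mem _)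

/-- Local units: because `s = s χ_B`, the coefficient of `h` in `s` is supported in `h B`, and only
finitely many `h` occur. -/
theorem exists_lowerAct_eq_self (S : IsSlice D D' U A B) (M : Rep.{u} R G)
    (z : IndLower (cornerEquiv S).toRingHom M) : ∃ F : Finset H,
      ∀ φ : LocallyConstant D.Space R, (∀ y, ∀ k ∈ F, k⁻¹ • y ∈ B → φ y = 1) →
        lowerAct S M (mono 1 φ) z = z := by
  classical
  induction z using BalancedTensor.induction with
  | mk s z =>
    refine ⟨(finite_support_coeffHom s.1).toFinset, fun φ hφ => ?_⟩
    refine (BalancedTensor.leftAction_mk _ _ _ _ _).trans ?_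
    congr 1
    refine Subtype.ext (crossed_ext fun h y => ?_)
    change coeffHom h (mono 1 φ * s.1) y = _
    rw [coeffHom_mono_one_mul, LocallyConstant.mul_apply]
    by_cases hy : coeffHom h s.1 y = 0
    · rw [hy, mul_zero]
    · rw [hφ y h, one_mul]
      · refine (Set.Finite.mem_toFinset _).2 fun h' => hy ?_
        change coeffHom h s.1 = 0 at h'
        rw [h', LocallyConstant.zero_apply]
      · rw [← mul_chi_eq s, coeffHom_mul_chi] at hy
        by_contra h'
        rw [if_neg h'] at hy
        exact hy rfl
  | add z z' h h' =>
    obtain ⟨F, hF⟩ := h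
    obtain ⟨F', hF'⟩ := h'
    refine ⟨F ∪ F', fun φ hφ => ?_⟩
    rw [map_add, hF φ fun y k hk => hφ y k (Finset.mem_union_left _ hk),
      hF' φ fun y k hk => hφ y k (Finset.mem_union_right _ hk)]

theorem exists_cover (R : Type u) [CommRing R] (B : TopologicalSpace.Clopens D.Space)
    (F : Finset H) : ∃ φ : LocallyConstant D.Space R,
      (∀ y, ∀ k ∈ F, k⁻¹ • y ∈ B → φ y = 1) ∧ ∀ y, φ y ≠ 0 → ∃ k ∈ F, k⁻¹ • y ∈ B := by
  have hV : IsClopen (⋃ k ∈ F, {y : D.Space | k⁻¹ • y ∈ B}) :=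
    F.finite_toSet.isClopen_biUnion fun k _ => B.isClopen.preimage (continuous_const_smul k⁻¹)
  refine ⟨LocallyConstant.charFn R hV, fun y k hk hy => ?_, fun y hy => ?_⟩
  · rw [LocallyConstant.coe_charFn]
    exact Set.indicator_of_mem (Set.mem_biUnion (s := (F : Set H)) hk hy) _
  · rw [LocallyConstant.coe_charFn] at hy
    obtain ⟨k, hk, h⟩ := Set.mem_iUnion₂.1 (Set.mem_of_indicator_ne_zero hy)
    exact ⟨k, hk, h⟩

/-- A function equal to `1` on finitely many translates of `B` and supported in them fixes `z`, yet
sends every element of the kernel to zero. -/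
theorem lowerMap_injective (S : IsSlice D D' U A B) (M : Rep.{u} R G) :
    Function.Injective (lowerMap S M) := by
  classical
  refine (injective_iff_map_eq_zero _).2 fun z hz => ?_
  obtain ⟨F, hF⟩ := exists_lowerAct_eq_self S M z
  obtain ⟨φ, h1, h2⟩ := exists_cover R B F
  rw [← hF φ h1]
  exact lowerAct_eq_zero S M hz F h2

theorem mem_range_lowerMap (S : IsSlice D D' U A B) (M : Rep.{u} R G) (F : Finset H)
    {f : eqFun X M.ρ} (φ : LocallyConstant D.Space R)
    (hφ : ∀ y, φ y ≠ 0 → ∃ k ∈ F, k⁻¹ • y ∈ B) :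
    covAct D H M (mono 1 φ) f ∈ LinearMap.range (lowerMap S M) := by
  classical
  induction F using Finset.induction_on generalizing φ with
  | empty =>
    have : φ = 0 := LocallyConstant.ext fun y => by
      by_contra h
      obtain ⟨k, hk, -⟩ := hφ y h
      exact absurd hk (Finset.notMem_empty k)
    rw [this, mono_zero, map_zero]
    exact zero_mem _
  | insert h F _ ih =>
    obtain ⟨φ₁, φ₂, rfl, h1, h2⟩ := split_support B hφ
    rw [mono_add, map_add, LinearMap.add_apply]
    refine add_mem ?_ (ih φ₂ h2)
    -- The part of `f` over `h B` is moved to `B`, where it comes from the row tensor product, and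
    -- then moved back: `φ₁ f = (φ₁ h)(χ_B h⁻¹ f)`.
    obtain ⟨z, hz⟩ := exists_rowEval_eq S M (f := covAct D H M (chi R H B * mono h⁻¹ 1) f) (by
      rw [← Module.End.mul_apply, ← map_mul, ← mul_assoc, (isIdempotentElem_chi R H B).eq])
    refine ⟨BalancedTensor.mk _ _ ⟨mono h φ₁, mono_mem_col h1⟩ z, ?_⟩
    rw [lowerMap_mk, hz, ← Module.End.mul_apply, ← map_mul, ← mul_assoc,
      mul_chi_eq ⟨mono h φ₁, mono_mem_col h1⟩, mono_mul_mono, mul_inv_cancel, smul_one, mul_one]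

theorem exists_lowerMap_eq (S : IsSlice D D' U A B) (hB : ∀ y : D.Space, ∃ h : H, h • y ∈ B)
    (M : Rep.{u} R G) {f : eqFun X M.ρ} (hf : f.1 ∈ eqFunC X M.ρ) : ∃ z, lowerMap S M z = f := by
  classical
  obtain ⟨-, K, hK, hfK⟩ := hf
  -- The translates of `B` cover the orbit space since `B` meets every orbit; compact support modulo
  -- the group leaves finitely many.
  obtain ⟨F, hF⟩ := (hK.image D.continuous_proj).elim_finite_subcover
    (fun k : H => {y : D.Space | k⁻¹ • y ∈ B})
    (fun k => (B.isClopen.preimage (continuous_const_smul k⁻¹)).isOpen) fun y _ => by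
      obtain ⟨k, hk⟩ := hB y
      exact Set.mem_iUnion.2 ⟨k⁻¹, by rwa [Set.mem_ofPred_eq, inv_inv]⟩
  obtain ⟨φ, h1, h2⟩ := exists_cover R B F
  have h := mem_range_lowerMap S M F (f := f) φ h2
  have h' : covAct D H M (mono 1 φ) f = f := by
    refine Subtype.ext (funext fun x => ?_)
    rw [crossAct_mono, map_one, inv_one, one_smul, Module.End.one_apply]
    by_cases hx : f.1 x = 0
    · rw [hx, smul_zero]
    · obtain ⟨g, hg⟩ := hfK x hx
      have h3 : D.proj x ∈ D.proj '' K := ⟨_, hg, D.proj_smul g x⟩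
      obtain ⟨k, hk, hky⟩ := Set.mem_iUnion₂.1 (hF h3)
      rw [h1 _ k hk hky, one_smul]
  rw [h'] at h
  exact h

/-- The identification of the induced module with the equivariant functions with compact support
modulo the group. -/
def lowerEquiv (S : IsSlice D D' U A B) (hB : ∀ y : D.Space, ∃ h : H, h • y ∈ B)
    (M : Rep.{u} R G) : IndLower (cornerEquiv S).toRingHom M ≃ₗ[R] eqFunC X M.ρ :=
  LinearEquiv.ofBijective
    (((eqFun X M.ρ).subtype ∘ₗ lowerMap S M).codRestrict _ (lowerMap_mem_eqFunC S M))
    ⟨fun z z' h => by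
      have h' := congrArg (fun f : eqFunC X M.ρ => f.1) h
      exact lowerMap_injective S M (Subtype.ext h'), fun f => by
      obtain ⟨z, hz⟩ := exists_lowerMap_eq S hB M (f := ⟨f.1, f.2.1⟩) f.2
      have h' : (lowerMap S M z).1 = f.1 := congrArg Subtype.val hz
      exact ⟨z, Subtype.ext h'⟩⟩

end Lower

/-! ### The induced module for cohomology -/

section Upper

variable {R G H X : Type u} [CommRing R] [Group G] [Group H] [TopologicalSpace X]
  [MulAction G X] [MulAction H X] [SMulCommClass G H X] [SMulCommClass H G X]
  [ContinuousConstSMul G X] [ContinuousConstSMul H X] {D : ClopenDomain G X} {D' : ClopenDomain H X}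
  {U : Set X} {A : TopologicalSpace.Clopens D'.Space} {B : TopologicalSpace.Clopens D.Space}
  [CompactSpace D'.Space]

/-- The homomorphism `x ↦ x · f` attached to an equivariant function. -/
def upperHom (S : IsSlice D D' U A B) (M : Rep.{u} R G) (f : eqFun X M.ρ) :
    rowIdeal R H B →ₗ[R] RowTensor A M :=
  (rowEquiv S M).symm.toLinearMap ∘ₗ
    { toFun := fun x => ⟨covAct D H M x.1 f, by
        rw [mem_fixedFun, ← Module.End.mul_apply, ← map_mul, chi_mul_row]⟩
      map_add' := fun x x' => Subtype.ext (by
        change covAct D H M (x.1 + x'.1) f = _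
        rw [map_add, LinearMap.add_apply]
        rfl)
      map_smul' := fun c x => Subtype.ext (crossAct_smul D _ c x.1 f) }

theorem rowEval_upperHom (S : IsSlice D D' U A B) (M : Rep.{u} R G) (f : eqFun X M.ρ)
    (x : rowIdeal R H B) : rowEval S M (upperHom S M f x) = covAct D H M x.1 f :=
  rowEval_rowEquiv_symm S M _

theorem upperHom_add (S : IsSlice D D' U A B) (M : Rep.{u} R G) (f f' : eqFun X M.ρ) :
    upperHom S M (f + f') = upperHom S M f + upperHom S M f' :=
  LinearMap.ext fun x => rowEval_injective S M <|
    (rowEval_upperHom S M (f + f') x).trans <|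
      (map_add (covAct D H M x.1) f f').trans <|
        (congrArg₂ (· + ·) (rowEval_upperHom S M f x).symm (rowEval_upperHom S M f' x).symm).trans
          (map_add (rowEval S M) (upperHom S M f x) (upperHom S M f' x)).symm

theorem upperHom_smul (S : IsSlice D D' U A B) (M : Rep.{u} R G) (c : R) (f : eqFun X M.ρ) :
    upperHom S M (c • f) = c • upperHom S M f :=
  LinearMap.ext fun x => rowEval_injective S M <|
    (rowEval_upperHom S M (c • f) x).trans <|
      (map_smul (covAct D H M x.1) c f).trans <|
        (congrArg (c • ·) (rowEval_upperHom S M f x).symm).trans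
          (map_smul (rowEval S M) c (upperHom S M f x)).symm

theorem upperHom_mem (S : IsSlice D D' U A B) (M : Rep.{u} R G) (f : eqFun X M.ρ) :
    upperHom S M f ∈ IndUpper (cornerEquiv S).toRingHom M := fun t x =>
  rowEval_injective S M <| (rowEval_upperHom S M f (rowLeft B t x)).trans <| by
    refine Eq.trans ?_ (rowEval_act S M t _).symm
    rw [rowEval_upperHom, ← Module.End.mul_apply, ← map_mul]
    rfl

/-- The map `f ↦ (x ↦ x · f)`. -/
def upperMap (S : IsSlice D D' U A B) (M : Rep.{u} R G) :
    eqFun X M.ρ →ₗ[R] IndUpper (cornerEquiv S).toRingHom M where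
  toFun f := ⟨upperHom S M f, upperHom_mem S M f⟩
  map_add' f f' := Subtype.ext (upperHom_add S M f f')
  map_smul' c f := Subtype.ext (upperHom_smul S M c f)

theorem rowEval_upperMap (S : IsSlice D D' U A B) (M : Rep.{u} R G) (f : eqFun X M.ρ)
    (x : rowIdeal R H B) : rowEval S M ((upperMap S M f).1 x) = covAct D H M x.1 f :=
  rowEval_upperHom S M f x

theorem upperMap_action (S : IsSlice D D' U A B) (M : Rep.{u} R G) (h : H) (f : eqFun X M.ρ) :
    upperMap S M (eqAction X M.ρ _ (trivial_commute R G H M.V M.ρ) h f) =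
      indUpperRep (cornerEquiv S).toRingHom M h (upperMap S M f) := by
  refine Subtype.ext (LinearMap.ext fun x => rowEval_injective S M ?_)
  refine (rowEval_upperMap S M _ x).trans (Eq.trans ?_ (rowEval_upperMap S M f
    (rowRight B (op (incl R D.Space H (MonoidAlgebra.of R H h))) x)).symm)
  change _ = covAct D H M (x.1 * incl R D.Space H (MonoidAlgebra.of R H h)) f
  rw [map_mul, Module.End.mul_apply, crossAct_incl]

theorem upperMap_naturality (S : IsSlice D D' U A B) {M M' : Rep.{u} R G} (φ : M ⟶ M')
    (f : eqFun X M.ρ) : upperMap S M' (covMap X φ f) =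
      indUpperMap (cornerEquiv S).toRingHom φ (upperMap S M f) := by
  refine Subtype.ext (LinearMap.ext fun x => rowEval_injective S M' ?_)
  refine (rowEval_upperMap S M' _ x).trans ?_
  rw [← covAct_covMap, ← rowEval_upperMap S M, ← rowEval_naturality]
  rfl

theorem mono_mem_row {h : H} {φ : LocallyConstant D.Space R} (hφ : ∀ y, φ y ≠ 0 → y ∈ B) :
    (mono h φ : CrossedProduct R D.Space H) ∈ rowIdeal R H B := by
  classical
  refine ⟨mono h φ, crossed_ext fun h' y => ?_⟩
  change coeffHom h' (chi R H B * mono h φ) y = _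
  rw [coeffHom_chi_mul, ite_eq_left_iff]
  exact fun hy => by_contra fun h' => hy (hφ y (coeffHom_mono_ne_zero (Ne.symm h')).2)

theorem charFn_ne_zero {y : D.Space} (hy : LocallyConstant.charFn R B.isClopen y ≠ 0) : y ∈ B := by
  rw [LocallyConstant.coe_charFn] at hy
  exact Set.mem_of_indicator_ne_zero hy

/-- The element `χ_B h`. -/
def rowMono (R : Type u) [CommRing R] (B : TopologicalSpace.Clopens D.Space) (h : H) :
    rowIdeal R H B :=
  ⟨mono h (LocallyConstant.charFn R B.isClopen), mono_mem_row fun _ => charFn_ne_zero⟩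

/-- If `h` moves the orbit of `x` into `B`, the value `f x` is recovered as the value of `(χ_B h) f`
at `h • x`. -/
theorem upperMap_injective (S : IsSlice D D' U A B) (hB : ∀ y : D.Space, ∃ h : H, h • y ∈ B)
    (M : Rep.{u} R G) : Function.Injective (upperMap S M) := by
  classical
  refine (injective_iff_map_eq_zero _).2 fun f hf => Subtype.ext (funext fun x => ?_)
  obtain ⟨h, hh⟩ := hB (D.proj x)
  have h1 := rowEval_upperMap S M f (rowMono R B h)
  have h2 := congrFun (congrArg Subtype.val h1) (h • x)
  rw [hf] at h2
  have h3 := crossAct_mono D (trivial_commute R G H M.V M.ρ) h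
    (LocallyConstant.charFn R B.isClopen) f (h • x)
  rw [inv_smul_smul, charFn_apply, if_pos (by rwa [← D.smul_proj]), one_smul] at h3
  refine h3.symm.trans (h2.symm.trans ?_)
  refine congrFun (congrArg Subtype.val (map_zero (rowEval S M))) (h • x)

/-- The value of the function given by a homomorphism, in a translate. -/
def upperVal (S : IsSlice D D' U A B) (M : Rep.{u} R G)
    (θ : IndUpper (cornerEquiv S).toRingHom M) (h : H) : eqFun X M.ρ :=
  rowEval S M (θ.1 (rowMono R B h))

/-- Linearity over the corner determines `θ` on `φ g` from its values on the elements `χ_B h`: the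
two elements become equal after multiplication by suitable corner elements, and over `x` these
multipliers do not lose the value. -/
theorem rowEval_mono (S : IsSlice D D' U A B) (M : Rep.{u} R G)
    (θ : IndUpper (cornerEquiv S).toRingHom M) {g h : H} {φ : LocallyConstant D.Space R}
    (hφ : ∀ y, φ y ≠ 0 → y ∈ B) {x : X} (hx : h • g⁻¹ • D.proj x ∈ B) :
    (rowEval S M (θ.1 ⟨mono g φ, mono_mem_row hφ⟩)).1 x =
      φ (D.proj x) • (upperVal S M θ h).1 (h • g⁻¹ • x) := by
  classical
  -- The characteristic function of the set where `h g⁻¹` leads into `B`. There `φ g` factors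
  -- through `χ_B h`, the first factor lying in the corner.
  let χ : LocallyConstant D.Space R := (g * h⁻¹) • LocallyConstant.charFn R B.isClopen
  have hχ (y : D.Space) : χ y = if h • g⁻¹ • y ∈ B then 1 else 0 := by
    have : χ y = LocallyConstant.charFn R B.isClopen ((g * h⁻¹)⁻¹ • y) := rfl
    rw [this, charFn_apply, mul_inv_rev, inv_inv, mul_smul]
  by_cases hxB : D.proj x ∈ B
  swap
  · rw [rowEval_eq_zero S M _ hxB]
    have : φ (D.proj x) = 0 := by_contra fun h' => hxB (hφ _ h')
    rw [this, zero_smul]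
  have ht : (mono (g * h⁻¹) (φ * χ) : CrossedProduct R D.Space H) ∈
      Subsemigroup.corner (chi R H B : CrossedProduct R D.Space H) := by
    rw [mem_corner_iff]
    intro k y hk
    obtain ⟨rfl, h2⟩ := coeffHom_mono_ne_zero hk
    rw [LocallyConstant.mul_apply] at h2
    refine ⟨hφ y (left_ne_zero_of_mul h2), ?_⟩
    by_contra h3
    refine right_ne_zero_of_mul h2 ?_
    rw [hχ, if_neg]
    rwa [mul_inv_rev, inv_inv, mul_smul] at h3
  have ht' : (mono 1 (LocallyConstant.charFn R B.isClopen * χ) : CrossedProduct R D.Space H) ∈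
      Subsemigroup.corner (chi R H B : CrossedProduct R D.Space H) := by
    rw [mem_corner_iff]
    intro k y hk
    obtain ⟨rfl, h2⟩ := coeffHom_mono_ne_zero hk
    rw [LocallyConstant.mul_apply] at h2
    have := charFn_ne_zero (left_ne_zero_of_mul h2)
    exact ⟨this, by rwa [inv_one, one_smul]⟩
  have h1 := congrArg (rowEval S M) (θ.2 ⟨_, ht⟩ (rowMono R B h))
  have h2 := congrArg (rowEval S M) (θ.2 ⟨_, ht'⟩ ⟨mono g φ, mono_mem_row hφ⟩)
  -- Both products are `φ χ g`, because `φ` is supported in `B` and `χ` is idempotent.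
  have h3 : rowLeft B ⟨_, ht⟩ (rowMono R B h) =
      rowLeft B ⟨_, ht'⟩ ⟨mono g φ, mono_mem_row hφ⟩ := by
    refine Subtype.ext ?_
    change mono (g * h⁻¹) (φ * χ) * mono h (LocallyConstant.charFn R B.isClopen) =
      mono 1 (LocallyConstant.charFn R B.isClopen * χ) * mono g φ
    rw [mono_mul_mono, mono_mul_mono, inv_mul_cancel_right, one_mul, one_smul]
    congr 1
    change φ * χ * χ = _
    refine LocallyConstant.ext fun y => ?_
    simp only [LocallyConstant.mul_apply, hχ, charFn_apply]
    by_cases hy : φ y = 0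
    · rw [hy, zero_mul, zero_mul, mul_zero]
    · rw [if_pos (hφ y hy)]
      split_ifs <;> ring
  rw [h3] at h1
  have h4 := (h1.symm.trans h2)
  have h5 := ((rowEval_act S M ⟨_, ht⟩ _).symm.trans h4).trans (rowEval_act S M ⟨_, ht'⟩ _)
  have h6 := congrFun (congrArg Subtype.val h5) x
  have h7 := crossAct_mono D (trivial_commute R G H M.V M.ρ) (g * h⁻¹) (φ * χ)
    (upperVal S M θ h) x
  have h8 := crossAct_mono D (trivial_commute R G H M.V M.ρ) 1
    (LocallyConstant.charFn R B.isClopen * χ)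
    (rowEval S M (θ.1 ⟨mono g φ, mono_mem_row hφ⟩)) x
  rw [LocallyConstant.mul_apply, hχ, if_pos hx, mul_one, mul_inv_rev, inv_inv, mul_smul] at h7
  rw [LocallyConstant.mul_apply, hχ, if_pos hx, mul_one, charFn_apply, if_pos hxB, one_smul,
    inv_one, one_smul] at h8
  exact h8.symm.trans (h6.symm.trans h7)

/-- The case `φ = χ_B`, `g = h'` of `rowEval_mono`: the value assigned to `x` does not depend on the
choice of a translation into `B`. -/
theorem upperVal_eq (S : IsSlice D D' U A B) (M : Rep.{u} R G)
    (θ : IndUpper (cornerEquiv S).toRingHom M) {h h' : H} {x : X} (hx : h • D.proj x ∈ B)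
    (hx' : h' • D.proj x ∈ B) :
    (upperVal S M θ h').1 (h' • x) = (upperVal S M θ h).1 (h • x) := by
  classical
  have := rowEval_mono S M θ (g := h') (h := h) (φ := LocallyConstant.charFn R B.isClopen)
    (fun _ => charFn_ne_zero) (x := h' • x) (by rwa [← D.smul_proj, inv_smul_smul])
  rw [charFn_apply, if_pos (by rwa [← D.smul_proj]), one_smul, inv_smul_smul] at this
  exact this

/-- The value at a point of the function given by a homomorphism. -/
def upperPoint (S : IsSlice D D' U A B) (hB : ∀ y : D.Space, ∃ h : H, h • y ∈ B) (M : Rep.{u} R G)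
    (θ : IndUpper (cornerEquiv S).toRingHom M) (x : X) : M.V :=
  (upperVal S M θ (hB (D.proj x)).choose).1 ((hB (D.proj x)).choose • x)

theorem upperPoint_eq (S : IsSlice D D' U A B) (hB : ∀ y : D.Space, ∃ h : H, h • y ∈ B)
    (M : Rep.{u} R G) (θ : IndUpper (cornerEquiv S).toRingHom M) {h : H} {x : X}
    (hx : h • D.proj x ∈ B) : upperPoint S hB M θ x = (upperVal S M θ h).1 (h • x) :=
  upperVal_eq S M θ hx (hB (D.proj x)).choose_spec

theorem upperPoint_mem (S : IsSlice D D' U A B) (hB : ∀ y : D.Space, ∃ h : H, h • y ∈ B)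
    (M : Rep.{u} R G) (θ : IndUpper (cornerEquiv S).toRingHom M) :
    upperPoint S hB M θ ∈ eqFun X M.ρ := by
  constructor
  · rw [IsLocallyConstant.iff_eventually_eq]
    intro x
    obtain ⟨h, hx⟩ := hB (D.proj x)
    have hV : IsOpen {y : X | h • D.proj y ∈ B} :=
      B.isClopen.isOpen.preimage ((continuous_const_smul h).comp D.continuous_proj)
    -- The same `h` serves on a neighbourhood of `x`, so the pointwise choices do not spoil local
    -- constancy.
    filter_upwards [hV.mem_nhds hx,
      (isLocallyConstant_smul (upperVal S M θ h).2.1 h).eventually_eq x] with y hy hy'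
    rw [upperPoint_eq S hB M θ hy, upperPoint_eq S hB M θ hx, hy']
  · intro g x
    obtain ⟨h, hx⟩ := hB (D.proj x)
    rw [upperPoint_eq S hB M θ hx, upperPoint_eq S hB M θ (h := h) (by rwa [D.proj_smul]),
      ← smul_comm g, (upperVal S M θ h).2.2]

/-- The function given by a homomorphism. -/
def upperFun (S : IsSlice D D' U A B) (hB : ∀ y : D.Space, ∃ h : H, h • y ∈ B) (M : Rep.{u} R G)
    (θ : IndUpper (cornerEquiv S).toRingHom M) : eqFun X M.ρ :=
  ⟨upperPoint S hB M θ, upperPoint_mem S hB M θ⟩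

theorem upperMap_upperFun (S : IsSlice D D' U A B) (hB : ∀ y : D.Space, ∃ h : H, h • y ∈ B)
    (M : Rep.{u} R G) (θ : IndUpper (cornerEquiv S).toRingHom M) :
    upperMap S M (upperFun S hB M θ) = θ := by
  refine Subtype.ext (LinearMap.ext fun x => rowEval_injective S M ?_)
  rw [rowEval_upperMap]
  obtain ⟨x, s, rfl⟩ := x
  change covAct D H M (chi R H B * s) _ =
    rowEval S M (θ.1 ⟨chi R H B * s, chi_mul_mem_row s⟩)
  induction s using crossed_induction with
  | zero =>
    have : (⟨chi R H B * 0, chi_mul_mem_row 0⟩ : rowIdeal R H B) = 0 :=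
      Subtype.ext (mul_zero _)
    rw [this, mul_zero, map_zero, map_zero, map_zero]
    rfl
  | add s s' h h' =>
    have : (⟨chi R H B * (s + s'), chi_mul_mem_row _⟩ : rowIdeal R H B) =
      ⟨chi R H B * s, chi_mul_mem_row s⟩ + ⟨chi R H B * s', chi_mul_mem_row s'⟩ :=
      Subtype.ext (mul_add _ _ _)
    rw [this, mul_add, map_add, map_add, map_add, LinearMap.add_apply, h, h']
  | single g φ =>
    have hs : chi R H B * mono g φ = mono g (LocallyConstant.charFn R B.isClopen * φ) := by
      rw [chi, mono_mul_mono, one_mul, one_smul]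
    have hφ (y : D.Space) (hy : (LocallyConstant.charFn R B.isClopen * φ) y ≠ 0) : y ∈ B :=
      charFn_ne_zero (left_ne_zero_of_mul hy)
    have : (⟨chi R H B * mono g φ, chi_mul_mem_row _⟩ : rowIdeal R H B) =
      ⟨_, mono_mem_row hφ⟩ := Subtype.ext hs
    rw [this, hs]
    refine Subtype.ext (funext fun x => ?_)
    -- This `h` computes both sides: it is admissible in `rowEval_mono` at `x`, and for the value of
    -- the constructed function at `g⁻¹ • x`.
    obtain ⟨h, hh⟩ := hB (g⁻¹ • D.proj x)
    rw [rowEval_mono S M θ hφ hh, crossAct_mono]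
    refine congrArg _ ?_
    exact upperPoint_eq S hB M θ (x := g⁻¹ • x) (by rwa [← D.smul_proj])

/-- The identification of the induced module with the equivariant functions. -/
def upperEquiv (S : IsSlice D D' U A B) (hB : ∀ y : D.Space, ∃ h : H, h • y ∈ B) (M : Rep.{u} R G) :
    eqFun X M.ρ ≃ₗ[R] IndUpper (cornerEquiv S).toRingHom M :=
  LinearEquiv.ofBijective (upperMap S M)
    ⟨upperMap_injective S hB M, fun θ => ⟨upperFun S hB M θ, upperMap_upperFun S hB M θ⟩⟩

end Upper

/-! ### Functors of equivariant functions, and naturality -/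

section RepHom

variable {R G : Type u} [CommRing R] [Group G]

/-- The morphism of representations given by an equivariant linear map. -/
def repHom {V W : Rep.{u} R G} (f : V.V →ₗ[R] W.V) (hf : ∀ g v, f (V.ρ g v) = W.ρ g (f v)) :
    V ⟶ W :=
  Rep.ofHom (ρ := V.ρ) (σ := W.ρ) ⟨f, fun g => LinearMap.ext (hf g)⟩

theorem repHom_ext {V W : Rep.{u} R G} {f f' : V ⟶ W} (h : ∀ v, f.hom v = f'.hom v) : f = f' :=
  Rep.hom_ext (Representation.IntertwiningMap.toLinearMap_injective _ _ (LinearMap.ext h))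

/-- The isomorphism of representations given by an equivariant linear equivalence. -/
def repIso {V W : Rep.{u} R G} (e : V.V ≃ₗ[R] W.V) (he : ∀ g v, e (V.ρ g v) = W.ρ g (e v)) :
    V ≅ W where
  hom := repHom e.toLinearMap he
  inv := repHom e.symm.toLinearMap fun g w => e.injective (by
    refine (e.apply_symm_apply _).trans ((congrArg _ (e.apply_symm_apply w).symm).trans ?_)
    exact (he g _).symm)
  hom_inv_id := repHom_ext fun v => e.symm_apply_apply v
  inv_hom_id := repHom_ext fun w => e.apply_symm_apply w

end RepHom

section Functors

variable {R G H X : Type u} [CommRing R] [Group G] [Group H] [TopologicalSpace X]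
  [MulAction G X] [MulAction H X] [SMulCommClass G H X] [SMulCommClass H G X]
  [ContinuousConstSMul G X] [ContinuousConstSMul H X]

/-- The map of functions with compact support modulo the group given by an equivariant map. -/
def eqFunMapC {V W : Type u} [AddCommGroup V] [Module R V] [AddCommGroup W]
    [Module R W] {ρ : Representation R G V} {ρ' : Representation R G W}
    (f : V →ₗ[R] W) (hf : ∀ k v, f (ρ k v) = ρ' k (f v)) : eqFunC X ρ →ₗ[R] eqFunC X ρ' where
  toFun h := ⟨fun x => f (h.1 x), (eqFunMap f hf ⟨h.1, h.2.1⟩).2, by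
    obtain ⟨-, K, hK, hhK⟩ := h.2
    exact ⟨K, hK, fun x hx => hhK x fun h' => hx (by simp only [h', map_zero])⟩⟩
  map_add' h h' := Subtype.ext (funext fun x => map_add f _ _)
  map_smul' c h := Subtype.ext (funext fun x => map_smul f _ _)

variable (R G H X) in
/-- The representation of `H` on the `G`-equivariant functions, as a functor. -/
def covFunctor : Rep.{u} R G ⥤ Rep.{u} R H where
  obj M := eqRep X (trivial_commute R G H M.V M.ρ)
  map {M M'} f := repHom (V := eqRep X (trivial_commute R G H M.V M.ρ))
    (W := eqRep X (trivial_commute R G H M'.V M'.ρ)) (covMap X f) fun _ _ => rfl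
  map_id _ := rfl
  map_comp _ _ := rfl

variable (R G H X) in
/-- The representation of `H` on the `G`-equivariant functions with compact support modulo `G`, as
a functor. -/
def covFunctorC : Rep.{u} R G ⥤ Rep.{u} R H where
  obj M := eqRepC X (trivial_commute R G H M.V M.ρ)
  map {M M'} f := repHom (V := eqRepC X (trivial_commute R G H M.V M.ρ))
    (W := eqRepC X (trivial_commute R G H M'.V M'.ρ))
    (eqFunMapC f.hom.toLinearMap fun g v => Rep.hom_comm_apply f g v) fun _ _ => rfl
  map_id _ := rfl
  map_comp _ _ := rfl

variable (R G H X) in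
/-- The representation of `G` on the `H`-invariant functions, as a functor. -/
def invFunctor : Rep.{u} R G ⥤ Rep.{u} R G where
  obj M := eqRep X (commute_trivial R G H M.V M.ρ)
  map {M M'} f := repHom (V := eqRep X (commute_trivial R G H M.V M.ρ))
    (W := eqRep X (commute_trivial R G H M'.V M'.ρ)) (invMap H X f) fun g _ =>
      Subtype.ext (funext fun _ => Rep.hom_comm_apply f g _)
  map_id _ := rfl
  map_comp _ _ := rfl

variable (R G H X) in
/-- The representation of `G` on the `H`-invariant functions with compact support modulo `H`, as a
functor. -/
def invFunctorC : Rep.{u} R G ⥤ Rep.{u} R G where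
  obj M := eqRepC X (commute_trivial R G H M.V M.ρ)
  map {M M'} f := repHom (V := eqRepC X (commute_trivial R G H M.V M.ρ))
    (W := eqRepC X (commute_trivial R G H M'.V M'.ρ))
    (eqFunMapC f.hom.toLinearMap fun _ _ => rfl) fun g _ =>
      Subtype.ext (funext fun _ => Rep.hom_comm_apply f g _)
  map_id _ := rfl
  map_comp _ _ := rfl

theorem homog_map {A A' : Rep.{u} R G} (φ : A ⟶ A') {n : ℕ} (u : (Fin n → G) → A.V) (s : ℕ → G) :
    homog (A := A') (fun g => φ.hom (u g)) s = φ.hom (homog u s) :=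
  (Rep.hom_comm_apply φ (s 0) _).symm

theorem hsingle_map {A A' : Rep.{u} R G} (φ : A ⟶ A') {n : ℕ} (s : ℕ → G) (a : A.V) :
    Finsupp.mapRange.linearMap φ.hom.toLinearMap (hsingle n s a) =
      hsingle (A := A') n s (φ.hom a) := by
  rw [hsingle_apply, hsingle_apply, Finsupp.mapRange.linearMap_apply, Finsupp.mapRange_single]
  congr 1
  exact Rep.hom_comm_apply φ _ a

variable (D : ClopenDomain G X) (D' : ClopenDomain H X)

theorem transferCohomology_naturality {M M' : Rep.{u} R G} (f : M ⟶ M') (n : ℕ) :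
    (groupCohomology.functor R G n).map ((invFunctor R G H X).map f) ≫
      transferCohomology D (trivial_commute R G H M'.V M'.ρ) (commute_trivial R G H M'.V M'.ρ) n =
    transferCohomology D (trivial_commute R G H M.V M.ρ) (commute_trivial R G H M.V M.ρ) n ≫
      (groupCohomology.functor R H n).map ((covFunctor R G H X).map f) := by
  refine cohomologyHom_naturality _ _ _ _ ((invFunctor R G H X).map f)
    ((covFunctor R G H X).map f) (fun n u => ?_) n
  funext h
  refine eqRep_ext _ fun x => ?_
  refine (evalAt_transferCochain D (trivial_commute R G H M'.V M'.ρ)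
    (commute_trivial R G H M'.V M'.ρ) _ h x).trans ?_
  refine (congrArg (evalAt (Representation.trivial R H M'.V) x)
    (homog_map ((invFunctor R G H X).map f) u _)).trans ?_
  refine (congrArg f.hom (evalAt_transferCochain D (trivial_commute R G H M.V M.ρ)
    (commute_trivial R G H M.V M.ρ) u h x)).symm.trans ?_
  rfl

/-- The map of functions with compact support given by a linear map. -/
def lccMap {V W : Type u} [AddCommGroup V] [Module R V] [AddCommGroup W] [Module R W]
    (f : V →ₗ[R] W) (k : lcc R X V) : lcc R X W :=
  ⟨fun x => f (k.1 x), k.2.1.comp f, by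
    obtain ⟨-, K, hK, hkK⟩ := k.2
    exact ⟨K, hK, fun x hx => hkK x fun h' => hx (by simp only [h', map_zero])⟩⟩

theorem eqFunMapC_trace {V W : Type u} [AddCommGroup V] [Module R V] [AddCommGroup W]
    [Module R W] {ρ : Representation R G V} {ρ' : Representation R G W}
    (f : V →ₗ[R] W) (hf : ∀ k v, f (ρ k v) = ρ' k (f v)) (k : lcc R X V) :
    eqFunMapC f hf (trace D ρ k) = trace D ρ' (lccMap f k) := by
  refine Subtype.ext (funext fun x => ?_)
  change f (∑ᶠ g : G, ρ g (k.1 (g⁻¹ • x))) = ∑ᶠ g : G, ρ' g (f (k.1 (g⁻¹ • x)))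
  rw [map_finsum f (finite_support_trace D ρ k x)]
  exact finsum_congr fun g => hf g _

theorem transferHomology_naturality {M M' : Rep.{u} R G} (f : M ⟶ M') (n : ℕ) :
    (groupHomology.functor R G n).map ((invFunctorC R G H X).map f) ≫
      transferHomology D D' (trivial_commute R G H M'.V M'.ρ)
        (commute_trivial R G H M'.V M'.ρ) n =
    transferHomology D D' (trivial_commute R G H M.V M.ρ) (commute_trivial R G H M.V M.ρ) n ≫
      (groupHomology.functor R H n).map ((covFunctorC R G H X).map f) := by
  refine homologyHom_naturality _ _ _ _ ((invFunctorC R G H X).map f)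
    ((covFunctorC R G H X).map f) (fun n => ?_) n
  refine chain_hom_ext D D' (commute_trivial R G H M.V M.ρ) fun s h t k hk => ?_
  have h1 : ((invFunctorC R G H X).map f).hom (trace D' (Representation.trivial R H M.V) k) =
      trace D' (Representation.trivial R H M'.V) (lccMap f.hom.toLinearMap k) :=
    eqFunMapC_trace D' f.hom.toLinearMap (fun _ _ => rfl) k
  have h2 : ((covFunctorC R G H X).map f).hom (trace D M.ρ k) =
      trace D M'.ρ (lccMap f.hom.toLinearMap k) :=
    eqFunMapC_trace D f.hom.toLinearMap (fun g v => Rep.hom_comm_apply f g v) k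
  refine (congrArg (transferChain D D' (trivial_commute R G H M'.V M'.ρ)
    (commute_trivial R G H M'.V M'.ρ) n) ((hsingle_map ((invFunctorC R G H X).map f) s _).trans
      (congrArg _ h1))).trans ?_
  refine (transferChain_hsingle D D' (trivial_commute R G H M'.V M'.ρ)
    (commute_trivial R G H M'.V M'.ρ) n s h (lccMap f.hom.toLinearMap k) ?_).trans ?_
  · intro x hx i hi
    refine (hk x (fun h' => hx ?_) i hi).1
    change f.hom.toLinearMap (k.1 x) = 0
    rw [h', map_zero]
  · refine Eq.symm ((congrArg (Finsupp.mapRange.linearMap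
      ((covFunctorC R G H X).map f).hom.toLinearMap) (transferChain_hsingle D D'
      (trivial_commute R G H M.V M.ρ) (commute_trivial R G H M.V M.ρ) n s h k
      fun x hx i hi => (hk x hx i hi).1)).trans ?_)
    exact (hsingle_map ((covFunctorC R G H X).map f) h _).trans (congrArg _ h2)

/-- The transfer in cohomology, as an isomorphism of functors. -/
def transferCohomologyNatIso (R : Type u) [CommRing R] (n : ℕ) :
    invFunctor R G H X ⋙ groupCohomology.functor R G n ≅
      covFunctor R G H X ⋙ groupCohomology.functor R H n :=
  NatIso.ofComponents (fun M => transferCohomologyIso D D' (trivial_commute R G H M.V M.ρ)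
    (commute_trivial R G H M.V M.ρ) n) fun f => transferCohomology_naturality D f n

/-- The transfer in homology, as an isomorphism of functors. -/
def transferHomologyNatIso (R : Type u) [CommRing R] (n : ℕ) :
    invFunctorC R G H X ⋙ groupHomology.functor R G n ≅
      covFunctorC R G H X ⋙ groupHomology.functor R H n :=
  NatIso.ofComponents (fun M => transferHomologyIso D D' (trivial_commute R G H M.V M.ρ)
    (commute_trivial R G H M.V M.ρ) n) fun f => transferHomology_naturality D D' f n

end Functors

/-! ### The factorizations of the induction maps in terms of functions. -/

section Models

variable {R G H X : Type u} [CommRing R] [Group G] [Group H] [TopologicalSpace X]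
  [MulAction G X] [MulAction H X] [SMulCommClass G H X] [SMulCommClass H G X]
  [ContinuousConstSMul G X] [ContinuousConstSMul H X] {D : ClopenDomain G X} {D' : ClopenDomain H X}
  {U : Set X} {A : TopologicalSpace.Clopens D'.Space} {B : TopologicalSpace.Clopens D.Space}
  (S : IsSlice D D' U A B) (hB : ∀ y : D.Space, ∃ h : H, h • y ∈ B)

theorem mem_eqFunC_of_isCompact {K : Type u} [Group K] [MulAction K X] (D : ClopenDomain K X)
    (hD : IsCompact D.carrier) {V : Type u} [AddCommGroup V] [Module R V]
    {ρ : Representation R K V} {f : X → V} (hf : f ∈ eqFun X ρ) : f ∈ eqFunC X ρ :=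
  ⟨hf, D.carrier, hD, fun x _ => ⟨D.toDom x, D.toDom_mem x⟩⟩

/-- If the fundamental domain is compact, all equivariant functions have compact support modulo the
group. -/
def compactEquiv {K : Type u} [Group K] [MulAction K X] (D : ClopenDomain K X)
    (hD : IsCompact D.carrier) {V : Type u} [AddCommGroup V] [Module R V]
    (ρ : Representation R K V) : eqFun X ρ ≃ₗ[R] eqFunC X ρ where
  toFun f := ⟨f.1, mem_eqFunC_of_isCompact D hD f.2⟩
  invFun f := ⟨f.1, f.2.1⟩
  map_add' _ _ := rfl
  map_smul' _ _ := rfl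
  left_inv _ := rfl
  right_inv _ := rfl

variable (R) in
/-- The functor `M ↦ res (R(Y ⋊ G) ⊗_{RG} M)` in terms of functions. -/
def extResIso (D' : ClopenDomain H X) [CompactSpace D'.Space] :
    extRes R G D'.Space ≅ invFunctor R G H X :=
  NatIso.ofComponents
    (fun M => repIso (V := (extRes R G D'.Space).obj M) (W := (invFunctor R G H X).obj M)
      (fullEquiv D' M) fun g z =>
        (fullMap_act M (incl R D'.Space G (MonoidAlgebra.of R G g)) z).trans (by
          rw [crossAct_incl]
          rfl))
    fun f => repHom_ext fun z => fullMap_naturality f z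

variable (R) in
/-- The functor `M ↦ res (R(Y ⋊ G) ⊗_{RG} M)` in terms of functions with compact support modulo
`H`. -/
def extResIsoC (D' : ClopenDomain H X) [CompactSpace D'.Space] (hD' : IsCompact D'.carrier) :
    extRes R G D'.Space ≅ invFunctorC R G H X :=
  extResIso R D' ≪≫ NatIso.ofComponents
    (fun M => repIso (V := (invFunctor R G H X).obj M) (W := (invFunctorC R G H X).obj M)
      (compactEquiv D' hD' _) fun _ _ => rfl)
    fun _ => rfl

variable [CompactSpace D'.Space]

variable (R) in
/-- The induction functor for homology in terms of functions. -/
def indLowerIso : indLower (R := R) (cornerEquiv S).toRingHom ≅ covFunctorC R G H X :=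
  NatIso.ofComponents
    (fun M => repIso (V := (indLower (cornerEquiv S).toRingHom).obj M)
      (W := (covFunctorC R G H X).obj M) (lowerEquiv S hB M) fun h z => Subtype.ext (by
        refine (congrArg Subtype.val (lowerMap_act S M
          (incl R D.Space H (MonoidAlgebra.of R H h)) z)).trans ?_
        rw [crossAct_incl]
        rfl))
    fun f => repHom_ext fun z =>
      Subtype.ext (congrArg (fun k => k.1) (lowerMap_naturality S f z))

variable (R) in
/-- The induction functor for cohomology in terms of functions. -/
def indUpperIso : covFunctor R G H X ≅ indUpper (R := R) (cornerEquiv S).toRingHom :=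
  NatIso.ofComponents
    (fun M => repIso (V := (covFunctor R G H X).obj M)
      (W := (indUpper (cornerEquiv S).toRingHom).obj M) (upperEquiv S hB M)
      fun h f => upperMap_action S M h f)
    fun f => repHom_ext fun z => upperMap_naturality S f z

variable (R) in
/-- The isomorphism of homology groups. -/
def homologyNatIso (hD' : IsCompact D'.carrier) (n : ℕ) :
    extRes R G D'.Space ⋙ groupHomology.functor R G n ≅
      indLower (cornerEquiv S).toRingHom ⋙ groupHomology.functor R H n :=
  Functor.isoWhiskerRight (extResIsoC R D' hD') _ ≪≫ transferHomologyNatIso D D' R n ≪≫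
    Functor.isoWhiskerRight (indLowerIso R S hB).symm _

variable (R) in
/-- The isomorphism of cohomology groups. -/
def cohomologyNatIso (n : ℕ) :
    extRes R G D'.Space ⋙ groupCohomology.functor R G n ≅
      indUpper (cornerEquiv S).toRingHom ⋙ groupCohomology.functor R H n :=
  Functor.isoWhiskerRight (extResIso R D') _ ≪≫ transferCohomologyNatIso D D' R n ≪≫
    Functor.isoWhiskerRight (indUpperIso R S hB) _

end Models

/-! ### Trivial coefficients: the functions on the orbit space -/

section OrbitSpace

variable {R G H X : Type u} [CommRing R] [Group G] [Group H] [TopologicalSpace X]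
  [MulAction G X] [MulAction H X] [SMulCommClass G H X] [SMulCommClass H G X]
  [ContinuousConstSMul G X] [ContinuousConstSMul H X] (D : ClopenDomain G X)

variable (R) in
/-- Invariant functions are functions on the orbit space. -/
def restrictEquiv : eqFun X (Representation.trivial R G R) ≃ₗ[R] LocallyConstant D.Space R where
  toFun f := ⟨fun d => f.1 d.1, f.2.1.comp_continuous continuous_subtype_val⟩
  invFun k := ⟨fun x => k (D.proj x), k.isLocallyConstant.comp_continuous D.continuous_proj,
    fun g x => congrArg k (D.proj_smul g x)⟩
  map_add' _ _ := rfl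
  map_smul' _ _ := rfl
  left_inv f := Subtype.ext (funext fun x => f.2.2 (D.toDom x) x)
  right_inv k := LocallyConstant.ext fun d => congrArg k (D.proj_coe d)

theorem act_mono (h : H) (φ k : LocallyConstant D.Space R) : act (mono h φ) k = φ * h • k :=
  SkewMonoidAlgebra.sum_single_index (zero_mul _)

theorem act_add (s s' : CrossedProduct R D.Space H) (k : LocallyConstant D.Space R) :
    act (s + s') k = act s k + act s' k :=
  SkewMonoidAlgebra.sum_add_index' (fun _ => zero_mul _) fun _ _ _ => add_mul _ _ _

theorem act_eq (s : CrossedProduct R D.Space H) (k : LocallyConstant D.Space R) :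
    act s k = restrictEquiv R D (crossAct D (trivial_commute R G H R (Representation.trivial R G R))
      s ((restrictEquiv R D).symm k)) := by
  induction s using crossed_induction with
  | zero =>
    rw [map_zero, LinearMap.zero_apply, map_zero]
    exact SkewMonoidAlgebra.sum_zero_index
  | add s s' h h' => rw [act_add, h, h', map_add, LinearMap.add_apply, map_add]
  | single h φ =>
    rw [act_mono]
    ext d
    refine Eq.symm ((crossAct_mono D _ h φ _ d.1).trans ?_)
    rw [D.proj_coe]
    refine congrArg (φ d * ·) (congrArg k ?_)
    rw [← D.smul_proj, D.proj_coe]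

theorem act_apply_proj (s : CrossedProduct R D.Space H) (k : LocallyConstant D.Space R) (x : X) :
    act s k (D.proj x) = (crossAct D (trivial_commute R G H R (Representation.trivial R G R))
      s ((restrictEquiv R D).symm k)).1 x := by
  rw [act_eq]
  exact congrFun (congrArg Subtype.val ((restrictEquiv R D).symm_apply_apply _)) x

variable (R H) in
/-- The identification of the representations of invariant functions and of functions on the orbit
space. -/
def restrictIso : invRep R G H X ≅ functionRep R H D.Space :=
  repIso (V := invRep R G H X) (W := functionRep R H D.Space) (restrictEquiv R D) fun h f =>
    LocallyConstant.ext fun d => by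
      change f.1 (h⁻¹ • d.1) = f.1 (D.proj (h⁻¹ • d.1)).1
      exact (f.2.2 _ _).symm

variable (R H) in
/-- If the fundamental domain is compact, all invariant functions have compact support modulo the
group. -/
def compactIso (hD : IsCompact D.carrier) : invRep R G H X ≅ invRepC R G H X :=
  repIso (V := invRep R G H X) (W := invRepC R G H X) (compactEquiv D hD _) fun _ _ => rfl

variable {D} {D' : ClopenDomain H X} {U : Set X} {A : TopologicalSpace.Clopens D'.Space}
  {B : TopologicalSpace.Clopens D.Space}

theorem rowEval_trivial_apply (S : IsSlice D D' U A B) (s : rowIdeal R G A) (r : R) {x : X}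
    (hx : x ∈ U) : (rowEval S (Rep.trivial R G R) (BalancedTensor.mk _ _ s r)).1 x =
      act s.1 (LocallyConstant.const _ r) (D'.proj x) := by
  rw [rowEval_mk, transferFun_apply S _ hx, act_apply_proj]
  rfl

/-- A function prescribed on the slice alone is made unique by cutting it down to `B`. -/
theorem chi_mul_rowEval (S : IsSlice D D' U A B) (z : RowTensor A (Rep.trivial R G R))
    (f : eqFun X (Rep.trivial R G R).ρ)
    (hf : ∀ x ∈ U, (rowEval S (Rep.trivial R G R) z).1 x = f.1 x) :
    covAct D H (Rep.trivial R G R) (chi R H B) f = rowEval S (Rep.trivial R G R) z := by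
  classical
  refine eqFun_ext_slice S (fun x hx => ?_) (fun x hx => ?_) fun x hx => rowEval_eq_zero S _ z hx
  · rw [crossAct_chi, if_pos (S.proj_mem hx), hf x hx]
  · rw [crossAct_chi, if_neg hx]

/-- Because `s' = s' χ_B`, the values of `k` off `B` are irrelevant; any extension of the prescribed
function gives the same result. -/
theorem lowerMap_trivial (S : IsSlice D D' U A B) (s' : colIdeal R H B) (s : rowIdeal R G A) (r : R)
    (k : LocallyConstant D.Space R)
    (hk : ∀ x ∈ U, k (D.proj x) = act s.1 (LocallyConstant.const _ r) (D'.proj x)) :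
    restrictEquiv R D (lowerMap S (Rep.trivial R G R) (BalancedTensor.mk _ _ s'
      (BalancedTensor.mk _ _ s r))) = act s'.1 k := by
  rw [lowerMap_mk, act_eq, ← chi_mul_rowEval S _ ((restrictEquiv R D).symm k) fun x hx =>
    (rowEval_trivial_apply S s r hx).trans (hk x hx).symm]
  conv_rhs => rw [← mul_chi_eq s', map_mul]
  rfl

/-- Here `x = χ_B x`, so `x · k` is supported over `B` and is determined by its values on the slice;
the row tensor is in turn determined by its evaluation. -/
theorem upperMap_trivial [CompactSpace D'.Space] (S : IsSlice D D' U A B)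
    (k : LocallyConstant D.Space R) (x : rowIdeal R H B) (s : rowIdeal R G A)
    (hk : ∀ y ∈ U, act x.1 k (D.proj y) = act s.1 1 (D'.proj y)) :
    (upperMap S (Rep.trivial R G R) ((restrictEquiv R D).symm k)).1 x =
      BalancedTensor.mk (rowRightGroup R G A) (repLeft (Rep.trivial R G R)) s (1 : R) := by
  refine rowEval_injective S _ ?_
  rw [rowEval_upperMap, ← chi_mul_rowEval S _ (covAct D H (Rep.trivial R G R) x.1
    ((restrictEquiv R D).symm k)) fun y hy => (rowEval_trivial_apply S s 1 hy).trans
      ((hk y hy).symm.trans (act_apply_proj D x.1 k y))]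
  rw [← Module.End.mul_apply, ← map_mul, chi_mul_row x]

end OrbitSpace

/-! ### The induction maps for trivial coefficients and their multiplicativity. -/

section TrivialCoefficients

variable {R G H X : Type u} [CommRing R] [Group G] [Group H] [TopologicalSpace X]
  [MulAction G X] [MulAction H X] [SMulCommClass G H X] [SMulCommClass H G X]
  [ContinuousConstSMul G X] [ContinuousConstSMul H X] {D : ClopenDomain G X}
  {D' : ClopenDomain H X} {U : Set X} {A : TopologicalSpace.Clopens D'.Space}
  {B : TopologicalSpace.Clopens D.Space} [CompactSpace D'.Space]
  (S : IsSlice D D' U A B) (hB : ∀ y : D.Space, ∃ h : H, h • y ∈ B)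

variable (R) in
/-- The natural transformation in homology. -/
def lowerTrans (hD' : IsCompact D'.carrier) (n : ℕ) : groupHomology.functor R G n ⟶
    indLower (cornerEquiv S).toRingHom ⋙ groupHomology.functor R H n :=
  (Functor.leftUnitor _).inv ≫ Functor.whiskerRight (unitMap R G D'.Space) _ ≫
    (homologyNatIso R S hB hD' n).hom

variable (R) in
/-- The natural transformation in cohomology. -/
def upperTrans (n : ℕ) : groupCohomology.functor R G n ⟶
    indUpper (cornerEquiv S).toRingHom ⋙ groupCohomology.functor R H n :=
  (Functor.leftUnitor _).inv ≫ Functor.whiskerRight (unitMap R G D'.Space) _ ≫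
    (cohomologyNatIso R S hB n).hom

variable (R) in
/-- The module induced from the trivial module, for homology. -/
def lowerTrivialIso (hD : IsCompact D.carrier) :
    (indLower (cornerEquiv S).toRingHom).obj (Rep.trivial R G R) ≅ functionRep R H D.Space :=
  (indLowerIso R S hB).app (Rep.trivial R G R) ≪≫ (compactIso R H D hD).symm ≪≫ restrictIso R H D

variable (R) in
/-- The module induced from the trivial module, for cohomology. -/
def upperTrivialIso :
    (indUpper (cornerEquiv S).toRingHom).obj (Rep.trivial R G R) ≅ functionRep R H D.Space :=
  ((indUpperIso R S hB).app (Rep.trivial R G R)).symm ≪≫ restrictIso R H D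

variable (R G H X) in
/-- The constant functions. -/
def constHom : Rep.trivial R G R ⟶ invRep R H G X :=
  repHom (V := Rep.trivial R G R) (W := invRep R H G X) (constFun X R H R) fun _ _ => rfl

variable (R G) in
/-- The constant functions, if they have compact support modulo the group. -/
def constHomC (D' : ClopenDomain H X) (hD' : IsCompact D'.carrier) :
    Rep.trivial R G R ⟶ invRepC R H G X :=
  constHom R G H X ≫ (compactIso R G D' hD').hom

theorem unitMap_extResIso : (unitMap R G D'.Space).app (Rep.trivial R G R) ≫
    (extResIso R D').hom.app (Rep.trivial R G R) = constHom R G H X := by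
  refine repHom_ext fun r => ?_
  refine (fullMap_mk (Rep.trivial R G R) 1 r).trans ?_
  rw [map_one]
  rfl

/-- Formal: the induced module enters through an isomorphism and is left again through its inverse,
so it drops out of the composite. -/
theorem comp_cancel_apply {X₀ X₁ X₂ X₃ X₄ X₅ : ModuleCat.{u} R} (a : X₀ ⟶ X₁) (b : X₁ ⟶ X₂)
    (t : X₂ ⟶ X₃) (i : X₃ ⟶ X₄) (j : X₄ ⟶ X₃) (r : X₃ ⟶ X₅) (h : i ≫ j = 𝟙 X₃) (x : X₀) :
    (j ≫ r).hom ((a ≫ b ≫ t ≫ i).hom x) = r.hom (t.hom ((a ≫ b).hom x)) := by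
  have h' : (a ≫ b ≫ t ≫ i) ≫ j ≫ r = (a ≫ b) ≫ t ≫ r := by
    simp only [Category.assoc, reassoc_of% h]
  exact congrArg (fun f => f.hom x) h'

/-- With the induced module eliminated, three maps remain: the inclusion of constants, the transfer,
and the passage to functions on the orbit space. Each preserves products. -/
theorem cohomologyMap_upperTrans (n : ℕ) (x : groupCohomology (Rep.trivial R G R) n) :
    cohomologyMap (upperTrans R S hB) (upperTrivialIso R S hB).hom n x =
      ((groupCohomology.functor R H n).map (restrictIso R H D).hom).hom
        ((transferCohomology D (trivial_commute R G H R (Representation.trivial R G R))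
          (trivial_commute R H G R (Representation.trivial R H R)) n).hom
          (((groupCohomology.functor R G n).map (constHom R G H X)).hom x)) := by
  have h1 : (groupCohomology.functor R G n).map (constHom R G H X) =
      (groupCohomology.functor R G n).map ((unitMap R G D'.Space).app (Rep.trivial R G R)) ≫
      (groupCohomology.functor R G n).map ((extResIso R D').hom.app (Rep.trivial R G R)) :=
    (congrArg (groupCohomology.functor R G n).map
      (unitMap_extResIso (R := R) (D' := D')).symm).trans (Functor.map_comp _ _ _)
  have h2 : (groupCohomology.functor R H n).map (upperTrivialIso R S hB).hom =
    (groupCohomology.functor R H n).map ((indUpperIso R S hB).inv.app (Rep.trivial R G R)) ≫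
      (groupCohomology.functor R H n).map (restrictIso R H D).hom :=
    (groupCohomology.functor R H n).map_comp _ _
  have h3 : (groupCohomology.functor R H n).map ((indUpperIso R S hB).hom.app (Rep.trivial R G R)) ≫
      (groupCohomology.functor R H n).map ((indUpperIso R S hB).inv.app (Rep.trivial R G R)) =
        𝟙 _ := by
    rw [← Functor.map_comp, Iso.hom_inv_id_app]
    exact CategoryTheory.Functor.map_id _ _
  refine (congrArg (fun f => f.hom (((upperTrans R S hB n).app (Rep.trivial R G R)).hom x))
    h2).trans ?_
  refine (comp_cancel_apply
    ((groupCohomology.functor R G n).map ((unitMap R G D'.Space).app (Rep.trivial R G R)))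
    ((groupCohomology.functor R G n).map ((extResIso R D').hom.app (Rep.trivial R G R)))
    (transferCohomology D (trivial_commute R G H R (Representation.trivial R G R))
        (trivial_commute R H G R (Representation.trivial R H R)) n) _ _
    ((groupCohomology.functor R H n).map (restrictIso R H D).hom) h3 x).trans ?_
  exact (congrArg (fun f => ((groupCohomology.functor R H n).map (restrictIso R H D).hom).hom
    ((transferCohomology D (trivial_commute R G H R (Representation.trivial R G R))
      (trivial_commute R H G R (Representation.trivial R H R)) n).hom (f.hom x))) h1).symm

theorem homologyMap_lowerTrans (hD : IsCompact D.carrier) (hD' : IsCompact D'.carrier) (n : ℕ)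
    (x : groupHomology (Rep.trivial R G R) n) :
    homologyMap (lowerTrans R S hB hD') (lowerTrivialIso R S hB hD).hom n x =
      ((groupHomology.functor R H n).map ((compactIso R H D hD).inv ≫ (restrictIso R H D).hom)).hom
        ((transferHomology D D' (trivial_commute R G H R (Representation.trivial R G R))
          (trivial_commute R H G R (Representation.trivial R H R)) n).hom
          (((groupHomology.functor R G n).map (constHomC R G D' hD')).hom x)) := by
  have h1 : (groupHomology.functor R G n).map (constHomC R G D' hD') =
      (groupHomology.functor R G n).map ((unitMap R G D'.Space).app (Rep.trivial R G R)) ≫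
      (groupHomology.functor R G n).map ((extResIsoC R D' hD').hom.app (Rep.trivial R G R)) := by
    rw [← Functor.map_comp, constHomC, ← unitMap_extResIso (R := R) (D' := D')]
    rfl
  have h2 : (groupHomology.functor R H n).map (lowerTrivialIso R S hB hD).hom =
    (groupHomology.functor R H n).map ((indLowerIso R S hB).hom.app (Rep.trivial R G R)) ≫
      (groupHomology.functor R H n).map ((compactIso R H D hD).inv ≫ (restrictIso R H D).hom) :=
    (groupHomology.functor R H n).map_comp _ _
  have h3 : (groupHomology.functor R H n).map ((indLowerIso R S hB).inv.app (Rep.trivial R G R)) ≫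
      (groupHomology.functor R H n).map ((indLowerIso R S hB).hom.app (Rep.trivial R G R)) =
        𝟙 _ := by
    rw [← Functor.map_comp, Iso.inv_hom_id_app]
    exact CategoryTheory.Functor.map_id _ _
  refine (congrArg (fun f => f.hom (((lowerTrans R S hB hD' n).app (Rep.trivial R G R)).hom x))
    h2).trans ?_
  refine (comp_cancel_apply
    ((groupHomology.functor R G n).map ((unitMap R G D'.Space).app (Rep.trivial R G R)))
    ((groupHomology.functor R G n).map ((extResIsoC R D' hD').hom.app (Rep.trivial R G R)))
    (transferHomology D D' (trivial_commute R G H R (Representation.trivial R G R))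
        (trivial_commute R H G R (Representation.trivial R H R)) n) _ _ ((groupHomology.functor R H n).map
      ((compactIso R H D hD).inv ≫ (restrictIso R H D).hom)) h3 x).trans ?_
  exact (congrArg (fun f => ((groupHomology.functor R H n).map
      ((compactIso R H D hD).inv ≫ (restrictIso R H D).hom)).hom
    ((transferHomology D D' (trivial_commute R G H R (Representation.trivial R G R))
      (trivial_commute R H G R (Representation.trivial R H R)) n).hom (f.hom x))) h1).symm

theorem cohomologyMap_cup {m n N : ℕ} (h : m + n = N) (x : groupCohomology (Rep.trivial R G R) m)
    (y : groupCohomology (Rep.trivial R G R) n) :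
    cohomologyMap (upperTrans R S hB) (upperTrivialIso R S hB).hom N
        (cup (trivialMul R G) (trivialMul_equivariant R G) h x y) =
      cup (functionMul R H D.Space) (functionMul_equivariant R H D.Space) h
        (cohomologyMap (upperTrans R S hB) (upperTrivialIso R S hB).hom m x)
        (cohomologyMap (upperTrans R S hB) (upperTrivialIso R S hB).hom n y) := by
  rw [cohomologyMap_upperTrans, cohomologyMap_upperTrans, cohomologyMap_upperTrans]
  have h1 := functor_map_cup (A₁ := Rep.trivial R G R) (A₂ := Rep.trivial R G R)
    (A₃ := Rep.trivial R G R) (B₁ := invRep R H G X) (B₂ := invRep R H G X)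
    (B₃ := invRep R H G X) (trivialMul R G) (trivialMul_equivariant R G) (eqFunMul R H X)
    (eqFunMul_equivariant (G := H) (H := G)) (constHom R G H X) (constHom R G H X)
    (constHom R G H X) (fun _ _ => rfl) h x y
  have h2 := functor_map_cup (A₁ := invRep R G H X) (A₂ := invRep R G H X)
    (A₃ := invRep R G H X) (eqFunMul R G X) (eqFunMul_equivariant (G := G) (H := H))
    (functionMul R H D.Space) (functionMul_equivariant R H D.Space) (restrictIso R H D).hom
    (restrictIso R H D).hom (restrictIso R H D).hom (fun _ _ => rfl) h
    ((transferCohomology D (trivial_commute R G H R (Representation.trivial R G R))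
      (trivial_commute R H G R (Representation.trivial R H R)) m).hom
      (((groupCohomology.functor R G m).map (constHom R G H X)).hom x))
    ((transferCohomology D (trivial_commute R G H R (Representation.trivial R G R))
      (trivial_commute R H G R (Representation.trivial R H R)) n).hom
      (((groupCohomology.functor R G n).map (constHom R G H X)).hom y))
  refine (congrArg (fun z => ((groupCohomology.functor R H N).map (restrictIso R H D).hom).hom
    ((transferCohomology D (trivial_commute R G H R (Representation.trivial R G R))
      (trivial_commute R H G R (Representation.trivial R H R)) N).hom z)) h1).trans ?_
  refine Eq.trans ?_ h2
  exact congrArg ((groupCohomology.functor R H N).map (restrictIso R H D).hom).hom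
    (transferCohomology_cup D h _ _)

/-- The two outer maps preserve caps because they are multiplicative on coefficients, the middle one
by the projection formula. Compactness of both domains identifies invariant functions with those of
compact support modulo the group. -/
theorem homologyMap_cap (hD : IsCompact D.carrier) (hD' : IsCompact D'.carrier) {k m N : ℕ}
    (h : k + m = N) (x : groupCohomology (Rep.trivial R G R) m)
    (y : groupHomology (Rep.trivial R G R) N) :
    homologyMap (lowerTrans R S hB hD') (lowerTrivialIso R S hB hD).hom k
        (cap (trivialMul R G) (trivialMul_equivariant R G) h x y) =
      cap (functionMul R H D.Space) (functionMul_equivariant R H D.Space) h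
        (cohomologyMap (upperTrans R S hB) (upperTrivialIso R S hB).hom m x)
        (homologyMap (lowerTrans R S hB hD') (lowerTrivialIso R S hB hD).hom N y) := by
  rw [cohomologyMap_upperTrans, homologyMap_lowerTrans, homologyMap_lowerTrans]
  have h1 := functor_map_cap (A₁ := Rep.trivial R G R) (A₂ := Rep.trivial R G R)
    (A₃ := Rep.trivial R G R) (B₁ := invRep R H G X) (B₂ := invRepC R H G X)
    (B₃ := invRepC R H G X) (trivialMul R G) (trivialMul_equivariant R G) (eqFunMulC R H X)
    (eqFunMulC_equivariant (G := H) (H := G)) (constHom R G H X) (constHomC R G D' hD')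
    (constHomC R G D' hD') (fun _ _ => rfl) h x y
  have h2 := functor_map_cap (A₁ := invRep R G H X) (A₂ := invRepC R G H X)
    (A₃ := invRepC R G H X) (eqFunMulC R G X) (eqFunMulC_equivariant (G := G) (H := H))
    (functionMul R H D.Space) (functionMul_equivariant R H D.Space) (restrictIso R H D).hom
    ((compactIso R H D hD).inv ≫ (restrictIso R H D).hom)
    ((compactIso R H D hD).inv ≫ (restrictIso R H D).hom) (fun _ _ => rfl) h
    ((transferCohomology D (trivial_commute R G H R (Representation.trivial R G R))
      (trivial_commute R H G R (Representation.trivial R H R)) m).hom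
      (((groupCohomology.functor R G m).map (constHom R G H X)).hom x))
    ((transferHomology D D' (trivial_commute R G H R (Representation.trivial R G R))
      (trivial_commute R H G R (Representation.trivial R H R)) N).hom
      (((groupHomology.functor R G N).map (constHomC R G D' hD')).hom y))
  refine (congrArg (fun z => ((groupHomology.functor R H k).map
    ((compactIso R H D hD).inv ≫ (restrictIso R H D).hom)).hom
    ((transferHomology D D' (trivial_commute R G H R (Representation.trivial R G R))
      (trivial_commute R H G R (Representation.trivial R H R)) k).hom z)) h1).trans ?_
  refine Eq.trans ?_ h2
  refine congrArg ((groupHomology.functor R H k).map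
    ((compactIso R H D hD).inv ≫ (restrictIso R H D).hom)).hom ?_
  exact transferHomology_cap D D' h (((groupCohomology.functor R G m).map (constHom R G H X)).hom x)
    (((groupHomology.functor R G N).map (constHomC R G D' hD')).hom y)

end TrivialCoefficients

/-! ### The coupling: `G = Λ`, `H = Γ`, with slice `A`. -/

section Coupling

variable {R Λ Γ X : Type u} [CommRing R] [Group Λ] [Group Γ] [TopologicalSpace X] [MulAction Λ X]
  [MulAction Γ X] [SMulCommClass Λ Γ X] [SMulCommClass Γ Λ X] [ContinuousConstSMul Λ X]
  [ContinuousConstSMul Γ X] {C : TopologicalCoupling Λ Γ X}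
  {A : TopologicalSpace.Clopens C.domΓ.Space} {B : TopologicalSpace.Clopens C.domΛ.Space}

instance : CompactSpace C.domΓ.Space := isCompact_iff_compactSpace.1 C.isCompact_domΓ

theorem isCanonicalLower_lowerTrivialIso (hAB : C.IsMatching A B)
    (hD : IsCompact C.domΛ.carrier) :
    IsCanonicalLower (lowerTrivialIso R hAB.isSlice hAB.meets_right hD).hom := by
  intro s' s r k hk
  refine lowerMap_trivial hAB.isSlice s' s r k ?_
  rintro _ ⟨a, ha, rfl⟩
  exact (hk a ha).trans (congrArg (fun y => act s.1 (LocallyConstant.const _ r) y)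
    (C.domΓ.proj_coe a).symm)

theorem isCanonicalUpper_upperTrivialIso (hAB : C.IsMatching A B) :
    IsCanonicalUpper (upperTrivialIso R hAB.isSlice hAB.meets_right).inv := by
  intro k x s hk
  refine upperMap_trivial hAB.isSlice k x s ?_
  rintro _ ⟨a, ha, rfl⟩
  exact (hk a ha).trans (congrArg (fun y => act s.1 1 y) (C.domΓ.proj_coe a).symm)

end Coupling

end

end CouplingInduction

theorem mainTheorem7 {R Λ Γ X : Type u} [CommRing R] [Group Λ] [Group Γ] [Countable Λ] [Countable Γ]
    [TopologicalSpace X] [T2Space X] [LocallyCompactSpace X] [MulAction Λ X] [MulAction Γ X]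
    [SMulCommClass Λ Γ X] [SMulCommClass Γ Λ X] [ContinuousConstSMul Λ X] [ContinuousConstSMul Γ X]
    [ProperlyDiscontinuousSMul Λ X] [ProperlyDiscontinuousSMul Γ X]
    (φ : Λ → Γ) (hφ : IsUniformEmbedding φ) (C : TopologicalCoupling Λ Γ X)
    (A : TopologicalSpace.Clopens C.domΓ.Space) (B : TopologicalSpace.Clopens C.domΛ.Space)
    (hAB : C.IsMatching A B) :
    ∃ Φ : GroupoidRing R Γ B ≃+* GroupoidRing R Λ A, C.Induces Φ ∧
      ∃ (Il : ∀ n, groupHomology.functor R Λ n ⟶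
            indLower Φ.toRingHom ⋙ groupHomology.functor R Γ n)
        (Iu : ∀ n, groupCohomology.functor R Λ n ⟶
            indUpper Φ.toRingHom ⋙ groupCohomology.functor R Γ n),
        (∀ n, ∃ e : extRes R Λ C.domΓ.Space ⋙ groupHomology.functor R Λ n ≅
            indLower Φ.toRingHom ⋙ groupHomology.functor R Γ n,
          ∀ M : Rep.{u} R Λ, (Il n).app M =
            (groupHomology.functor R Λ n).map ((unitMap R Λ C.domΓ.Space).app M) ≫ e.hom.app M) ∧
        (∀ n, ∃ e : extRes R Λ C.domΓ.Space ⋙ groupCohomology.functor R Λ n ≅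
            indUpper Φ.toRingHom ⋙ groupCohomology.functor R Γ n,
          ∀ M : Rep.{u} R Λ, (Iu n).app M =
            (groupCohomology.functor R Λ n).map ((unitMap R Λ C.domΓ.Space).app M) ≫
              e.hom.app M) ∧
        (IsCompact C.domΛ.carrier →
          ∃ (κl : (indLower Φ.toRingHom).obj (Rep.trivial R Λ R) ≅ functionRep R Γ C.domΛ.Space)
            (κu : (indUpper Φ.toRingHom).obj (Rep.trivial R Λ R) ≅ functionRep R Γ C.domΛ.Space),
            IsCanonicalLower κl.hom ∧ IsCanonicalUpper κu.inv ∧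
            (∀ (m n N : ℕ) (h : m + n = N) (x : groupCohomology (Rep.trivial R Λ R) m)
              (y : groupCohomology (Rep.trivial R Λ R) n),
              cohomologyMap Iu κu.hom N (cup (trivialMul R Λ) (trivialMul_equivariant R Λ) h x y) =
                cup (functionMul R Γ C.domΛ.Space) (functionMul_equivariant R Γ C.domΛ.Space) h
                  (cohomologyMap Iu κu.hom m x) (cohomologyMap Iu κu.hom n y)) ∧
            (∀ (k m N : ℕ) (h : k + m = N) (x : groupCohomology (Rep.trivial R Λ R) m)
              (y : groupHomology (Rep.trivial R Λ R) N),
              homologyMap Il κl.hom k (cap (trivialMul R Λ) (trivialMul_equivariant R Λ) h x y) =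
                cap (functionMul R Γ C.domΛ.Space) (functionMul_equivariant R Γ C.domΛ.Space) h
                  (cohomologyMap Iu κu.hom m x) (homologyMap Il κl.hom N y))) := by
  -- The induction maps are defined as composites of the map induced by `j` with the natural
  -- isomorphisms, so both factorizations hold by construction.
  refine ⟨cornerEquiv hAB.isSlice, hAB.induces,
    lowerTrans R hAB.isSlice hAB.meets_right C.isCompact_domΓ,
    upperTrans R hAB.isSlice hAB.meets_right,
    fun n => ⟨homologyNatIso R hAB.isSlice hAB.meets_right C.isCompact_domΓ n, fun M => ?_⟩,
    fun n => ⟨cohomologyNatIso R hAB.isSlice hAB.meets_right n, fun M => ?_⟩, fun hD => ?_⟩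
  · rw [lowerTrans]
    rfl
  · rw [upperTrans]
    rfl
  · exact ⟨lowerTrivialIso R hAB.isSlice hAB.meets_right hD,
      upperTrivialIso R hAB.isSlice hAB.meets_right,
      isCanonicalLower_lowerTrivialIso hAB hD, isCanonicalUpper_upperTrivialIso hAB,
      fun _ _ _ h x y => cohomologyMap_cup hAB.isSlice hAB.meets_right h x y,
      fun _ _ _ h x y => homologyMap_cap hAB.isSlice hAB.meets_right hD C.isCompact_domΓ h x y⟩
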